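/- Let $X=\{(x,y,z)\in\mathbb{C}^3 : xz=y^3\}$ be the affine model of the $A_2$ surface singularity, let $\sigma:\tilde X\to X$ be its minimal resolution, obtained as the strict transform of $X$ under the blow-up of $\mathbb{C}^3$ at the origin, and let $E=\sigma^{-1}(0)$ be the exceptional locus. For a complex surface $U$ and $m\ge 0$ let $H^0(U,S^m\Omega^1_U)$ be the space of holomorphic symmetric differentials of degree $m$ on $U$. (1) For every open neighbourhood $W$ of $E$ in $\tilde X$ (so, for every representative of the germ $(\tilde X,E)$) and every $m$, the vector space $H^0(W\setminus E,S^m\Omega^1_W)/H^0(W,S^m\Omega^1_W)$ is finite-dimensional, and $$h^0(x):=\lim_{m\to\infty}\frac{\dim\big[H^0(W\setminus E,S^m\Omega^1_W)/H^0(W,S^m\Omega^1_W)\big]}{m^3}=\frac{29}{216}.$$ (2) For every $m$ the vector space $H^1(\tilde X,S^m\Omega^1_{\tilde X})$ is finite-dimensional, and $$h^1(x):=\lim_{m\to\infty}\frac{\dim H^1(\tilde X,S^m\Omega^1_{\tilde X})}{m^3}=\frac{67}{216}.$$ Here $H^1(\tilde X,S^m\Omega^1_{\tilde X})$ is computed as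 the first Čech cohomology of the sheaf of holomorphic sections of $S^m\Omega^1_{\tilde X}$ for the cover of $\tilde X$ by the three standard charts of the blow-up (where the first, second or third homogeneous coordinate of the line is non-zero), each of which is biholomorphic to $\mathbb{C}^2$, with Stein intersections. -/

import Mathlib

open Set Filter Topology Manifold ContDiff TopologicalSpace
open scoped LinearAlgebra.Projectivization

noncomputable section

/-! ### Holomorphic symmetric differentials on a complex manifold -/

namespace SymmetricDifferential

variable (E : Type*) [NormedAddCommGroup E] [NormedSpace ℂ E]
  {M : Type*} [TopologicalSpace M] [ChartedSpace E M] [IsManifold 𝓘(ℂ, E) ω M]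

/-- The total space of the holomorphic tangent bundle of the open subset `U` of `M`, as an open
subset of the total space of the tangent bundle of `M`. -/
def tangentOver (U : Opens M) : Opens (TangentBundle 𝓘(ℂ, E) M) :=
  ⟨{v | v.proj ∈ U}, U.isOpen.preimage (FiberBundle.continuous_proj E (TangentSpace 𝓘(ℂ, E)))⟩

/-- The point `(p, v)` of the tangent bundle of `U`, for `p ∈ U` and `v` a tangent vector at `p`. -/
def tangentPt {U : Opens M} (p : U) (v : TangentSpace 𝓘(ℂ, E) (p : M)) : tangentOver E U :=
  ⟨⟨p, v⟩, p.2⟩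

/-- `H⁰(U, SᵐΩ¹)`: the holomorphic symmetric differentials of degree `m` on the open set `U`.
The fibre of `SᵐΩ¹` at `p` is the space of homogeneous polynomials of degree `m` on the tangent
space at `p`, that is, of the maps `v ↦ A(v, …, v)` with `A` an `m`-linear form. A section of
`SᵐΩ¹` over `U` is therefore a function on the tangent bundle of `U` that is such a polynomial on
each tangent space, and it is a holomorphic section if and only if the function is holomorphic. -/
def sections (m : ℕ) (U : Opens M) : Submodule ℂ (tangentOver E U → ℂ) where
  carrier := {f | MDifferentiable 𝓘(ℂ, E).tangent 𝓘(ℂ, ℂ) f ∧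
    ∀ p : U, ∃ A : MultilinearMap ℂ (fun _ : Fin m => TangentSpace 𝓘(ℂ, E) (p : M)) ℂ,
      ∀ v, f (tangentPt E p v) = A fun _ => v}
  add_mem' := by
    rintro f g ⟨hf, hf'⟩ ⟨hg, hg'⟩
    refine ⟨hf.add hg, fun p => ?_⟩
    obtain ⟨A, hA⟩ := hf' p
    obtain ⟨B, hB⟩ := hg' p
    exact ⟨A + B, fun v => by simp [hA, hB]⟩
  zero_mem' := ⟨mdifferentiable_const, fun _ => ⟨0, fun _ => rfl⟩⟩
  smul_mem' := by
    rintro c f ⟨hf, hf'⟩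
    refine ⟨hf.const_smul c, fun p => ?_⟩
    obtain ⟨A, hA⟩ := hf' p
    exact ⟨c • A, fun v => by simp [hA]⟩

/-- The restriction map `H⁰(V, SᵐΩ¹) → H⁰(U, SᵐΩ¹)` for `U ⊆ V`. -/
def restrict (m : ℕ) {U V : Opens M} (h : U ≤ V) :
    sections E m V →ₗ[ℂ] sections E m U where
  toFun f := ⟨fun v => f.1 ⟨v.1, h v.2⟩, by
    have hUV : tangentOver E U ≤ tangentOver E V := fun v hv => h hv
    refine ⟨f.2.1.comp ((contMDiff_inclusion (n := 1) hUV).mdifferentiable one_ne_zero),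
      fun p => ?_⟩
    exact f.2.2 ⟨p.1, h p.2⟩⟩
  map_add' _ _ := rfl
  map_smul' _ _ := rfl

/-- For a closed set `Z` (given by the open set `Zc`, its complement) and an open set `W`, the
quotient `H⁰(W ∖ Z, SᵐΩ¹) / H⁰(W, SᵐΩ¹)`. -/
abbrev ExtensionQuotient (m : ℕ) (W Zc : Opens M) : Type _ :=
  sections E m (W ⊓ Zc) ⧸
    LinearMap.range (restrict E m (inf_le_left : W ⊓ Zc ≤ W))

section Cech

variable {ι : Type*}

/-- The Čech 0-cochains of `SᵐΩ¹` for a family of open sets. -/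
def Cochain0 (m : ℕ) (𝒰 : ι → Opens M) : Type _ := ∀ i, sections E m (𝒰 i)

/-- The Čech 1-cochains of `SᵐΩ¹` for a family of open sets. -/
def Cochain1 (m : ℕ) (𝒰 : ι → Opens M) : Type _ := ∀ i j, sections E m (𝒰 i ⊓ 𝒰 j)

/-- The Čech 2-cochains of `SᵐΩ¹` for a family of open sets. -/
def Cochain2 (m : ℕ) (𝒰 : ι → Opens M) : Type _ := ∀ i j k, sections E m (𝒰 i ⊓ 𝒰 j ⊓ 𝒰 k)

instance (m : ℕ) (𝒰 : ι → Opens M) : AddCommGroup (Cochain0 E m 𝒰) :=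
  inferInstanceAs (AddCommGroup (∀ i, sections E m (𝒰 i)))

instance (m : ℕ) (𝒰 : ι → Opens M) : Module ℂ (Cochain0 E m 𝒰) :=
  inferInstanceAs (Module ℂ (∀ i, sections E m (𝒰 i)))

instance (m : ℕ) (𝒰 : ι → Opens M) : AddCommGroup (Cochain1 E m 𝒰) :=
  inferInstanceAs (AddCommGroup (∀ i j, sections E m (𝒰 i ⊓ 𝒰 j)))

instance (m : ℕ) (𝒰 : ι → Opens M) : Module ℂ (Cochain1 E m 𝒰) :=
  inferInstanceAs (Module ℂ (∀ i j, sections E m (𝒰 i ⊓ 𝒰 j)))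

instance (m : ℕ) (𝒰 : ι → Opens M) : AddCommGroup (Cochain2 E m 𝒰) :=
  inferInstanceAs (AddCommGroup (∀ i j k, sections E m (𝒰 i ⊓ 𝒰 j ⊓ 𝒰 k)))

instance (m : ℕ) (𝒰 : ι → Opens M) : Module ℂ (Cochain2 E m 𝒰) :=
  inferInstanceAs (Module ℂ (∀ i j k, sections E m (𝒰 i ⊓ 𝒰 j ⊓ 𝒰 k)))

/-- The Čech coboundary `(sᵢ) ↦ (sⱼ - sᵢ)`, from 0-cochains to 1-cochains. -/
def cechD0 (m : ℕ) (𝒰 : ι → Opens M) : Cochain0 E m 𝒰 →ₗ[ℂ] Cochain1 E m 𝒰 where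
  toFun s i j := restrict E m inf_le_right (s j) - restrict E m inf_le_left (s i)
  map_add' s t := by
    funext i j
    change restrict E m _ (s j + t j) - restrict E m _ (s i + t i) = (_ - _) + (_ - _)
    simp only [map_add]
    abel
  map_smul' c s := by
    funext i j
    change restrict E m _ (c • s j) - restrict E m _ (c • s i) = c • (_ - _)
    simp only [map_smul, smul_sub]

/-- The Čech coboundary `(sᵢⱼ) ↦ (sⱼₖ - sᵢₖ + sᵢⱼ)`, from 1-cochains to 2-cochains. -/
def cechD1 (m : ℕ) (𝒰 : ι → Opens M) : Cochain1 E m 𝒰 →ₗ[ℂ] Cochain2 E m 𝒰 where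
  toFun s i j k :=
    restrict E m (le_inf (inf_le_left.trans inf_le_right) inf_le_right) (s j k) -
      restrict E m (le_inf (inf_le_left.trans inf_le_left) inf_le_right) (s i k) +
      restrict E m inf_le_left (s i j)
  map_add' s t := by
    funext i j k
    change restrict E m _ (s j k + t j k) - restrict E m _ (s i k + t i k) +
      restrict E m _ (s i j + t i j) = (_ - _ + _) + (_ - _ + _)
    simp only [map_add]
    abel
  map_smul' c s := by
    funext i j k
    change restrict E m _ (c • s j k) - restrict E m _ (c • s i k) +
      restrict E m _ (c • s i j) = c • (_ - _ + _)
    simp only [map_smul, smul_add, smul_sub]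

/-- The first Čech cohomology group of `SᵐΩ¹` for a family of open sets: 1-cocycles modulo
1-coboundaries. If the open sets form a locally finite cover of `M` and are Stein, this is
`H¹(M, SᵐΩ¹)`. -/
abbrev CechH1 (m : ℕ) (𝒰 : ι → Opens M) : Type _ :=
  LinearMap.ker (cechD1 E m 𝒰) ⧸
    (LinearMap.range (cechD0 E m 𝒰)).submoduleOf (LinearMap.ker (cechD1 E m 𝒰))

end Cech

end SymmetricDifferential

/-! ### The minimal resolution of the `A₂` singularity -/

/-- The affine model of the `A₂` singularity: the surface `xz = y³` in `ℂ³`, singular at `0`. -/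
def A2Surface : Set (Fin 3 → ℂ) := {p | p 0 * p 2 = p 1 ^ 3}

/-- The minimal resolution of the `A₂` singularity: the strict transform of the surface `xz = y³`
under the blow-up of `ℂ³` at the origin. The blow-up consists of the pairs of a point `pt` and a
line `line` through `0` that contains it; on it the strict transform is given by `v₀ v₂ = y v₁²`
for `v` in the line (where `v` is a multiple of the point, this is the equation `xz = y³`, with
the equation of the exceptional plane divided out). -/
@[ext]
structure A2Resolution where
  /-- the point of `ℂ³` -/
  pt : Fin 3 → ℂ
  /-- the line through the origin -/
  line : ℙ ℂ (Fin 3 → ℂ)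
  pt_mem : pt ∈ line.submodule
  eqn : ∀ v ∈ line.submodule, v 0 * v 2 = pt 1 * v 1 ^ 2

namespace A2Resolution

/-- The resolution map `σ`. -/
def sigma (q : A2Resolution) : A2Surface :=
  ⟨q.pt, by have := q.eqn q.pt q.pt_mem; simp only [A2Surface, mem_ofPred_eq, this]; ring⟩

/-- The direction vector of the line with `j`-th coordinate `1`, in the `j`-th chart. -/
def vec : Fin 3 → ℂ × ℂ → Fin 3 → ℂ
  | 0, c => ![1, c.2, c.1 * c.2 ^ 3]
  | 1, c => ![c.1, 1, c.2]
  | 2, c => ![c.1 ^ 3 * c.2, c.1, 1]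

/-- The point is `scale j c • vec j c` in the `j`-th chart. -/
def scale : Fin 3 → ℂ × ℂ → ℂ
  | 0, c => c.1
  | 1, c => c.1 * c.2
  | 2, c => c.2

lemma vec_self (j : Fin 3) (c : ℂ × ℂ) : vec j c j = 1 := by
  fin_cases j <;> simp [vec]

lemma vec_ne_zero (j : Fin 3) (c : ℂ × ℂ) : vec j c ≠ 0 := fun h => by
  have := vec_self j c
  simp [h] at this

/-- The inverse of the `j`-th chart. -/
def param (j : Fin 3) (c : ℂ × ℂ) : A2Resolution where
  pt := scale j c • vec j c
  line := Projectivization.mk ℂ (vec j c) (vec_ne_zero j c)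
  pt_mem := Submodule.smul_mem _ _ (Submodule.mem_span_singleton_self _)
  eqn := by
    intro v hv
    rw [Projectivization.submodule_mk, Submodule.mem_span_singleton] at hv
    obtain ⟨t, rfl⟩ := hv
    fin_cases j <;> simp [vec, scale] <;> ring

/-- The coordinates in the `j`-th chart: `(x, y/x)`, `(x/y, z/y)` and `(y/z, z)`, where the
quotients are those of the homogeneous coordinates of the line. -/
def coord : Fin 3 → A2Resolution → ℂ × ℂ
  | 0, q => (q.pt 0, q.line.rep 1 / q.line.rep 0)
  | 1, q => (q.line.rep 0 / q.line.rep 1, q.line.rep 2 / q.line.rep 1)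
  | 2, q => (q.line.rep 1 / q.line.rep 2, q.pt 2)

lemma rep_param (j : Fin 3) (c : ℂ × ℂ) :
    ∃ t : ℂ, t ≠ 0 ∧ (param j c).line.rep = t • vec j c := by
  obtain ⟨t, ht⟩ := Projectivization.exists_smul_eq_mk_rep ℂ (vec j c) (vec_ne_zero j c)
  exact ⟨t, t.ne_zero, ht.symm⟩

lemma rep_param_ne_zero_iff (i j : Fin 3) (c : ℂ × ℂ) :
    (param i c).line.rep j ≠ 0 ↔ vec i c j ≠ 0 := by
  obtain ⟨t, ht, h⟩ := rep_param i c
  simp [h, ht]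

lemma ratio_param (i j k : Fin 3) (c : ℂ × ℂ) :
    (param i c).line.rep k / (param i c).line.rep j = vec i c k / vec i c j := by
  obtain ⟨t, ht, h⟩ := rep_param i c
  simp [h, mul_div_mul_left _ _ ht]

lemma param_coord (j : Fin 3) (q : A2Resolution) (hq : q.line.rep j ≠ 0) :
    param j (coord j q) = q := by
  have hm := q.pt_mem
  rw [Projectivization.submodule_eq, Submodule.mem_span_singleton] at hm
  obtain ⟨t, ht⟩ := hm
  have he := q.eqn q.line.rep
    (by rw [Projectivization.submodule_eq]; exact Submodule.mem_span_singleton_self _)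
  have hp : ∀ i, q.pt i = t * q.line.rep i := fun i => by rw [← ht]; simp
  rw [hp] at he
  have hs : scale j (coord j q) = t * q.line.rep j := by
    fin_cases j
    · simp [scale, coord, hp]
    · simp only [scale, coord, Fin.mk_one] at hq ⊢
      field_simp
      linear_combination he
    · simp [scale, coord, hp]
  have hv : vec j (coord j q) = (q.line.rep j)⁻¹ • q.line.rep := by
    fin_cases j
    · ext k
      fin_cases k <;> simp [vec, coord, hp] at hq ⊢ <;> field_simp
      linear_combination -he
    · ext k
      fin_cases k <;> simp [vec, coord] at hq ⊢ <;> field_simp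
    · ext k
      fin_cases k <;> simp [vec, coord, hp] at hq ⊢ <;> field_simp
      linear_combination -he
  ext1
  · simp only [param, hs, hv, smul_smul]
    rw [mul_assoc, mul_inv_cancel₀ hq, mul_one, ht]
  · simp only [param]
    conv_rhs => rw [← Projectivization.mk_rep q.line]
    rw [Projectivization.mk_eq_mk_iff']
    exact ⟨_, hv.symm⟩

lemma coord_param (j : Fin 3) (c : ℂ × ℂ) : coord j (param j c) = c := by
  fin_cases j <;> simp [coord, ratio_param] <;> simp [param, vec, scale]

/-- The `j`-th chart: the points whose line has non-zero `j`-th homogeneous coordinate are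
parametrized by `ℂ²`. -/
def chart (j : Fin 3) : PartialEquiv A2Resolution (ℂ × ℂ) where
  toFun := coord j
  invFun := param j
  source := {q | q.line.rep j ≠ 0}
  target := univ
  map_source' _ _ := mem_univ _
  map_target' c _ := by
    simp only [mem_ofPred_eq, rep_param_ne_zero_iff, vec_self]
    exact one_ne_zero
  left_inv' q hq := param_coord j q hq
  right_inv' c _ := coord_param j c

lemma contDiff_vec (i k : Fin 3) : ContDiff ℂ ω (fun c => vec i c k) := by
  fin_cases i <;> fin_cases k <;> simp [vec] <;> fun_prop

lemma contDiff_scale (i : Fin 3) : ContDiff ℂ ω (scale i) := by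
  fin_cases i
  · exact contDiff_fst
  · exact contDiff_fst.mul contDiff_snd
  · exact contDiff_snd

lemma transition_source (i j : Fin 3) :
    ((chart i).symm.trans (chart j)).source = {c | vec i c j ≠ 0} := by
  ext c
  simp only [PartialEquiv.trans_source, PartialEquiv.symm_source, chart, mem_inter_iff, mem_univ,
    true_and, mem_preimage, mem_ofPred_eq]
  exact rep_param_ne_zero_iff i j c

lemma contDiffOn_transition (i j : Fin 3) :
    ContDiffOn ℂ ω ((chart i).symm.trans (chart j)) ((chart i).symm.trans (chart j)).source := by
  rw [transition_source]
  have hr : ∀ k, ContDiffOn ℂ ω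
      (fun c => (param i c).line.rep k / (param i c).line.rep j) {c | vec i c j ≠ 0} := fun k => by
    simp only [ratio_param]
    exact (contDiff_vec i k).contDiffOn.div (contDiff_vec i j).contDiffOn fun c hc => hc
  have hp : ∀ k, ContDiffOn ℂ ω (fun c => (param i c).pt k) {c | vec i c j ≠ 0} := fun k =>
    ((contDiff_scale i).mul (contDiff_vec i k)).contDiffOn
  fin_cases j
  · exact (hp 0).prodMk (hr 1)
  · exact (hr 0).prodMk (hr 2)
  · exact (hr 1).prodMk (hp 2)

lemma exists_rep_ne_zero (q : A2Resolution) : ∃ j, q.line.rep j ≠ 0 := by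
  by_contra! h
  exact q.line.rep_nonzero (funext h)

/-- The three charts define the complex manifold structure. -/
def core : ChartedSpaceCore (ℂ × ℂ) A2Resolution where
  atlas := range chart
  chartAt q := chart (exists_rep_ne_zero q).choose
  mem_chart_source q := (exists_rep_ne_zero q).choose_spec
  chart_mem_atlas q := mem_range_self _
  open_source := by
    rintro _ _ ⟨i, rfl⟩ ⟨j, rfl⟩
    rw [transition_source]
    exact isOpen_ne_fun (contDiff_vec i j).continuous continuous_const
  continuousOn_toFun := by
    rintro _ _ ⟨i, rfl⟩ ⟨j, rfl⟩
    exact (contDiffOn_transition i j).continuousOn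

instance : TopologicalSpace A2Resolution := core.toTopologicalSpace

instance : ChartedSpace (ℂ × ℂ) A2Resolution := core.toChartedSpace

instance : IsManifold 𝓘(ℂ, ℂ × ℂ) ω A2Resolution := by
  refine isManifold_of_contDiffOn _ _ _ ?_
  intro e e' he he'
  obtain ⟨_, ⟨_, rfl⟩, he⟩ := he
  obtain ⟨_, ⟨⟨i, rfl⟩, rfl⟩, rfl⟩ := he
  obtain ⟨_, ⟨_, rfl⟩, he'⟩ := he'
  obtain ⟨_, ⟨⟨j, rfl⟩, rfl⟩, rfl⟩ := he'
  have := contDiffOn_transition i j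
  simp only [modelWithCornersSelf_coe, modelWithCornersSelf_coe_symm, Function.id_comp,
    Function.comp_id, preimage_id, range_id, inter_univ]
  exact this

/-- The domain of the `j`-th chart, an open subset biholomorphic to `ℂ²`. -/
def chartDomain (j : Fin 3) : Opens A2Resolution :=
  ⟨{q | q.line.rep j ≠ 0}, core.open_source' (mem_range_self j)⟩

/-- The exceptional locus `E`, the fibre of `σ` over the singular point. -/
def exceptional : Set A2Resolution := {q | (q.sigma : Fin 3 → ℂ) = 0}

lemma isOpen_compl_exceptional : IsOpen exceptionalᶜ := by
  have key : ∀ j, IsOpen {c | (param j c).pt ≠ 0} := fun j => by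
    have : Continuous fun c => (param j c).pt :=
      continuous_pi fun k => ((contDiff_scale j).mul (contDiff_vec j k)).continuous
    exact isOpen_ne_fun this continuous_const
  have : exceptionalᶜ = ⋃ j, chart j ⁻¹' {c | (param j c).pt ≠ 0} ∩ (chart j).source := by
    ext q
    simp only [mem_iUnion, mem_inter_iff, mem_preimage, mem_ofPred_eq]
    constructor
    · intro hq
      obtain ⟨j, hj⟩ := exists_rep_ne_zero q
      refine ⟨j, ?_, hj⟩
      change (param j (coord j q)).pt ≠ 0
      rw [param_coord j q hj]
      exact hq
    · rintro ⟨j, h, hj⟩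
      change (param j (coord j q)).pt ≠ 0 at h
      rw [param_coord j q hj] at h
      exact h
  rw [this]
  refine isOpen_iUnion fun j => ?_
  apply TopologicalSpace.GenerateOpen.basic
  simp only [mem_iUnion, mem_singleton_iff]
  exact ⟨chart j, mem_range_self j, _, key j, rfl⟩

/-- The complement of the exceptional locus, as an open set. -/
def regular : Opens A2Resolution := ⟨exceptionalᶜ, isOpen_compl_exceptional⟩

end A2Resolution

end

/-! ### Laurent series in two variables -/

namespace UnitAddTorus

open MeasureTheory

attribute [local instance] instMeasureSpaceUnitAddCircle

-- The resolution is toric. The torus is the set where both coordinates of a chart are non-zero; its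
-- complement consists of four divisors, numbered -1, 0, 1, 2. Chart `j` meets divisor `j` (first
-- coordinate zero) and divisor `j - 1` (second coordinate zero). Divisors 0 and 1 are the
-- components of E, while -1 and 2 are non-compact.
--
-- On the torus, SᵐΩ¹ is trivialised by the logarithmic forms u = dlog y and v = dlog (x/y). A
-- symmetric differential therefore has a Laurent expansion whose term of weight n = (a, b) is y^a
-- (x/y)^b times a binary form of degree m in u, v, stored as a polynomial p in t = v/u. The
-- monomial has order a + rb along divisor r. There v - ru has no pole, while a complementary
-- logarithmic form has a simple one, so the term is regular along divisor r exactly when p vanishes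
-- at t = r to order max(0, m - a - rb) (`HasExpansion.mem_reg`, `chartCoeff_eq_zero_of_reg`).
-- Vanishing conditions at distinct points are independent, so each space of admissible p has
-- dimension m + 1 minus the total order, truncated at 0.
--
-- Both quotients then split into finite-dimensional problems, one for each weight. Write V_r for
-- the forms regular along divisor r. A differential on W ∖ E has its coefficients in V₋₁ ∩ V₂ and
-- extends over E exactly when they also lie in V₀ ∩ V₁ (`finrank_extensionQuotient`). In the Čech
-- complex, charts 0 and 1 share only divisor 0 outside the torus, charts 1 and 2 share only divisor
-- 1, and charts 0 and 2 share nothing. Hence H¹ in weight n is the cokernel of the map (V₋₁ ∩ V₀) ×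
-- (V₀ ∩ V₁) × (V₁ ∩ V₂) → V₀ × V₁ of consecutive differences, with kernel V₋₁ ∩ V₀ ∩ V₁ ∩ V₂
-- (`finrank_cechH1`). Only weights in a box of size O(m) contribute.
--
-- The analytic work is to move between differentials and coefficients. Cauchy estimates turn
-- holomorphy along a divisor into vanishing. Conversely, a series of regular terms that converges
-- at one torus point of a chart converges on the bidisc below it. For Čech coboundaries the
-- primitives need bounds uniform in the weight (`exists_primitive_bound`). An arbitrary W is
-- reduced to a Reinhardt tube around E.
--
-- After scaling by m, the sums of dimensions become Riemann sums of the piecewise linear functions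
-- `wedge` (`tendsto_sum_count`), and the two limits are combinations of explicit integrals.

local instance : IsProbabilityMeasure (volume : Measure UnitAddCircle) :=
  inferInstanceAs (IsProbabilityMeasure AddCircle.haarAddCircle)

lemma integral_mFourier {d : Type*} [Fintype d] (n : d → ℤ) :
    ∫ z, mFourier n z = if n = 0 then 1 else 0 := by
  classical
  have := orthonormal_iff_ite.mp (orthonormal_mFourier (d := d)) 0 n
  simp only [ContinuousMap.inner_toLp, ← mFourier_neg, ← mFourier_add] at this
  simpa [eq_comm] using this

lemma norm_mFourier_apply {d : Type*} [Fintype d] (n : d → ℤ) (z : UnitAddTorus d) :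
    ‖mFourier n z‖ = 1 := by
  simp [mFourier, fourier_apply, norm_prod, Circle.norm_coe]

/-- Characters have modulus 1, so convergence at a single point already gives absolute summability
of the coefficients, and the series may be integrated term by term against a character. -/
lemma mFourierCoeff_of_hasSum {d : Type*} [Fintype d] {b : (d → ℤ) → ℂ}
    {g : UnitAddTorus d → ℂ} (h : ∀ z, HasSum (fun n => b n * mFourier n z) (g z)) (n : d → ℤ) :
    mFourierCoeff g n = b n := by
  classical
  have hb : Summable fun n => ‖b n‖ := by
    refine (h 0).summable.norm.congr fun n => ?_
    rw [norm_mul, norm_mFourier_apply, mul_one]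
  have hs : ∀ z, HasSum (fun k => b k * mFourier (k - n) z) (mFourier (-n) z • g z) := fun z => by
    refine ((h z).mul_left (mFourier (-n) z)).congr_fun fun k => ?_
    rw [sub_eq_add_neg, mFourier_add]
    ring
  have hi : ∀ k, Integrable (fun z => b k * mFourier (k - n) z) := fun k =>
    (Continuous.integrable_of_hasCompactSupport (by fun_prop)
      (HasCompactSupport.of_compactSpace _))
  have hsum := hasSum_integral_of_summable_integral_norm hi (by
    simpa only [norm_mul, norm_mFourier_apply, mul_one, integral_const, probReal_univ, one_smul]
      using hb)
  have he : ∀ z, ∑' k, b k * mFourier (k - n) z = mFourier (-n) z • g z := fun z => (hs z).tsum_eq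
  simp only [he, integral_const_mul, integral_mFourier, sub_eq_zero, mul_ite, mul_one,
    mul_zero] at hsum
  exact hsum.unique (hasSum_ite_eq' n (b n) |>.congr_fun fun k => by
    rcases eq_or_ne k n with rfl | hk
    · simp
    · simp [hk, hk.symm])

lemma norm_mFourierCoeff_le {d : Type*} [Fintype d] {g : UnitAddTorus d → ℂ} {M : ℝ}
    (h : ∀ z, ‖g z‖ ≤ M) (n : d → ℤ) : ‖mFourierCoeff g n‖ ≤ M := by
  refine (norm_integral_le_of_norm_le_const (C := M) (ae_of_all _ fun z => ?_)).trans ?_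
  · rw [norm_smul, norm_mFourier_apply, one_mul]
    exact h z
  · simp

end UnitAddTorus

/-! ### Laurent expansions of holomorphic functions on Reinhardt domains -/

namespace Laurent

open UnitAddTorus MeasureTheory

attribute [local instance] instMeasureSpaceUnitAddCircle

local instance : IsProbabilityMeasure (volume : Measure UnitAddCircle) :=
  inferInstanceAs (IsProbabilityMeasure AddCircle.haarAddCircle)

/-- The point with polar coordinates `ρ` and `z`. -/
noncomputable def torusPt (ρ : ℝ × ℝ) (z : UnitAddTorus (Fin 2)) : ℂ × ℂ :=
  (ρ.1 * fourier 1 (z 0), ρ.2 * fourier 1 (z 1))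

lemma continuous_torusPt (ρ : ℝ × ℝ) : Continuous (torusPt ρ) := by
  unfold torusPt
  fun_prop

lemma norm_torusPt_fst {ρ : ℝ × ℝ} (h : 0 ≤ ρ.1) (z) : ‖(torusPt ρ z).1‖ = ρ.1 := by
  simp [torusPt, fourier_apply, Circle.norm_coe, abs_of_nonneg h]

lemma norm_torusPt_snd {ρ : ℝ × ℝ} (h : 0 ≤ ρ.2) (z) : ‖(torusPt ρ z).2‖ = ρ.2 := by
  simp [torusPt, fourier_apply, Circle.norm_coe, abs_of_nonneg h]

lemma fourier_one_zpow {T : ℝ} (k : ℤ) (x : AddCircle T) : (fourier 1 x : ℂ) ^ k = fourier k x := by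
  simp only [fourier_apply, one_smul, AddCircle.toCircle_zsmul, Circle.coe_zpow]

lemma exists_torusPt (s : ℂ × ℂ) : ∃ z, torusPt (‖s.1‖, ‖s.2‖) z = s := by
  have key : ∀ w : ℂ, ∃ x : AddCircle (1 : ℝ), (‖w‖ : ℂ) * fourier 1 x = w := fun w => by
    refine ⟨((w.arg / (2 * Real.pi) : ℝ) : AddCircle (1 : ℝ)), ?_⟩
    rw [fourier_coe_apply]
    conv_rhs => rw [← Complex.norm_mul_exp_arg_mul_I w]
    congr 2
    push_cast
    have : (Real.pi : ℂ) ≠ 0 := by exact_mod_cast Real.pi_ne_zero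
    field_simp
  obtain ⟨x, hx⟩ := key s.1
  obtain ⟨y, hy⟩ := key s.2
  exact ⟨![x, y], Prod.ext hx hy⟩

/-- The Laurent monomial with exponents `n`. -/
noncomputable def mon (n : ℤ × ℤ) (s : ℂ × ℂ) : ℂ := s.1 ^ n.1 * s.2 ^ n.2

lemma mon_torusPt (ρ : ℝ × ℝ) (n : ℤ × ℤ) (z) :
    mon n (torusPt ρ z) = (ρ.1 : ℂ) ^ n.1 * (ρ.2 : ℂ) ^ n.2 * mFourier ![n.1, n.2] z := by
  simp only [mon, torusPt, mul_zpow, fourier_one_zpow, mFourier, ContinuousMap.coe_mk,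
    Fin.prod_univ_two, Matrix.cons_val_zero, Matrix.cons_val_one]
  ring

lemma norm_mon (n : ℤ × ℤ) (s : ℂ × ℂ) : ‖mon n s‖ = ‖s.1‖ ^ n.1 * ‖s.2‖ ^ n.2 := by
  simp [mon]

/-- The coefficients of a Laurent series, as Fourier coefficients of its sum. -/
lemma coeff_eq {a : ℤ × ℤ → ℂ} {g : ℂ × ℂ → ℂ} {ρ : ℝ × ℝ}
    (h : ∀ z, HasSum (fun n => a n * mon n (torusPt ρ z)) (g (torusPt ρ z))) (n : ℤ × ℤ) :
    a n * ((ρ.1 : ℂ) ^ n.1 * (ρ.2 : ℂ) ^ n.2) =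
      mFourierCoeff (fun z => g (torusPt ρ z)) ![n.1, n.2] := by
  set b : (Fin 2 → ℤ) → ℂ := fun n => a (n 0, n 1) * ((ρ.1 : ℂ) ^ n 0 * (ρ.2 : ℂ) ^ n 1) with hb
  have := mFourierCoeff_of_hasSum (b := b) (g := fun z => g (torusPt ρ z)) (fun z => by
    rw [← (finTwoArrowEquiv ℤ).symm.hasSum_iff]
    refine (h z).congr_fun fun k => ?_
    simp [hb, mon_torusPt]
    ring) ![n.1, n.2]
  rw [this]
  simp [hb]

/-- Cauchy's estimate: up to the power of the radii, the coefficient is a Fourier coefficient of `g`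
on the torus of radii `ρ`. -/
lemma norm_coeff_le {a : ℤ × ℤ → ℂ} {g : ℂ × ℂ → ℂ} {ρ : ℝ × ℝ} {M : ℝ} (h1 : 0 ≤ ρ.1)
    (h2 : 0 ≤ ρ.2) (h : ∀ z, HasSum (fun n => a n * mon n (torusPt ρ z)) (g (torusPt ρ z)))
    (hM : ∀ z, ‖g (torusPt ρ z)‖ ≤ M) (n : ℤ × ℤ) : ‖a n‖ * (ρ.1 ^ n.1 * ρ.2 ^ n.2) ≤ M := by
  have := norm_mFourierCoeff_le hM ![n.1, n.2]
  rw [← coeff_eq h] at this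
  simpa [abs_of_nonneg, h1, h2] using this

lemma coeff_unique {a b : ℤ × ℤ → ℂ} {g : ℂ × ℂ → ℂ} {ρ : ℝ × ℝ} (h1 : 0 < ρ.1) (h2 : 0 < ρ.2)
    (ha : ∀ z, HasSum (fun n => a n * mon n (torusPt ρ z)) (g (torusPt ρ z)))
    (hb : ∀ z, HasSum (fun n => b n * mon n (torusPt ρ z)) (g (torusPt ρ z))) : a = b := by
  funext n
  have := (coeff_eq ha n).trans (coeff_eq hb n).symm
  refine mul_right_cancel₀ ?_ this
  have h1' : (ρ.1 : ℂ) ≠ 0 := by exact_mod_cast h1.ne'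
  have h2' : (ρ.2 : ℂ) ≠ 0 := by exact_mod_cast h2.ne'
  positivity

lemma integral_haarAddCircle (f : AddCircle (1 : ℝ) → ℂ) :
    ∫ x, f x ∂AddCircle.haarAddCircle = ∫ x in (0 : ℝ)..1, f x := by
  have := AddCircle.intervalIntegral_preimage (1 : ℝ) 0 f
  rw [AddCircle.volume_eq_smul_haarAddCircle, zero_add] at this
  simpa using this.symm

/-- The mean over a circle does not depend on its radius. -/
lemma integral_circle_eq {h : ℂ → ℂ} {R r r' : ℝ} (hr : 0 < r) (hrr : r ≤ r') (hR : r' < R)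
    (hh : DifferentiableOn ℂ h {s | 0 < ‖s‖ ∧ ‖s‖ < R}) :
    ∫ x : UnitAddCircle, h (r' * fourier 1 x) ∂AddCircle.haarAddCircle =
      ∫ x : UnitAddCircle, h (r * fourier 1 x) ∂AddCircle.haarAddCircle := by
  have ho : IsOpen {s : ℂ | 0 < ‖s‖ ∧ ‖s‖ < R} :=
    (isOpen_lt continuous_const continuous_norm).inter (isOpen_lt continuous_norm continuous_const)
  -- With θ = 2πx the mean becomes the contour integral of h(z)/z divided by 2πi, which Cauchy's
  -- theorem on the annulus makes independent of the radius.
  have key : ∀ r : ℝ, 0 < r → ∫ x : UnitAddCircle, h (r * fourier 1 x) ∂AddCircle.haarAddCircle =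
      (2 * Real.pi * Complex.I)⁻¹ * ∮ z in C(0, r), (z - 0)⁻¹ • h z := fun r hr => by
    rw [integral_haarAddCircle, circleIntegral]
    have e : ∀ θ : ℝ, deriv (circleMap 0 r) θ • (circleMap 0 r θ - 0)⁻¹ • h (circleMap 0 r θ) =
        Complex.I * h (circleMap 0 r θ) := fun θ => by
      have : circleMap 0 r θ ≠ 0 := circleMap_ne_center hr.ne'
      simp only [deriv_circleMap, smul_eq_mul, sub_zero]
      field_simp
    simp only [e, intervalIntegral.integral_const_mul]
    have e2 : ∀ x : ℝ, h (r * fourier 1 (x : AddCircle (1 : ℝ))) =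
        h (circleMap 0 r (2 * Real.pi * x)) := fun x => by
      rw [fourier_coe_apply, circleMap]
      congr 1
      push_cast
      simp
      left; ring_nf
    simp only [e2]
    rw [intervalIntegral.integral_comp_mul_left (fun θ => h (circleMap 0 r θ))
      (by positivity : (2 * Real.pi) ≠ 0)]
    have hpi : (Real.pi : ℂ) ≠ 0 := by exact_mod_cast Real.pi_ne_zero
    simp only [mul_zero, mul_one, Complex.real_smul]
    push_cast
    field_simp
  rw [key r hr, key r' (hr.trans_le hrr)]
  congr 1
  refine Complex.circleIntegral_sub_center_inv_smul_eq_of_differentiable_on_annulus_off_countable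
    hr hrr countable_empty (hh.continuousOn.mono ?_) fun z hz => hh.differentiableAt ?_
  · rintro z ⟨h1, h2⟩
    simp only [mem_closedBall_zero_iff, Metric.mem_ball, dist_zero_right, not_lt] at h1 h2
    exact ⟨hr.trans_le h2, h1.trans_lt hR⟩
  · refine ho.mem_nhds ?_
    obtain ⟨⟨h1, h2⟩, -⟩ := hz
    simp only [mem_closedBall_zero_iff, Metric.mem_ball, dist_zero_right, not_le] at h1 h2
    exact ⟨hr.trans h2, h1.trans hR⟩

/-- The punctured bidisc of radii `R`. -/
def bidisc (R : ℝ × ℝ) : Set (ℂ × ℂ) :=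
  {s | (0 < ‖s.1‖ ∧ ‖s.1‖ < R.1) ∧ (0 < ‖s.2‖ ∧ ‖s.2‖ < R.2)}

lemma torusPt_mem_bidisc {R ρ : ℝ × ℝ} (h1 : 0 < ρ.1) (h1' : ρ.1 < R.1) (h2 : 0 < ρ.2)
    (h2' : ρ.2 < R.2) (z) : torusPt ρ z ∈ bidisc R := by
  simp only [bidisc, mem_ofPred_eq, norm_torusPt_fst h1.le, norm_torusPt_snd h2.le]
  exact ⟨⟨h1, h1'⟩, h2, h2'⟩

lemma integral_torus_eq {h : ℂ × ℂ → ℂ} {R ρ ρ' : ℝ × ℝ} (hh : DifferentiableOn ℂ h (bidisc R))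
    (h1 : 0 < ρ.1) (h1' : ρ.1 ≤ ρ'.1) (h1R : ρ'.1 < R.1) (h2 : 0 < ρ.2) (h2' : ρ.2 ≤ ρ'.2)
    (h2R : ρ'.2 < R.2) :
    ∫ z, h (torusPt ρ' z) = ∫ z, h (torusPt ρ z) := by
  have prod : ∀ ρ : ℝ × ℝ, ∫ z, h (torusPt ρ z) =
      ∫ z : UnitAddCircle × UnitAddCircle, h (ρ.1 * fourier 1 z.1, ρ.2 * fourier 1 z.2) := by
    intro ρ
    rw [← (volume_preserving_finTwoArrow UnitAddCircle).integral_comp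
      (MeasurableEquiv.measurableEmbedding _)]
    rfl
  have int : ∀ ρ : ℝ × ℝ, 0 < ρ.1 → ρ.1 < R.1 → 0 < ρ.2 → ρ.2 < R.2 →
      Integrable (fun z : UnitAddCircle × UnitAddCircle =>
        h (ρ.1 * fourier 1 z.1, ρ.2 * fourier 1 z.2)) := by
    intro ρ h1 h1' h2 h2'
    refine Continuous.integrable_of_hasCompactSupport ?_ (HasCompactSupport.of_compactSpace _)
    exact hh.continuousOn.comp_continuous (by fun_prop)
      fun z => torusPt_mem_bidisc h1 h1' h2 h2' ![z.1, z.2]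
  have hn : ∀ (r : ℝ) (x : UnitAddCircle), 0 < r → ‖(r : ℂ) * fourier 1 x‖ = r := fun r x hr => by
    simp [fourier_apply, Circle.norm_coe, abs_of_pos hr]
  -- Fubini allows the radii to be changed one at a time, each by the one-variable statement.
  trans ∫ z, h (torusPt (ρ.1, ρ'.2) z)
  · rw [prod, prod, Measure.volume_eq_prod, integral_prod_symm _ (int ρ' (by linarith)
      h1R (by linarith) h2R), integral_prod_symm _ (int (ρ.1, ρ'.2) h1 (by simp; linarith)
      (by simp; linarith) h2R)]
    congr 1
    ext y
    refine integral_circle_eq (h := fun s => h (s, ρ'.2 * fourier 1 y)) (R := R.1) h1 h1' h1R ?_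
    refine hh.comp (by fun_prop) fun s hs => ⟨hs, ?_⟩
    rw [hn _ _ (by linarith)]
    exact ⟨by linarith, h2R⟩
  · rw [prod, prod, Measure.volume_eq_prod, integral_prod _ (int (ρ.1, ρ'.2) h1 (by simp; linarith)
      (by simp; linarith) h2R), integral_prod _ (int ρ h1 (by linarith) h2 (by linarith))]
    congr 1
    ext x
    refine integral_circle_eq (h := fun s => h (ρ.1 * fourier 1 x, s)) (R := R.2) h2 h2' h2R ?_
    refine hh.comp (by fun_prop) fun s hs => ⟨?_, hs⟩
    rw [hn _ _ h1]
    exact ⟨h1, by linarith⟩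

lemma differentiableOn_mon (n : ℤ × ℤ) (R : ℝ × ℝ) : DifferentiableOn ℂ (mon n) (bidisc R) := by
  intro s hs
  have h1 : s.1 ≠ 0 := norm_pos_iff.mp hs.1.1
  have h2 : s.2 ≠ 0 := norm_pos_iff.mp hs.2.1
  unfold mon
  exact ((differentiableAt_fst.zpow (.inl h1)).mul
    (differentiableAt_snd.zpow (.inl h2))).differentiableWithinAt

lemma summable_geometric_abs {r : ℝ} (h0 : 0 < r) (h1 : r < 1) :
    Summable fun n : ℤ × ℤ => r ^ n.1.natAbs * r ^ n.2.natAbs := by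
  have h : Summable fun n : ℤ => r ^ n.natAbs := by
    rw [summable_int_iff_summable_nat_and_neg]
    simpa using summable_geometric_of_lt_one h0.le h1
  exact h.mul_of_nonneg h (fun n => by positivity) fun n => by positivity

/-- A holomorphic function on a punctured bidisc has a Laurent expansion. -/
theorem exists_hasSum_bidisc {g : ℂ × ℂ → ℂ} {R : ℝ × ℝ} (h1 : 0 < R.1) (h2 : 0 < R.2)
    (hg : DifferentiableOn ℂ g (bidisc R)) :
    ∃ a : ℤ × ℤ → ℂ, ∀ s ∈ bidisc R, HasSum (fun n => a n * mon n s) (g s) := by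
  set ρ₀ : ℝ × ℝ := (R.1 / 2, R.2 / 2) with hρ₀
  set c : ℝ × ℝ → ℤ × ℤ → ℂ := fun ρ n => ∫ z, g (torusPt ρ z) * mon (-n) (torusPt ρ z) with hc
  have hcc : ∀ ρ ρ' : ℝ × ℝ, 0 < ρ.1 → ρ.1 < R.1 → 0 < ρ.2 → ρ.2 < R.2 → 0 < ρ'.1 → ρ'.1 < R.1 →
      0 < ρ'.2 → ρ'.2 < R.2 → c ρ = c ρ' := by
    intro ρ ρ' a1 a2 a3 a4 b1 b2 b3 b4
    funext n
    have hd := hg.mul (differentiableOn_mon (-n) R)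
    -- `ρ` and `ρ'` need not be comparable, so both are compared with their componentwise minimum.
    have A := integral_torus_eq hd (ρ := (min ρ.1 ρ'.1, min ρ.2 ρ'.2)) (ρ' := ρ)
      (lt_min a1 b1) (min_le_left _ _) a2 (lt_min a3 b3) (min_le_left _ _) a4
    have B := integral_torus_eq hd (ρ := (min ρ.1 ρ'.1, min ρ.2 ρ'.2)) (ρ' := ρ')
      (lt_min a1 b1) (min_le_right _ _) b2 (lt_min a3 b3) (min_le_right _ _) b4
    exact A.trans B.symm
  have hF : ∀ ρ : ℝ × ℝ, 0 < ρ.1 → ρ.1 < R.1 → 0 < ρ.2 → ρ.2 < R.2 → ∀ n : ℤ × ℤ,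
      mFourierCoeff (fun z => g (torusPt ρ z)) ![n.1, n.2] =
        c ρ₀ n * ((ρ.1 : ℂ) ^ n.1 * (ρ.2 : ℂ) ^ n.2) := by
    intro ρ a1 a2 a3 a4 n
    rw [← hcc ρ ρ₀ a1 a2 a3 a4 (by simp [hρ₀, h1]) (by simp [hρ₀]; linarith) (by simp [hρ₀, h2])
      (by simp [hρ₀]; linarith), hc, mFourierCoeff]
    simp only
    rw [← integral_mul_const]
    congr 1
    ext z
    have e1 : (ρ.1 : ℂ) ≠ 0 := by exact_mod_cast a1.ne'
    have e2 : (ρ.2 : ℂ) ≠ 0 := by exact_mod_cast a3.ne'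
    have en : (-![n.1, n.2] : Fin 2 → ℤ) = ![(-n).1, (-n).2] := by
      ext i; fin_cases i <;> rfl
    rw [mon_torusPt, smul_eq_mul, en]
    simp only [Prod.fst_neg, Prod.snd_neg, zpow_neg]
    field_simp
  have hbound : ∀ ρ : ℝ × ℝ, 0 < ρ.1 → ρ.1 < R.1 → 0 < ρ.2 → ρ.2 < R.2 → ∃ M, ∀ n : ℤ × ℤ,
      ‖c ρ₀ n‖ * (ρ.1 ^ n.1 * ρ.2 ^ n.2) ≤ M := by
    intro ρ a1 a2 a3 a4
    have hcont : Continuous fun z => g (torusPt ρ z) :=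
      hg.continuousOn.comp_continuous (continuous_torusPt ρ)
        fun z => torusPt_mem_bidisc a1 a2 a3 a4 z
    obtain ⟨M, hM⟩ := isCompact_univ.exists_bound_of_continuousOn hcont.continuousOn
    refine ⟨M, fun n => ?_⟩
    have := norm_mFourierCoeff_le (fun z => hM z (mem_univ z)) ![n.1, n.2]
    rw [hF ρ a1 a2 a3 a4] at this
    simpa [abs_of_pos, a1, a3] using this
  refine ⟨c ρ₀, fun s hs => ?_⟩
  obtain ⟨⟨s1, s1'⟩, s2, s2'⟩ := hs
  obtain ⟨lam, hl1, hlR⟩ : ∃ lam : ℝ, 1 < lam ∧ lam * ‖s.1‖ < R.1 ∧ lam * ‖s.2‖ < R.2 := by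
    have e1 : 1 < R.1 / ‖s.1‖ := (one_lt_div s1).mpr s1'
    have e2 : 1 < R.2 / ‖s.2‖ := (one_lt_div s2).mpr s2'
    obtain ⟨l, hl, hl'⟩ := exists_between (lt_min e1 e2)
    exact ⟨l, hl, (lt_div_iff₀ s1).mp (hl'.trans_le (min_le_left _ _)),
      (lt_div_iff₀ s2).mp (hl'.trans_le (min_le_right _ _))⟩
  have hl0 : 0 < lam := by linarith
  have hsm : ∀ t : ℝ, 0 < t → lam⁻¹ * t ≤ lam * t := fun t ht => by
    have : lam⁻¹ ≤ 1 := inv_le_one_of_one_le₀ hl1.le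
    exact mul_le_mul_of_nonneg_right (this.trans hl1.le) ht.le
  -- One Cauchy estimate for each sign quadrant of the exponents: the larger radius for non-negative
  -- exponents, the smaller one for non-positive exponents. Together they give decay like `lam⁻¹ ^
  -- (|n.1| + |n.2|)`.
  obtain ⟨M1, hM1⟩ := hbound (lam * ‖s.1‖, lam * ‖s.2‖) (by positivity) hlR.1 (by positivity) hlR.2
  obtain ⟨M2, hM2⟩ := hbound (lam⁻¹ * ‖s.1‖, lam * ‖s.2‖) (by positivity)
    ((hsm _ s1).trans_lt hlR.1) (by positivity) hlR.2
  obtain ⟨M3, hM3⟩ := hbound (lam * ‖s.1‖, lam⁻¹ * ‖s.2‖) (by positivity) hlR.1 (by positivity)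
    ((hsm _ s2).trans_lt hlR.2)
  obtain ⟨M4, hM4⟩ := hbound (lam⁻¹ * ‖s.1‖, lam⁻¹ * ‖s.2‖) (by positivity)
    ((hsm _ s1).trans_lt hlR.1) (by positivity) ((hsm _ s2).trans_lt hlR.2)
  simp only [mul_zpow] at hM1 hM2 hM3 hM4
  set M := max (max M1 M2) (max M3 M4) with hM
  have hsum : Summable fun n : ℤ × ℤ => c ρ₀ n * ((‖s.1‖ : ℂ) ^ n.1 * (‖s.2‖ : ℂ) ^ n.2) := by
    refine Summable.of_norm_bounded ((summable_geometric_abs (r := lam⁻¹) (by positivity)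
      (inv_lt_one_of_one_lt₀ hl1)).mul_left M) fun n => ?_
    have key : ∀ e f : ℝ, 0 < e → 0 < f → ∀ N, N ≤ M →
        ‖c ρ₀ n‖ * (e * ‖s.1‖ ^ n.1 * (f * ‖s.2‖ ^ n.2)) ≤ N →
        ‖c ρ₀ n * ((‖s.1‖ : ℂ) ^ n.1 * (‖s.2‖ : ℂ) ^ n.2)‖ ≤ M * (e⁻¹ * f⁻¹) := by
      intro e f he hf N hN h
      have := h.trans hN
      simp only [norm_mul, norm_zpow, Complex.norm_real, norm_norm]
      rw [← mul_inv, ← div_eq_mul_inv, le_div_iff₀ (by positivity)]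
      calc _ = ‖c ρ₀ n‖ * (e * ‖s.1‖ ^ n.1 * (f * ‖s.2‖ ^ n.2)) := by ring
        _ ≤ M := this
    have pos : ∀ k : ℤ, 0 ≤ k → lam⁻¹ ^ k.natAbs = (lam ^ k)⁻¹ := fun k hk => by
      lift k to ℕ using hk
      simp
    have neg : ∀ k : ℤ, k ≤ 0 → lam⁻¹ ^ k.natAbs = (lam⁻¹ ^ k)⁻¹ := fun k hk => by
      obtain ⟨j, hj⟩ := Int.eq_ofNat_of_zero_le (neg_nonneg.mpr hk)
      obtain rfl : k = -j := by omega
      simp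
    rcases le_total 0 n.1 with hk | hk <;> rcases le_total 0 n.2 with hl | hl
    · rw [pos _ hk, pos _ hl]
      exact key _ _ (by positivity) (by positivity) M1 (by simp [hM]) (hM1 n)
    · rw [pos _ hk, neg _ hl]
      exact key _ _ (by positivity) (by positivity) M3 (by simp [hM]) (hM3 n)
    · rw [neg _ hk, pos _ hl]
      exact key _ _ (by positivity) (by positivity) M2 (by simp [hM]) (hM2 n)
    · rw [neg _ hk, neg _ hl]
      exact key _ _ (by positivity) (by positivity) M4 (by simp [hM]) (hM4 n)
  obtain ⟨z, hz⟩ := exists_torusPt s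
  set F : C(UnitAddTorus (Fin 2), ℂ) := ⟨fun z => g (torusPt (‖s.1‖, ‖s.2‖) z),
    hg.continuousOn.comp_continuous (continuous_torusPt _)
        fun z => torusPt_mem_bidisc s1 s1' s2 s2' z⟩ with hFdef
  have hco : ∀ n : ℤ × ℤ, mFourierCoeff F ![n.1, n.2] =
      c ρ₀ n * ((‖s.1‖ : ℂ) ^ n.1 * (‖s.2‖ : ℂ) ^ n.2) :=
    fun n => hF (‖s.1‖, ‖s.2‖) s1 s1' s2 s2' n
  have hsF : Summable (mFourierCoeff F) := by
    rw [← (finTwoArrowEquiv ℤ).symm.summable_iff]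
    exact hsum.congr fun n => (hco n).symm
  have := hasSum_mFourier_series_apply_of_summable hsF z
  rw [← (finTwoArrowEquiv ℤ).symm.hasSum_iff] at this
  have hFz : F z = g s := by rw [hFdef]; simp [hz]
  rw [hFz] at this
  refine this.congr_fun fun n => ?_
  have hmon : mon n s = (‖s.1‖ : ℂ) ^ n.1 * (‖s.2‖ : ℂ) ^ n.2 * mFourier ![n.1, n.2] z := by
    conv_lhs => rw [← hz]
    exact mon_torusPt _ n z
  rw [hmon]
  simp only [Function.comp_apply, smul_eq_mul]
  rw [show (finTwoArrowEquiv ℤ).symm n = ![n.1, n.2] from rfl, hco]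
  ring

/-- A Reinhardt domain in the torus that contains with each point the smaller ones. -/
structure IsCompleteReinhardt (D : Set (ℂ × ℂ)) : Prop where
  isOpen : IsOpen D
  ne_zero : ∀ s ∈ D, s.1 ≠ 0 ∧ s.2 ≠ 0
  mem : ∀ s ∈ D, ∀ t : ℂ × ℂ, t.1 ≠ 0 → t.2 ≠ 0 → ‖t.1‖ ≤ ‖s.1‖ → ‖t.2‖ ≤ ‖s.2‖ → t ∈ D

/-- Openness leaves room to stretch `s` by a real factor slightly above 1; the bidisc below the
stretched point contains `s` and lies in `D`. -/
lemma IsCompleteReinhardt.exists_bidisc {D : Set (ℂ × ℂ)} (hD : IsCompleteReinhardt D)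
    {s : ℂ × ℂ} (hs : s ∈ D) : ∃ R, s ∈ bidisc R ∧ bidisc R ⊆ D := by
  have hc : Tendsto (fun l : ℝ => ((l : ℂ) * s.1, (l : ℂ) * s.2)) (𝓝 1) (𝓝 s) := by
    have : Continuous fun l : ℝ => ((l : ℂ) * s.1, (l : ℂ) * s.2) := by fun_prop
    simpa using this.tendsto 1
  have := (hc.eventually (hD.isOpen.mem_nhds hs)).filter_mono (nhdsWithin_le_nhds (s := Ioi 1))
  obtain ⟨l, hl, hl1⟩ := (this.and self_mem_nhdsWithin).exists
  have hl1 : 1 < l := hl1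
  have h1 := norm_pos_iff.mpr (hD.ne_zero s hs).1
  have h2 := norm_pos_iff.mpr (hD.ne_zero s hs).2
  refine ⟨(l * ‖s.1‖, l * ‖s.2‖), ⟨⟨h1, by simp; nlinarith⟩, h2, by simp; nlinarith⟩, ?_⟩
  rintro t ⟨⟨t1, t1'⟩, t2, t2'⟩
  have : |l| = l := abs_of_pos (by linarith)
  exact hD.mem _ hl t (norm_pos_iff.mp t1) (norm_pos_iff.mp t2) (by simpa [this] using t1'.le)
    (by simpa [this] using t2'.le)

/-- A holomorphic function on a complete Reinhardt domain has a Laurent expansion. -/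
theorem exists_hasSum {D : Set (ℂ × ℂ)} (hD : IsCompleteReinhardt D) {g : ℂ × ℂ → ℂ}
    (hg : DifferentiableOn ℂ g D) :
    ∃ a : ℤ × ℤ → ℂ, ∀ s ∈ D, HasSum (fun n => a n * mon n s) (g s) := by
  rcases D.eq_empty_or_nonempty with rfl | ⟨s₀, hs₀⟩
  · exact ⟨0, fun s hs => absurd hs (notMem_empty s)⟩
  choose! R hR hRD using fun s hs => hD.exists_bidisc (s := s) hs
  have hRpos : ∀ s ∈ D, 0 < (R s).1 ∧ 0 < (R s).2 := fun s hs =>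
    ⟨(hR s hs).1.1.trans (hR s hs).1.2, (hR s hs).2.1.trans (hR s hs).2.2⟩
  choose! a ha using fun s hs => exists_hasSum_bidisc (hRpos s hs).1 (hRpos s hs).2
    (hg.mono (hRD s hs))
  refine ⟨a s₀, fun s hs => ?_⟩
  -- Any two punctured bidiscs centred at 0 share a small torus, on which the coefficients are
  -- unique. So the local expansions agree even though `D` is not assumed connected.
  suffices a s₀ = a s by rw [this]; exact ha s hs s (hR s hs)
  have p1 := hRpos s hs
  have p2 := hRpos s₀ hs₀
  have m1 := lt_min p1.1 p2.1
  have m2 := lt_min p1.2 p2.2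
  have l1 := min_le_left (R s).1 (R s₀).1
  have l2 := min_le_right (R s).1 (R s₀).1
  have l3 := min_le_left (R s).2 (R s₀).2
  have l4 := min_le_right (R s).2 (R s₀).2
  have hz : ∀ s', (min (R s).1 (R s₀).1 ≤ (R s').1) → (min (R s).2 (R s₀).2 ≤ (R s').2) →
      ∀ z, torusPt (min (R s).1 (R s₀).1 / 2, min (R s).2 (R s₀).2 / 2) z ∈ bidisc (R s') :=
    fun s' h h' z => torusPt_mem_bidisc (by simp only; linarith) (by simp only; linarith)
      (by simp only; linarith) (by simp only; linarith) z
  exact coeff_unique (ρ := (min (R s).1 (R s₀).1 / 2, min (R s).2 (R s₀).2 / 2))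
    (by simp only; linarith) (by simp only; linarith)
    (fun z => ha s₀ hs₀ _ (hz s₀ l2 l4 z)) fun z => ha s hs _ (hz s l1 l3 z)

/-- The sum of a series of holomorphic functions with summable bounds is holomorphic. -/
theorem differentiableOn_tsum {ι E : Type*} [NormedAddCommGroup E] [NormedSpace ℂ E]
    {f : ι → E → ℂ} {u : ι → ℝ} {V : Set E} (hV : IsOpen V) (hu : Summable u)
    (hf : ∀ i, DifferentiableOn ℂ (f i) V) (hfu : ∀ i, ∀ x ∈ V, ‖f i x‖ ≤ u i) :
    DifferentiableOn ℂ (fun x => ∑' i, f i x) V := by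
  intro x hx
  obtain ⟨r, hr, hrV⟩ := Metric.isOpen_iff.mp hV x hx
  have hb : ∀ y ∈ Metric.ball x (r / 2), Metric.ball y (r / 2) ⊆ V := fun y hy =>
    (Metric.ball_subset_ball' (by rw [Metric.mem_ball] at hy; linarith)).trans hrV
  have hyV : ∀ y ∈ Metric.ball x (r / 2), y ∈ V := fun y hy =>
    hb y hy (Metric.mem_ball_self (by linarith))
  have hxb : x ∈ Metric.ball x (r / 2) := Metric.mem_ball_self (by linarith)
  -- On balls of radius `r / 2` each `f i` varies by at most `2 * u i`, so Cauchy's estimate bounds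
  -- its derivative by the summable `2 * u i / (r / 2)`.
  refine (hasFDerivAt_tsum_of_isPreconnected (f' := fun i y => fderiv ℂ (f i) y)
    ((hu.mul_left 2).div_const (r / 2)) Metric.isOpen_ball
    (convex_ball x (r / 2)).isPreconnected (fun i y hy => ?_) (fun i y hy => ?_) hxb
    (Summable.of_norm_bounded hu fun i => hfu i x hx) hxb).differentiableAt.differentiableWithinAt
  · exact ((hf i).differentiableAt (hV.mem_nhds (hyV y hy))).hasFDerivAt
  · refine Complex.norm_fderiv_le_div_of_mapsTo_ball ((hf i).mono (hb y hy)) (fun w hw => ?_)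
      (by linarith)
    rw [mem_closedBall_iff_norm]
    refine (norm_sub_le _ _).trans ?_
    linarith [hfu i w (hb y hy hw), hfu i y (hyV y hy)]

end Laurent

/-! ### Binary forms as polynomials -/

noncomputable section

namespace BinaryForm

open Polynomial

/-- The polynomials of degree at most `m` divisible by `h`. -/
def multiples (m : ℕ) (h : ℂ[X]) : Submodule ℂ ℂ[X] where
  carrier := {p | p.natDegree ≤ m ∧ h ∣ p}
  add_mem' hp hq := ⟨(natDegree_add_le _ _).trans (max_le hp.1 hq.1), dvd_add hp.2 hq.2⟩
  zero_mem' := ⟨by simp, dvd_zero _⟩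
  smul_mem' c p hp := ⟨(natDegree_smul_le c p).trans hp.1, dvd_smul_of_dvd c hp.2⟩

lemma mem_multiples {m : ℕ} {h p : ℂ[X]} : p ∈ multiples m h ↔ p.natDegree ≤ m ∧ h ∣ p := Iff.rfl

lemma multiples_eq_map (m : ℕ) {h : ℂ[X]} (hh : h ≠ 0) :
    multiples m h =
      (degreeLT ℂ (m + 1 - h.natDegree)).map (LinearMap.mulLeft ℂ h) := by
  ext p
  simp only [mem_multiples, Submodule.mem_map, mem_degreeLT, LinearMap.mulLeft_apply]
  constructor
  · rintro ⟨hp, q, rfl⟩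
    refine ⟨q, ?_, rfl⟩
    rcases eq_or_ne q 0 with rfl | hq
    · simp
    · rw [natDegree_mul hh hq] at hp
      rw [← natDegree_lt_iff_degree_lt hq]
      omega
  · rintro ⟨q, hq, rfl⟩
    refine ⟨?_, dvd_mul_right _ _⟩
    rcases eq_or_ne q 0 with rfl | hq0
    · simp
    · rw [natDegree_mul hh hq0]
      rw [← natDegree_lt_iff_degree_lt hq0] at hq
      omega

lemma finrank_multiples (m : ℕ) {h : ℂ[X]} (hh : h ≠ 0) :
    Module.finrank ℂ (multiples m h) = m + 1 - h.natDegree := by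
  have inj : Function.Injective (LinearMap.mulLeft ℂ h) := fun p q hpq =>
    mul_left_cancel₀ hh hpq
  rw [multiples_eq_map m hh,
    ← (Submodule.equivMapOfInjective _ inj (degreeLT ℂ (m + 1 - h.natDegree))).finrank_eq,
    (degreeLTEquiv ℂ _).finrank_eq, Module.finrank_fin_fun]

instance (m : ℕ) (h : ℂ[X]) : FiniteDimensional ℂ (multiples m h) := by
  have : multiples m h ≤ degreeLT ℂ (m + 1) := fun p hp => by
    rw [mem_degreeLT]
    exact natDegree_le_iff_degree_le.mp hp.1 |>.trans_lt (by exact_mod_cast m.lt_succ_self)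
  have : FiniteDimensional ℂ (degreeLT ℂ (m + 1)) :=
    (degreeLTEquiv ℂ (m + 1)).symm.finiteDimensional
  exact Submodule.finiteDimensional_of_le ‹multiples m h ≤ degreeLT ℂ (m + 1)›

lemma multiples_inf (m : ℕ) {h k : ℂ[X]} (hk : IsCoprime h k) :
    multiples m h ⊓ multiples m k = multiples m (h * k) := by
  ext p
  simp only [Submodule.mem_inf, mem_multiples]
  exact ⟨fun ⟨⟨a, b⟩, _, c⟩ => ⟨a, hk.mul_dvd b c⟩, fun ⟨a, b⟩ =>
    ⟨⟨a, (dvd_mul_right _ _).trans b⟩, a, (dvd_mul_left _ _).trans b⟩⟩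

/-- The polynomials of degree at most `m` vanishing to order `e` at `r`. -/
def vanishing (m : ℕ) (r : ℤ) (e : ℕ) : Submodule ℂ ℂ[X] := multiples m ((X - C (r : ℂ)) ^ e)

instance (m : ℕ) (r : ℤ) (e : ℕ) : FiniteDimensional ℂ (vanishing m r e) :=
  inferInstanceAs (FiniteDimensional ℂ (multiples m _))

lemma isCoprime_pow {r s : ℤ} (h : r ≠ s) (e f : ℕ) :
    IsCoprime ((X - C (r : ℂ)) ^ e) ((X - C (s : ℂ)) ^ f) :=
  (isCoprime_X_sub_C_of_isUnit_sub
    (isUnit_iff_ne_zero.mpr (sub_ne_zero.mpr (by exact_mod_cast h)))).pow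

lemma pow_ne_zero' (r : ℤ) (e : ℕ) : (X - C (r : ℂ)) ^ e ≠ 0 := pow_ne_zero _ (X_sub_C_ne_zero _)

lemma finrank_vanishing (m : ℕ) (r : ℤ) (e : ℕ) :
    Module.finrank ℂ (vanishing m r e) = m + 1 - e := by
  rw [vanishing, finrank_multiples m (pow_ne_zero' r e)]
  simp only [natDegree_pow, natDegree_X_sub_C, mul_one]

lemma finrank_vanishing_inf (m : ℕ) {r s : ℤ} (h : r ≠ s) (e f : ℕ) :
    Module.finrank ℂ ↥(vanishing m r e ⊓ vanishing m s f) = m + 1 - (e + f) := by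
  rw [vanishing, vanishing, multiples_inf m (isCoprime_pow h e f),
    finrank_multiples m (mul_ne_zero (pow_ne_zero' _ _) (pow_ne_zero' _ _)),
    natDegree_mul (pow_ne_zero' _ _) (pow_ne_zero' _ _)]
  simp only [natDegree_pow, natDegree_X_sub_C, mul_one]

lemma finrank_vanishing_inf₄ (m : ℕ) {r s t u : ℤ} (hrs : r ≠ s) (hrt : r ≠ t) (hru : r ≠ u)
    (hst : s ≠ t) (hsu : s ≠ u) (htu : t ≠ u) (e f g h : ℕ) :
    Module.finrank ℂ ↥(vanishing m r e ⊓ vanishing m s f ⊓ (vanishing m t g ⊓ vanishing m u h)) =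
      m + 1 - (e + f + g + h) := by
  rw [vanishing, vanishing, vanishing, vanishing, multiples_inf m (isCoprime_pow hrs e f),
    multiples_inf m (isCoprime_pow htu g h), multiples_inf m
      (((isCoprime_pow hrt e g).mul_right (isCoprime_pow hru e h)).mul_left
        ((isCoprime_pow hst f g).mul_right (isCoprime_pow hsu f h))),
    finrank_multiples m (mul_ne_zero (mul_ne_zero (pow_ne_zero' _ _) (pow_ne_zero' _ _))
      (mul_ne_zero (pow_ne_zero' _ _) (pow_ne_zero' _ _))),
    natDegree_mul (mul_ne_zero (pow_ne_zero' _ _) (pow_ne_zero' _ _))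
      (mul_ne_zero (pow_ne_zero' _ _) (pow_ne_zero' _ _)),
    natDegree_mul (pow_ne_zero' _ _) (pow_ne_zero' _ _),
    natDegree_mul (pow_ne_zero' _ _) (pow_ne_zero' _ _)]
  simp only [natDegree_pow, natDegree_X_sub_C, mul_one]
  omega

lemma vanishing_eq_bot {m : ℕ} (r : ℤ) {e : ℕ} (h : m < e) : vanishing m r e = ⊥ := by
  rw [← Submodule.finrank_eq_zero (R := ℂ), finrank_vanishing]
  omega

/-- Every order above `m` gives the zero space, so only finitely many spaces occur for fixed `m` and
`r`. This is the source of uniform bounds in `exists_primitive_bound`. -/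
lemma vanishing_min (m : ℕ) (r : ℤ) (e : ℕ) : vanishing m r (min e (m + 1)) = vanishing m r e := by
  rcases le_total e (m + 1) with h | h
  · rw [min_eq_left h]
  · rw [min_eq_right h, vanishing_eq_bot r (Nat.lt_succ_self m), vanishing_eq_bot r (by omega)]

/-- The value at `(u, v)` of the form of degree `m` given by the polynomial `p`. -/
def homEval (m : ℕ) (p : ℂ[X]) (u v : ℂ) : ℂ :=
  ∑ k ∈ Finset.range (m + 1), p.coeff k * (v ^ k * u ^ (m - k))

lemma homEval_add (m : ℕ) (p q : ℂ[X]) (u v : ℂ) :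
    homEval m (p + q) u v = homEval m p u v + homEval m q u v := by
  simp [homEval, add_mul, Finset.sum_add_distrib]

lemma homEval_smul (m : ℕ) (c : ℂ) (p : ℂ[X]) (u v : ℂ) :
    homEval m (c • p) u v = c * homEval m p u v := by
  simp [homEval, Finset.mul_sum, mul_assoc]

lemma homEval_zero (m : ℕ) (u v : ℂ) : homEval m 0 u v = 0 := by simp [homEval]

lemma homEval_of_ne_zero {m : ℕ} {p : ℂ[X]} (hp : p.natDegree ≤ m) {u : ℂ} (hu : u ≠ 0) (v : ℂ) :
    homEval m p u v = u ^ m * p.eval (v / u) := by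
  rw [eval_eq_sum_range' (Nat.lt_succ_of_le hp), homEval, Finset.mul_sum]
  refine Finset.sum_congr rfl fun k hk => ?_
  have hk' : k ≤ m := by simpa [Nat.lt_succ_iff] using hk
  rw [div_pow, ← Nat.sub_add_cancel hk', pow_add]
  simp only [Nat.sub_add_cancel hk']
  field_simp

lemma homEval_one {m : ℕ} {p : ℂ[X]} (hp : p.natDegree ≤ m) (v : ℂ) :
    homEval m p 1 v = p.eval v := by
  rw [homEval_of_ne_zero hp one_ne_zero]
  simp

lemma homEval_mul_left (m : ℕ) (p : ℂ[X]) (t u v : ℂ) :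
    homEval m p (t * u) (t * v) = t ^ m * homEval m p u v := by
  simp only [homEval, Finset.mul_sum]
  refine Finset.sum_congr rfl fun k hk => ?_
  have hk' : k ≤ m := by simpa [Nat.lt_succ_iff] using hk
  rw [mul_pow, mul_pow]
  nth_rewrite 3 [← Nat.add_sub_cancel' hk']
  rw [pow_add]
  ring

/-- The form `p` in the coordinates `x`, `y` with `u = x + y` and `v = j x + (j - 1) y`,
dehomogenized by `y = 1`. -/
def chartForm (m : ℕ) (j : ℤ) : ℂ[X] →ₗ[ℂ] ℂ[X] where
  toFun p := ∑ k ∈ Finset.range (m + 1), p.coeff k •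
    ((C (j : ℂ) * X + C ((j : ℂ) - 1)) ^ k * (X + 1) ^ (m - k))
  map_add' p q := by simp [add_smul, Finset.sum_add_distrib]
  map_smul' c p := by simp [Finset.smul_sum, mul_smul]

lemma eval_chartForm (m : ℕ) (j : ℤ) (p : ℂ[X]) (x : ℂ) :
    (chartForm m j p).eval x = homEval m p (x + 1) (j * x + (j - 1)) := by
  simp only [chartForm, homEval, LinearMap.coe_mk, AddHom.coe_mk, eval_finsetSum, eval_smul,
    eval_mul, eval_pow, eval_add, eval_C, eval_X, eval_one, smul_eq_mul]

lemma natDegree_chartForm_le (m : ℕ) (j : ℤ) (p : ℂ[X]) : (chartForm m j p).natDegree ≤ m := by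
  refine natDegree_sum_le_of_forall_le (Finset.range (m + 1)) (fun k => p.coeff k •
    ((C (j : ℂ) * X + C ((j : ℂ) - 1)) ^ k * (X + 1) ^ (m - k))) fun k hk => ?_
  have hk' : k ≤ m := by simpa [Nat.lt_succ_iff] using hk
  refine (natDegree_smul_le _ _).trans (natDegree_mul_le.trans ?_)
  have h1 : ((C (j : ℂ) * X + C ((j : ℂ) - 1)) ^ k).natDegree ≤ k * 1 :=
    natDegree_pow_le_of_le k natDegree_linear_le
  have h2 : ((X + 1 : ℂ[X]) ^ (m - k)).natDegree ≤ (m - k) * 1 :=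
    natDegree_pow_le_of_le _ (by compute_degree)
  omega

/-- The coefficient of `x ^ i * y ^ (m - i)` in the `j`-th coordinates. -/
def chartCoeff (m : ℕ) (j : ℤ) (i : ℕ) : ℂ[X] →ₗ[ℂ] ℂ := lcoeff ℂ i ∘ₗ chartForm m j

lemma chartCoeff_eq (m : ℕ) (j : ℤ) (i : ℕ) (p : ℂ[X]) :
    chartCoeff m j i p = (chartForm m j p).coeff i := rfl

lemma homEval_eq_sum_chartCoeff (m : ℕ) (j : ℤ) (p : ℂ[X]) (x y : ℂ) :
    homEval m p (x + y) (j * x + (j - 1) * y) =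
      ∑ i ∈ Finset.range (m + 1), chartCoeff m j i p * (x ^ i * y ^ (m - i)) := by
  have h1 : Continuous fun y : ℂ => homEval m p (x + y) (j * x + (j - 1) * y) := by
    unfold homEval
    fun_prop
  have h2 : Continuous fun y : ℂ =>
      ∑ i ∈ Finset.range (m + 1), chartCoeff m j i p * (x ^ i * y ^ (m - i)) := by fun_prop
  refine congrFun (Continuous.ext_on (dense_compl_singleton (0 : ℂ)) h1 h2 fun y hy => ?_) y
  have hy : y ≠ 0 := hy
  have e1 : x + y = y * (x / y + 1) := by field_simp
  have e2 : j * x + (j - 1) * y = y * (j * (x / y) + (j - 1)) := by field_simp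
  rw [e1, e2, homEval_mul_left, ← eval_chartForm,
    eval_eq_sum_range' (Nat.lt_succ_of_le (natDegree_chartForm_le m j p)), Finset.mul_sum]
  refine Finset.sum_congr rfl fun i hi => ?_
  have hi' : i ≤ m := by simpa [Nat.lt_succ_iff] using hi
  rw [chartCoeff_eq, div_pow]
  nth_rewrite 1 [← Nat.add_sub_cancel' hi']
  rw [pow_add]
  field_simp

/-- Inverting u = x + y, v = jx + (j - 1)y gives x = v + (1 - j)u and y = ju - v. At u = 1 these are
the two linear factors, which vanish at j - 1 and at j. -/
lemma eval_eq_sum_chartCoeff {m : ℕ} (j : ℤ) {p : ℂ[X]} (hp : p.natDegree ≤ m) :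
    p = ∑ i ∈ Finset.range (m + 1), chartCoeff m j i p •
      ((X + C (1 - (j : ℂ))) ^ i * (C (j : ℂ) - X) ^ (m - i)) := by
  refine Polynomial.funext fun t => ?_
  have := homEval_eq_sum_chartCoeff m j p (t + (1 - j)) (j - t)
  rw [show t + (1 - j) + (j - t) = (1 : ℂ) by ring,
    show j * (t + (1 - j)) + (j - 1) * (j - t) = t by ring, homEval_one hp] at this
  rw [this]
  simp [eval_finsetSum]

lemma mem_vanishing_of_chartCoeff {m : ℕ} {j : ℤ} {e : ℕ} {p : ℂ[X]} (hp : p.natDegree ≤ m)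
    (h : ∀ i ≤ m, m - i < e → chartCoeff m j i p = 0) : p ∈ vanishing m j e := by
  refine ⟨hp, ?_⟩
  rw [eval_eq_sum_chartCoeff j hp]
  refine Finset.dvd_sum fun i hi => ?_
  have hi' : i ≤ m := by simpa [Nat.lt_succ_iff] using hi
  rcases lt_or_ge (m - i) e with hlt | hge
  · simp [h i hi' hlt]
  · refine dvd_smul_of_dvd _ (Dvd.dvd.mul_left ((pow_dvd_pow _ hge).trans ?_) _)
    exact pow_dvd_pow_of_dvd ((dvd_neg.mpr dvd_rfl).trans (dvd_of_eq (neg_sub _ _))) _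

lemma mem_vanishing_of_chartCoeff' {m : ℕ} {j : ℤ} {e : ℕ} {p : ℂ[X]} (hp : p.natDegree ≤ m)
    (h : ∀ i ≤ m, i < e → chartCoeff m j i p = 0) : p ∈ vanishing m (j - 1) e := by
  refine ⟨hp, ?_⟩
  rw [eval_eq_sum_chartCoeff j hp]
  refine Finset.dvd_sum fun i hi => ?_
  have hi' : i ≤ m := by simpa [Nat.lt_succ_iff] using hi
  rcases lt_or_ge i e with hlt | hge
  · simp [h i hi' hlt]
  · refine dvd_smul_of_dvd _ (Dvd.dvd.mul_right ((pow_dvd_pow _ hge).trans ?_) _)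
    refine pow_dvd_pow_of_dvd (dvd_of_eq ?_) _
    push_cast
    simp only [map_sub, map_one]
    ring

/-- A change of coordinates is multiplicative on forms, and X - r stands for the linear form v - ru.
For r = j this is -y, a constant after y = 1, so the degree in x drops by `e`; for r = j - 1 it is
x, so the lowest `e` coefficients vanish. -/
lemma chartForm_mul {m : ℕ} (j r : ℤ) {e : ℕ} (he : e ≤ m) {q : ℂ[X]} (hq : q.natDegree ≤ m - e) :
    chartForm m j ((X - C (r : ℂ)) ^ e * q) =
      (C (j : ℂ) * X + C ((j : ℂ) - 1) - C (r : ℂ) * (X + 1)) ^ e * chartForm (m - e) j q := by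
  -- At x = -1 the form u = x + 1 is zero and v/u is undefined; agreement elsewhere is enough.
  refine Polynomial.eq_of_infinite_eval_eq _ _ ((Set.finite_singleton (-1 : ℂ)).infinite_compl.mono
    fun x hx => ?_)
  have hx : x + 1 ≠ 0 := fun h => hx (eq_neg_of_add_eq_zero_left h)
  have hdeg : ((X - C (r : ℂ)) ^ e * q).natDegree ≤ m := by
    refine natDegree_mul_le.trans ?_
    simp only [natDegree_pow, natDegree_X_sub_C]
    omega
  simp only [mem_ofPred_eq, eval_mul, eval_chartForm]
  rw [homEval_of_ne_zero hdeg hx, homEval_of_ne_zero hq hx]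
  nth_rewrite 1 [← Nat.add_sub_cancel' he]
  simp only [eval_mul, eval_pow, eval_sub, eval_X, eval_C, eval_add, eval_one, pow_add]
  have : (x + 1) ^ e * ((j * x + (j - 1)) / (x + 1) - r) ^ e =
      (j * x + (j - 1) - r * (x + 1)) ^ e := by
    rw [← mul_pow]
    congr 1
    field_simp
  rw [← this]
  ring

lemma chartCoeff_eq_zero {m : ℕ} {j : ℤ} {e : ℕ} {p : ℂ[X]} (h : p ∈ vanishing m j e) {i : ℕ}
    (hi : m < i + e) : chartCoeff m j i p = 0 := by
  rcases le_or_gt e m with he | he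
  · obtain ⟨hp, q, rfl⟩ := h
    rcases eq_or_ne q 0 with rfl | hq
    · simp
    rw [natDegree_mul (pow_ne_zero' _ _) hq] at hp
    simp only [natDegree_pow, natDegree_X_sub_C] at hp
    rw [chartCoeff_eq, chartForm_mul j j he (by omega)]
    have : C (j : ℂ) * X + C ((j : ℂ) - 1) - C (j : ℂ) * (X + 1) = C (-1) := by
      simp only [map_sub, map_neg, map_one]
      ring
    rw [this, ← C_pow, coeff_C_mul,
      coeff_eq_zero_of_natDegree_lt ((natDegree_chartForm_le _ _ _).trans_lt (by omega)), mul_zero]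
  · rw [vanishing_eq_bot j he] at h
    rw [(Submodule.mem_bot ℂ).mp h, map_zero]

lemma chartCoeff_eq_zero' {m : ℕ} {j : ℤ} {e : ℕ} {p : ℂ[X]} (h : p ∈ vanishing m (j - 1) e)
    {i : ℕ} (hi : i < e) : chartCoeff m j i p = 0 := by
  rcases le_or_gt e m with he | he
  · obtain ⟨hp, q, rfl⟩ := h
    rcases eq_or_ne q 0 with rfl | hq
    · simp
    rw [natDegree_mul (pow_ne_zero' _ _) hq] at hp
    simp only [natDegree_pow, natDegree_X_sub_C] at hp
    rw [chartCoeff_eq, chartForm_mul j (j - 1) he (by omega)]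
    have : C (j : ℂ) * X + C ((j : ℂ) - 1) - C ((j - 1 : ℤ) : ℂ) * (X + 1) = X := by
      push_cast
      simp only [map_sub, map_one]
      ring
    rw [this, mul_comm, coeff_mul_X_pow', if_neg (by omega)]
  · rw [vanishing_eq_bot _ he] at h
    rw [(Submodule.mem_bot ℂ).mp h, map_zero]

/-- The sum of the absolute values of the coefficients. -/
def coeffNorm (m : ℕ) (p : ℂ[X]) : ℝ := ∑ k ∈ Finset.range (m + 1), ‖p.coeff k‖

lemma coeffNorm_nonneg (m : ℕ) (p : ℂ[X]) : 0 ≤ coeffNorm m p :=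
  Finset.sum_nonneg fun _ _ => norm_nonneg _

lemma exists_bound (m : ℕ) (L : ℂ[X] →ₗ[ℂ] ℂ) :
    ∃ K, 0 ≤ K ∧ ∀ p : ℂ[X], p.natDegree ≤ m → ‖L p‖ ≤ K * coeffNorm m p := by
  refine ⟨∑ k ∈ Finset.range (m + 1), ‖L (X ^ k)‖, Finset.sum_nonneg fun _ _ => norm_nonneg _,
    fun p hp => ?_⟩
  have e : L p = ∑ k ∈ Finset.range (m + 1), p.coeff k * L (X ^ k) := by
    conv_lhs => rw [as_sum_range' p (m + 1) (Nat.lt_succ_of_le hp)]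
    simp only [map_sum, ← smul_X_eq_monomial, map_smul, smul_eq_mul]
  rw [e, coeffNorm, Finset.mul_sum]
  refine norm_sum_le_of_le _ fun k hk => ?_
  rw [norm_mul, mul_comm]
  exact mul_le_mul_of_nonneg_right
    (Finset.single_le_sum (f := fun k => ‖L (X ^ k)‖) (fun _ _ => norm_nonneg _) hk) (norm_nonneg _)

lemma exists_bound_map (m : ℕ) (L : ℂ[X] →ₗ[ℂ] ℂ[X]) :
    ∃ K, 0 ≤ K ∧ ∀ p : ℂ[X], p.natDegree ≤ m → coeffNorm m (L p) ≤ K * coeffNorm m p := by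
  choose K hK0 hK using fun k => exists_bound m (lcoeff ℂ k ∘ₗ L)
  refine ⟨∑ k ∈ Finset.range (m + 1), K k, Finset.sum_nonneg fun _ _ => hK0 _, fun p hp => ?_⟩
  rw [Finset.sum_mul, coeffNorm]
  exact Finset.sum_le_sum fun k _ => hK k p hp

/-- The coefficients of a polynomial as linear combinations of its values. -/
lemma exists_coeff_eq (m : ℕ) : ∃ l : ℕ → ℕ → ℂ, ∀ p : ℂ[X], p.natDegree ≤ m → ∀ k,
    p.coeff k = ∑ t ∈ Finset.range (m + 1), l k t * p.eval (t : ℂ) := by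
  refine ⟨fun k t => (Lagrange.basis (Finset.range (m + 1)) (fun t : ℕ => (t : ℂ)) t).coeff k,
    fun p hp k => ?_⟩
  have := Lagrange.eq_interpolate (s := Finset.range (m + 1)) (v := fun t : ℕ => (t : ℂ)) (f := p)
    (fun a _ b _ h => Nat.cast_injective (R := ℂ) h) (by
      rw [Finset.card_range]
      exact natDegree_le_iff_degree_le.mp hp |>.trans_lt (by exact_mod_cast m.lt_succ_self))
  conv_lhs => rw [this]
  simp [Lagrange.interpolate_apply, mul_comm]

end BinaryForm

end

/-! ### Symmetric differentials in the charts of the resolution -/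

noncomputable section

namespace SymmetricDifferential

variable {M : Type*} [TopologicalSpace M] {E : Type*} [NormedAddCommGroup E] [NormedSpace ℂ E]
  [ChartedSpace E M]

lemma mdifferentiableAt_subtype_iff {F : Type*} [NormedAddCommGroup F] [NormedSpace ℂ F]
    {H N : Type*} [TopologicalSpace H] {J : ModelWithCorners ℂ E H} [TopologicalSpace N]
    [ChartedSpace H N] {U : Opens N} {f : N → F} {x : U} :
    MDifferentiableAt J 𝓘(ℂ, F) (fun y : U => f y) x ↔ MDifferentiableAt J 𝓘(ℂ, F) f x :=
  (differentiableWithinAt_localInvariantProp.liftPropAt_iff_comp_subtype_val _ _).symm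

variable [IsManifold 𝓘(ℂ, E) ω M]

/-- The extension by zero of a symmetric differential to a function on the tangent bundle. -/
def extend {m : ℕ} {U : Opens M} (f : sections E m U) (v : TangentBundle 𝓘(ℂ, E) M) : ℂ :=
  open Classical in if h : v ∈ tangentOver E U then f.1 ⟨v, h⟩ else 0

lemma extend_apply {m : ℕ} {U : Opens M} (f : sections E m U) (v : tangentOver E U) :
    extend f v = f.1 v := dif_pos v.2

lemma extend_of_mem {m : ℕ} {U : Opens M} (f : sections E m U) {v : TangentBundle 𝓘(ℂ, E) M}
    (h : v.proj ∈ U) : extend f v = f.1 ⟨v, h⟩ := dif_pos h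

lemma extend_restrict {m : ℕ} {U V : Opens M} (h : U ≤ V) (f : sections E m V)
    {v : TangentBundle 𝓘(ℂ, E) M} (hv : v.proj ∈ U) :
    extend (restrict E m h f) v = extend f v := by
  rw [extend_of_mem _ hv, extend_of_mem _ (h hv)]
  rfl

lemma extend_add {m : ℕ} {U : Opens M} (f g : sections E m U) (v : TangentBundle 𝓘(ℂ, E) M) :
    extend (f + g) v = extend f v + extend g v := by
  unfold extend
  split_ifs
  · rfl
  · simp

lemma extend_smul {m : ℕ} {U : Opens M} (c : ℂ) (f : sections E m U)
    (v : TangentBundle 𝓘(ℂ, E) M) : extend (c • f) v = c * extend f v := by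
  unfold extend
  split_ifs
  · rfl
  · simp

lemma mdifferentiableAt_extend {m : ℕ} {U : Opens M} (f : sections E m U)
    {v : TangentBundle 𝓘(ℂ, E) M} (h : v.proj ∈ U) :
    MDifferentiableAt 𝓘(ℂ, E).tangent 𝓘(ℂ, ℂ) (extend f) v := by
  have := f.2.1 ⟨v, h⟩
  rw [← mdifferentiableAt_subtype_iff (U := tangentOver E U) (x := ⟨v, h⟩)]
  convert this using 2 with y
  exact extend_apply f _

/-- Being a symmetric differential is a local property. -/
lemma mem_sections_of_local {m : ℕ} {U : Opens M} {F : TangentBundle 𝓘(ℂ, E) M → ℂ}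
    (h : ∀ q ∈ U, ∃ N : Opens M, q ∈ N ∧ ∃ g : sections E m N, ∀ v : TangentBundle 𝓘(ℂ, E) M,
      v.proj ∈ N → v.proj ∈ U → F v = extend g v) :
    (fun v : tangentOver E U => F v) ∈ sections E m U := by
  refine ⟨fun v => ?_, fun p => ?_⟩
  · rw [mdifferentiableAt_subtype_iff (f := F)]
    obtain ⟨N, hN, g, hg⟩ := h v.1.proj v.2
    refine (mdifferentiableAt_extend g hN).congr_of_eventuallyEq ?_
    have : (tangentOver E N ⊓ tangentOver E U : Opens _).1 ∈ 𝓝 v.1 :=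
      (tangentOver E N ⊓ tangentOver E U).isOpen.mem_nhds ⟨hN, v.2⟩
    filter_upwards [this] with w hw
    exact hg w hw.1 hw.2
  · obtain ⟨N, hN, g, hg⟩ := h p.1 p.2
    obtain ⟨A, hA⟩ := g.2.2 ⟨p.1, hN⟩
    refine ⟨A, fun v => ?_⟩
    rw [← hA v]
    exact (hg (tangentPt E p v).1 hN p.2).trans (extend_of_mem g (v := ⟨p.1, v⟩) hN)

end SymmetricDifferential

/-! ### Tangent vectors in chart coordinates -/

namespace A2Resolution

open SymmetricDifferential

local notation "I₂" => 𝓘(ℂ, ℂ × ℂ)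

/-- The `j`-th chart as an open partial homeomorphism. -/
def openChart (j : Fin 3) : OpenPartialHomeomorph A2Resolution (ℂ × ℂ) :=
  core.openPartialHomeomorph (chart j) (mem_range_self j)

lemma openChart_mem (j : Fin 3) : openChart j ∈ IsManifold.maximalAtlas I₂ ω A2Resolution :=
  IsManifold.subset_maximalAtlas (mem_iUnion₂.mpr ⟨chart j, mem_range_self j, rfl⟩)

lemma contMDiff_param (j : Fin 3) : ContMDiff I₂ I₂ ω (param j) := by
  rw [← contMDiffOn_univ]
  exact contMDiffOn_symm_of_mem_maximalAtlas (openChart_mem j)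

lemma contMDiffOn_coord (j : Fin 3) : ContMDiffOn I₂ I₂ ω (coord j) (chartDomain j) :=
  contMDiffOn_of_mem_maximalAtlas (openChart_mem j)

lemma param_mem_chartDomain (j : Fin 3) (c : ℂ × ℂ) : param j c ∈ chartDomain j :=
  (chart j).map_target (mem_univ c)

lemma continuous_param (j : Fin 3) : Continuous (param j) := (contMDiff_param j).continuous

lemma mdifferentiableAt_param (j : Fin 3) (c : ℂ × ℂ) : MDifferentiableAt I₂ I₂ (param j) c :=
  (contMDiff_param j).mdifferentiable (by simp) c

lemma mdifferentiableAt_coord {j : Fin 3} {q : A2Resolution} (hq : q ∈ chartDomain j) :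
    MDifferentiableAt I₂ I₂ (coord j) q :=
  ((contMDiffOn_coord j).contMDiffAt ((chartDomain j).isOpen.mem_nhds hq)).mdifferentiableAt
    (by simp)

/-- The tangent vector at `param j c` with coordinates `w` in the `j`-th chart. -/
def tangentVec (j : Fin 3) (z : (ℂ × ℂ) × (ℂ × ℂ)) : TangentBundle I₂ A2Resolution :=
  ⟨param j z.1, mfderiv I₂ I₂ (param j) z.1 z.2⟩

lemma mdifferentiable_tangentVec (j : Fin 3) :
    MDifferentiable 𝓘(ℂ, (ℂ × ℂ) × (ℂ × ℂ)) (I₂).tangent (tangentVec j) := by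
  have h1 : ContMDiff (I₂).tangent (I₂).tangent 1 (tangentMap I₂ I₂ (param j)) :=
    (contMDiff_param j).contMDiff_tangentMap (m := 1) (by decide)
  have h2 : ContMDiff ((I₂).prod 𝓘(ℂ, ℂ × ℂ)) (I₂).tangent 1 _ :=
    contMDiff_tangentBundleModelSpaceHomeomorph_symm (I := I₂) (n := 1)
  have h3 := (h1.comp h2).mdifferentiable (by simp)
  rw [modelWithCornersSelf_prod (𝕜 := ℂ) (E := ℂ × ℂ) (F := ℂ × ℂ)]
  exact h3

/-- The coordinates of a tangent vector in the `j`-th chart. -/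
def tangentCoord (j : Fin 3) (v : TangentBundle I₂ A2Resolution) : (ℂ × ℂ) × (ℂ × ℂ) :=
  (coord j v.proj, mfderiv I₂ I₂ (coord j) v.proj v.2)

lemma mdifferentiableAt_tangentCoord {j : Fin 3} {v : TangentBundle I₂ A2Resolution}
    (hv : v.proj ∈ chartDomain j) :
    MDifferentiableAt (I₂).tangent 𝓘(ℂ, (ℂ × ℂ) × (ℂ × ℂ)) (tangentCoord j) v := by
  have h1 : ContMDiffOn (I₂).tangent (I₂).tangent 1 (tangentMapWithin I₂ I₂ (coord j)
      (chartDomain j)) _ := (contMDiffOn_coord j).contMDiffOn_tangentMapWithin (m := 1) (by decide)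
    (chartDomain j).isOpen.uniqueMDiffOn
  have h2 : ContMDiff (I₂).tangent ((I₂).prod 𝓘(ℂ, ℂ × ℂ)) 1 _ :=
    contMDiff_tangentBundleModelSpaceHomeomorph (I := I₂) (n := 1)
  have hnhds : (tangentOver (ℂ × ℂ) (chartDomain j)).1 ∈ 𝓝 v :=
    (tangentOver (ℂ × ℂ) (chartDomain j)).isOpen.mem_nhds hv
  have h3 := ((h2.comp_contMDiffOn h1).contMDiffAt hnhds).mdifferentiableAt (by simp)
  rw [modelWithCornersSelf_prod (𝕜 := ℂ) (E := ℂ × ℂ) (F := ℂ × ℂ)]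
  refine h3.congr_of_eventuallyEq ?_
  filter_upwards [hnhds] with w hw
  have : mfderivWithin I₂ I₂ (coord j) (chartDomain j) w.proj = mfderiv I₂ I₂ (coord j) w.proj :=
    mfderivWithin_of_isOpen (chartDomain j).isOpen hw
  exact Prod.ext rfl (DFunLike.congr_fun this w.2).symm

lemma tangentCoord_tangentVec (j : Fin 3) (z : (ℂ × ℂ) × (ℂ × ℂ)) :
    tangentCoord j (tangentVec j z) = z := by
  have hc : coord j ∘ param j = id := funext (coord_param j)
  have h := mfderiv_comp z.1 (mdifferentiableAt_coord (param_mem_chartDomain j z.1))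
    (mdifferentiableAt_param j z.1)
  rw [hc, mfderiv_id] at h
  refine Prod.ext (coord_param j z.1) ?_
  exact (DFunLike.congr_fun h z.2).symm

lemma tangentVec_tangentCoord {j : Fin 3} {v : TangentBundle I₂ A2Resolution}
    (hv : v.proj ∈ chartDomain j) : tangentVec j (tangentCoord j v) = v := by
  have hc : param j ∘ coord j =ᶠ[𝓝 v.proj] id := by
    filter_upwards [(chartDomain j).isOpen.mem_nhds hv] with q hq
    exact param_coord j q hq
  have h := mfderiv_comp v.proj (mdifferentiableAt_param j _) (mdifferentiableAt_coord hv)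
  rw [hc.mfderiv_eq, mfderiv_id] at h
  obtain ⟨q, w⟩ := v
  have hw := DFunLike.congr_fun h w
  have hq : param j (coord j q) = q := param_coord j q hv
  refine Bundle.TotalSpace.ext hq ?_
  exact heq_of_eq hw.symm

end A2Resolution

end

/-! ### Coefficients of a symmetric differential in a chart, and the change of charts on the torus
-/

noncomputable section

namespace A2Resolution

open SymmetricDifferential Laurent BinaryForm

local notation "I₂" => 𝓘(ℂ, ℂ × ℂ)

variable {m : ℕ} {U V : Opens A2Resolution}

/-- A symmetric differential in the `j`-th chart. -/
def rep (j : Fin 3) (f : sections (ℂ × ℂ) m U) (c w : ℂ × ℂ) : ℂ := extend f (tangentVec j (c, w))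

lemma rep_restrict (j : Fin 3) (h : U ≤ V) (f : sections (ℂ × ℂ) m V) {c : ℂ × ℂ}
    (hc : param j c ∈ U) (w : ℂ × ℂ) : rep j (restrict (ℂ × ℂ) m h f) c w = rep j f c w :=
  extend_restrict h f hc

lemma rep_add (j : Fin 3) (f g : sections (ℂ × ℂ) m U) (c w : ℂ × ℂ) :
    rep j (f + g) c w = rep j f c w + rep j g c w := extend_add f g _

lemma rep_smul (j : Fin 3) (a : ℂ) (f : sections (ℂ × ℂ) m U) (c w : ℂ × ℂ) :
    rep j (a • f) c w = a * rep j f c w := extend_smul a f _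

lemma isOpen_preimage_param (j : Fin 3) (U : Opens A2Resolution) :
    IsOpen {c : ℂ × ℂ | param j c ∈ U} := U.isOpen.preimage (continuous_param j)

lemma differentiableOn_rep (j : Fin 3) (f : sections (ℂ × ℂ) m U) :
    DifferentiableOn ℂ (fun z : (ℂ × ℂ) × (ℂ × ℂ) => rep j f z.1 z.2)
      {z | param j z.1 ∈ U} := fun z hz => by
  have h : MDifferentiableAt (I₂).tangent 𝓘(ℂ, ℂ) (extend f) (tangentVec j z) :=
    mdifferentiableAt_extend f hz
  exact (h.comp z (mdifferentiable_tangentVec j z)).differentiableAt.differentiableWithinAt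

lemma exists_multilinear (j : Fin 3) (f : sections (ℂ × ℂ) m U) {c : ℂ × ℂ}
    (hc : param j c ∈ U) :
    ∃ A : MultilinearMap ℂ (fun _ : Fin m => ℂ × ℂ) ℂ, ∀ w, rep j f c w = A fun _ => w := by
  obtain ⟨A, hA⟩ := f.2.2 ⟨param j c, hc⟩
  let L : ℂ × ℂ →L[ℂ] TangentSpace I₂ (param j c) := mfderiv I₂ I₂ (param j) c
  refine ⟨A.compLinearMap fun _ => L.toLinearMap, fun w => ?_⟩
  exact (extend_of_mem f (v := tangentVec j (c, w)) hc).trans (hA (L w))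

/-- Expand each argument in the standard basis; the terms are indexed by the set of slots that
receive the first basis vector, and `P i` collects the sets with `i` elements. -/
lemma exists_eq_sum_of_multilinear (A : MultilinearMap ℂ (fun _ : Fin m => ℂ × ℂ) ℂ) :
    ∃ P : ℕ → ℂ, ∀ w : ℂ × ℂ, A (fun _ => w) =
      ∑ i ∈ Finset.range (m + 1), P i * (w.1 ^ i * w.2 ^ (m - i)) := by
  classical
  refine ⟨fun i => ∑ s ∈ Finset.univ.filter (fun s : Finset (Fin m) => s.card = i),
    A (s.piecewise (fun _ => (1, 0)) (fun _ => (0, 1))), fun w => ?_⟩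
  have hw : (fun _ : Fin m => w) =
      (fun _ => w.1 • ((1 : ℂ), (0 : ℂ))) + fun _ => w.2 • ((0 : ℂ), (1 : ℂ)) := by
    ext <;> simp
  rw [hw, A.map_add_univ]
  have key : ∀ s : Finset (Fin m),
      A (s.piecewise (fun _ => w.1 • ((1 : ℂ), (0 : ℂ))) (fun _ => w.2 • ((0 : ℂ), (1 : ℂ)))) =
        A (s.piecewise (fun _ => (1, 0)) (fun _ => (0, 1))) *
          (w.1 ^ s.card * w.2 ^ (m - s.card)) := by
    intro s
    have e : s.piecewise (fun _ => w.1 • ((1 : ℂ), (0 : ℂ))) (fun _ => w.2 • ((0 : ℂ), (1 : ℂ))) =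
        fun i => (if i ∈ s then w.1 else w.2) •
          s.piecewise (fun _ => ((1 : ℂ), (0 : ℂ))) (fun _ => (0, 1)) i := by
      funext i
      by_cases hi : i ∈ s <;> simp [Finset.piecewise, hi]
    rw [e, A.map_smul_univ, Finset.prod_ite]
    simp only [Finset.prod_const, smul_eq_mul]
    rw [show (Finset.univ.filter fun i => i ∈ s) = s by ext; simp,
      show (Finset.univ.filter fun i => i ∉ s) = sᶜ by ext; simp, Finset.card_compl,
      Fintype.card_fin, mul_comm]
  simp only [key, Finset.sum_mul]
  rw [← Finset.sum_fiberwise_of_maps_to (s := Finset.univ) (t := Finset.range (m + 1))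
    (g := Finset.card) (fun s _ => by
      simpa [Nat.lt_succ_iff] using (Finset.card_le_univ s))]
  refine Finset.sum_congr rfl fun i _ => Finset.sum_congr rfl fun s hs => ?_
  rw [(Finset.mem_filter.mp hs).2]

lemma exists_multilinear_of_sum (P : ℕ → ℂ) :
    ∃ A : MultilinearMap ℂ (fun _ : Fin m => ℂ × ℂ) ℂ, ∀ w : ℂ × ℂ, A (fun _ => w) =
      ∑ i ∈ Finset.range (m + 1), P i * (w.1 ^ i * w.2 ^ (m - i)) := by
  classical
  refine ⟨∑ i ∈ Finset.range (m + 1), P i • (MultilinearMap.mkPiAlgebra ℂ (Fin m) ℂ).compLinearMap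
    (fun k : Fin m => if (k : ℕ) < i then LinearMap.fst ℂ ℂ ℂ else LinearMap.snd ℂ ℂ ℂ),
    fun w => ?_⟩
  simp only [sum_apply, smul_apply, smul_eq_mul,
    MultilinearMap.compLinearMap_apply, MultilinearMap.mkPiAlgebra_apply]
  refine Finset.sum_congr rfl fun i hi => ?_
  have hi' : i ≤ m := by simpa [Nat.lt_succ_iff] using hi
  congr 1
  have : ∀ k : Fin m, (if (k : ℕ) < i then LinearMap.fst ℂ ℂ ℂ else LinearMap.snd ℂ ℂ ℂ) w =
      if (k : ℕ) < i then w.1 else w.2 := fun k => by split_ifs <;> rfl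
  simp only [this]
  rw [Fin.prod_univ_eq_prod_range (fun k => if k < i then w.1 else w.2) m,
    ← Finset.prod_range_mul_prod_Ico _ hi',
    Finset.prod_congr rfl fun k hk => if_pos (Finset.mem_range.mp hk),
    Finset.prod_congr rfl fun k hk => if_neg (not_lt.mpr (Finset.mem_Ico.mp hk).1)]
  simp

/-- The coefficients of a symmetric differential in a chart are holomorphic. -/
lemma exists_coeff (j : Fin 3) (f : sections (ℂ × ℂ) m U) :
    ∃ F : ℕ → ℂ × ℂ → ℂ, (∀ i, DifferentiableOn ℂ (F i) {c | param j c ∈ U}) ∧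
      ∀ c, param j c ∈ U → ∀ w : ℂ × ℂ,
        rep j f c w = ∑ i ∈ Finset.range (m + 1), F i c * (w.1 ^ i * w.2 ^ (m - i)) := by
  obtain ⟨l, hl⟩ := exists_coeff_eq m
  -- Interpolation at the directions (t, 1), t = 0, …, m, writes the coefficients as fixed linear
  -- combinations of values of `f`, so they inherit holomorphy.
  refine ⟨fun i c => ∑ t ∈ Finset.range (m + 1), l i t * rep j f c ((t : ℂ), 1), fun i => ?_,
    fun c hc w => ?_⟩
  · refine DifferentiableOn.fun_sum fun t _ => DifferentiableOn.const_mul ?_ _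
    exact (differentiableOn_rep j f).comp
      (f := fun c : ℂ × ℂ => (c, ((t : ℂ), (1 : ℂ)))) (by fun_prop) fun c hc => hc
  · obtain ⟨A, hA⟩ := exists_multilinear j f hc
    obtain ⟨P, hP⟩ := exists_eq_sum_of_multilinear A
    set p : Polynomial ℂ := ∑ i ∈ Finset.range (m + 1), Polynomial.monomial i (P i) with hp
    have hdeg : p.natDegree ≤ m := by
      refine Polynomial.natDegree_sum_le_of_forall_le (Finset.range (m + 1))
        (fun i => Polynomial.monomial i (P i)) fun i hi => ?_
      exact (Polynomial.natDegree_monomial_le _).trans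
        (by simpa [Nat.lt_succ_iff] using hi)
    have hev : ∀ t : ℂ, p.eval t = rep j f c (t, 1) := fun t => by
      rw [hA, hP, hp]
      simp [Polynomial.eval_finsetSum]
    have hco : ∀ i ∈ Finset.range (m + 1), p.coeff i = P i := fun i hi => by
      rw [hp]
      simp only [Polynomial.finsetSum_coeff, Polynomial.coeff_monomial]
      rw [Finset.sum_ite_eq' _ i, if_pos hi]
    rw [hA, hP]
    refine Finset.sum_congr rfl fun i hi => ?_
    rw [← hco i hi, hl p hdeg]
    simp only [hev]

/-- A symmetric differential on an open subset of a chart is given by its coefficients. -/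
lemma exists_section (m : ℕ) (j : Fin 3) (hV : V ≤ chartDomain j) (F : ℕ → ℂ × ℂ → ℂ)
    (hF : ∀ i ≤ m, DifferentiableOn ℂ (F i) {c | param j c ∈ V}) :
    ∃ f : sections (ℂ × ℂ) m V, ∀ c w : ℂ × ℂ, param j c ∈ V →
      rep j f c w = ∑ i ∈ Finset.range (m + 1), F i c * (w.1 ^ i * w.2 ^ (m - i)) := by
  let G : (ℂ × ℂ) × (ℂ × ℂ) → ℂ := fun z =>
    ∑ i ∈ Finset.range (m + 1), F i z.1 * (z.2.1 ^ i * z.2.2 ^ (m - i))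
  have hG : DifferentiableOn ℂ G {z | param j z.1 ∈ V} := by
    refine DifferentiableOn.fun_sum fun i hi => DifferentiableOn.mul ?_ (by fun_prop)
    exact (hF i (by simpa [Nat.lt_succ_iff] using hi)).comp (by fun_prop) fun z hz => hz
  have hGo : IsOpen {z : (ℂ × ℂ) × (ℂ × ℂ) | param j z.1 ∈ V} :=
    (isOpen_preimage_param j V).preimage continuous_fst
  have hcoord : ∀ v : TangentBundle I₂ A2Resolution, v.proj ∈ V →
      param j (tangentCoord j v).1 ∈ V := fun v hv => by
    have : param j (coord j v.proj) = v.proj := param_coord j _ (hV hv)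
    change param j (coord j v.proj) ∈ V
    rwa [this]
  refine ⟨⟨fun v => G (tangentCoord j v), fun v => ?_, fun p => ?_⟩, fun c w hc => ?_⟩
  · rw [mdifferentiableAt_subtype_iff (f := fun v => G (tangentCoord j v))]
    have h1 : MDifferentiableAt 𝓘(ℂ, (ℂ × ℂ) × (ℂ × ℂ)) 𝓘(ℂ, ℂ) G (tangentCoord j v) :=
      (hG.differentiableAt (hGo.mem_nhds (hcoord v v.2))).mdifferentiableAt
    exact h1.comp v.1 (mdifferentiableAt_tangentCoord (hV v.2))
  · obtain ⟨A, hA⟩ := exists_multilinear_of_sum (m := m) fun i => F i (coord j p)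
    let L : TangentSpace I₂ (p : A2Resolution) →L[ℂ] ℂ × ℂ := mfderiv I₂ I₂ (coord j) p
    exact ⟨A.compLinearMap fun _ => L.toLinearMap, fun v => (hA (L v)).symm⟩
  · rw [rep, extend_of_mem _ (v := tangentVec j (c, w)) hc]
    change G (tangentCoord j (tangentVec j (c, w))) = _
    rw [tangentCoord_tangentVec]

lemma sections_ext_rep {f g : sections (ℂ × ℂ) m U}
    (h : ∀ j c, param j c ∈ U → ∀ w, rep j f c w = rep j g c w) : f = g := by
  refine Subtype.ext (funext fun v => ?_)
  obtain ⟨j, hj⟩ := exists_rep_ne_zero v.1.proj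
  have hv := tangentVec_tangentCoord (v := v.1) (j := j) hj
  have hU : param j (tangentCoord j v.1).1 ∈ U := by
    have : param j (coord j v.1.proj) = v.1.proj := param_coord j _ hj
    change param j (coord j v.1.proj) ∈ U
    rw [this]
    exact v.2
  have := h j (tangentCoord j v.1).1 hU (tangentCoord j v.1).2
  rw [rep, rep, hv, extend_apply, extend_apply] at this
  exact this

/-- The coordinates in the middle chart as functions of those in the `j`-th chart. -/
def toMiddle (j : Fin 3) (c : ℂ × ℂ) : ℂ × ℂ :=
  (mon ((j : ℕ), (j : ℕ) - 1) c, mon (1 - (j : ℕ), 2 - (j : ℕ)) c)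

lemma mon_ne_zero (n : ℤ × ℤ) {c : ℂ × ℂ} (h1 : c.1 ≠ 0) (h2 : c.2 ≠ 0) : mon n c ≠ 0 :=
  mul_ne_zero (zpow_ne_zero _ h1) (zpow_ne_zero _ h2)

lemma param_toMiddle (j : Fin 3) {c : ℂ × ℂ} (h1 : c.1 ≠ 0) (h2 : c.2 ≠ 0) :
    param 1 (toMiddle j c) = param j c := by
  have key : ∃ t : ℂ, t • vec j c = vec 1 (toMiddle j c) ∧
      scale j c = scale 1 (toMiddle j c) * t := by
    fin_cases j
    · refine ⟨c.2⁻¹, funext fun k => ?_, ?_⟩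
      · fin_cases k <;> simp [vec, toMiddle, mon] <;> field_simp
      · simp [scale, toMiddle, mon]
        field_simp
    · exact ⟨1, by simp [vec, toMiddle, mon], by simp [scale, toMiddle, mon]⟩
    · refine ⟨c.1⁻¹, funext fun k => ?_, ?_⟩
      · fin_cases k <;> simp [vec, toMiddle, mon] <;> field_simp
      · simp [scale, toMiddle, mon]
        field_simp
  obtain ⟨t, ht, hs⟩ := key
  ext1
  · change scale 1 (toMiddle j c) • vec 1 (toMiddle j c) = scale j c • vec j c
    rw [← ht, hs, smul_smul]
  · change Projectivization.mk ℂ (vec 1 (toMiddle j c)) _ = Projectivization.mk ℂ (vec j c) _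
    rw [Projectivization.mk_eq_mk_iff']
    exact ⟨t, ht⟩

lemma hasFDerivAt_mon (n : ℤ × ℤ) {c : ℂ × ℂ} (h1 : c.1 ≠ 0) (h2 : c.2 ≠ 0) :
    ∃ L : ℂ × ℂ →L[ℂ] ℂ, HasFDerivAt (mon n) L c ∧
      ∀ x y, L (c.1 * x, c.2 * y) = mon n c * (n.1 * x + n.2 * y) := by
  have f1 : HasFDerivAt (fun c : ℂ × ℂ => c.1) (ContinuousLinearMap.fst ℂ ℂ ℂ) c :=
    hasFDerivAt_fst
  have f2 : HasFDerivAt (fun c : ℂ × ℂ => c.2) (ContinuousLinearMap.snd ℂ ℂ ℂ) c :=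
    hasFDerivAt_snd
  have d1 := (hasDerivAt_zpow n.1 c.1 (.inl h1)).comp_hasFDerivAt c f1
  have d2 := (hasDerivAt_zpow n.2 c.2 (.inl h2)).comp_hasFDerivAt c f2
  refine ⟨_, d1.mul d2, fun x y => ?_⟩
  simp only [mon, Function.comp_apply, add_apply, smul_apply, ContinuousLinearMap.coe_fst',
    ContinuousLinearMap.coe_snd', smul_eq_mul, zpow_sub_one₀ h1, zpow_sub_one₀ h2]
  field_simp
  ring

/-- In `(c.1 * x, c.2 * y)` the numbers `x`, `y` are the values of dlog c.1 and dlog c.2. As the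
transition is monomial, these values change by its constant exponent matrix. -/
lemma rep_toMiddle (j : Fin 3) (f : sections (ℂ × ℂ) m U) {c : ℂ × ℂ} (h1 : c.1 ≠ 0)
    (h2 : c.2 ≠ 0) (x y : ℂ) :
    rep j f c (c.1 * x, c.2 * y) = rep 1 f (toMiddle j c)
      ((toMiddle j c).1 * ((j : ℕ) * x + ((j : ℕ) - 1) * y),
        (toMiddle j c).2 * ((1 - (j : ℕ)) * x + (2 - (j : ℕ)) * y)) := by
  obtain ⟨L1, hL1, e1⟩ := hasFDerivAt_mon ((j : ℕ), (j : ℕ) - 1) h1 h2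
  obtain ⟨L2, hL2, e2⟩ := hasFDerivAt_mon (1 - (j : ℕ), 2 - (j : ℕ)) h1 h2
  have hd : HasFDerivAt (toMiddle j) (L1.prod L2) c := hL1.prodMk hL2
  have heq : param j =ᶠ[𝓝 c] param 1 ∘ toMiddle j := by
    have o1 : IsOpen {c : ℂ × ℂ | c.1 ≠ 0 ∧ c.2 ≠ 0} :=
      (isOpen_ne_fun continuous_fst continuous_const).inter
        (isOpen_ne_fun continuous_snd continuous_const)
    filter_upwards [o1.mem_nhds ⟨h1, h2⟩] with d hd
    exact (param_toMiddle j hd.1 hd.2).symm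
  have hcomp := mfderiv_comp c (mdifferentiableAt_param 1 (toMiddle j c))
    hd.differentiableAt.mdifferentiableAt
  have hw : (L1.prod L2) (c.1 * x, c.2 * y) =
      ((toMiddle j c).1 * ((j : ℕ) * x + ((j : ℕ) - 1) * y),
        (toMiddle j c).2 * ((1 - (j : ℕ)) * x + (2 - (j : ℕ)) * y)) := by
    rw [ContinuousLinearMap.prod_apply, e1, e2]
    simp [toMiddle]
  have hm : mfderiv I₂ I₂ (toMiddle j) c = L1.prod L2 := by
    rw [mfderiv_eq_fderiv]
    exact hd.fderiv
  rw [← hw, rep, rep]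
  congr 1
  refine Bundle.TotalSpace.ext (param_toMiddle j h1 h2).symm (heq_of_eq ?_)
  have h3 := heq.mfderiv_eq (I := I₂) (I' := I₂)
  rw [hcomp, hm] at h3
  exact DFunLike.congr_fun h3 (c.1 * x, c.2 * y)

end A2Resolution

end

/-! ### Laurent expansions of symmetric differentials -/

noncomputable section

namespace BinaryForm

open Polynomial

lemma natDegree_sum_smul_le (m : ℕ) (j : ℤ) (a : ℕ → ℂ) :
    (∑ i ∈ Finset.range (m + 1), a i •
      ((X + C (1 - (j : ℂ))) ^ i * (C (j : ℂ) - X) ^ (m - i))).natDegree ≤ m := by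
  refine natDegree_sum_le_of_forall_le (Finset.range (m + 1)) (fun i => a i •
    ((X + C (1 - (j : ℂ))) ^ i * (C (j : ℂ) - X) ^ (m - i))) fun i hi => ?_
  have hi' : i ≤ m := by simpa [Nat.lt_succ_iff] using hi
  refine (natDegree_smul_le _ _).trans (natDegree_mul_le.trans ?_)
  have h1 : ((X + C (1 - (j : ℂ))) ^ i).natDegree ≤ i * 1 :=
    natDegree_pow_le_of_le i (by rw [natDegree_X_add_C])
  have h2 : ((C (j : ℂ) - X : ℂ[X]) ^ (m - i)).natDegree ≤ (m - i) * 1 :=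
    natDegree_pow_le_of_le _ ((natDegree_sub_le _ _).trans (by simp))
  omega

lemma homEval_sum_smul (m : ℕ) (j : ℤ) (a : ℕ → ℂ) (x y : ℂ) :
    homEval m (∑ i ∈ Finset.range (m + 1), a i •
      ((X + C (1 - (j : ℂ))) ^ i * (C (j : ℂ) - X) ^ (m - i))) (x + y) (j * x + (j - 1) * y) =
      ∑ i ∈ Finset.range (m + 1), a i * (x ^ i * y ^ (m - i)) := by
  set p := ∑ i ∈ Finset.range (m + 1), a i •
      ((X + C (1 - (j : ℂ))) ^ i * (C (j : ℂ) - X) ^ (m - i)) with hp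
  have hdeg : p.natDegree ≤ m := natDegree_sum_smul_le m j a
  have h1 : Continuous fun y : ℂ => homEval m p (x + y) (j * x + (j - 1) * y) := by
    unfold homEval
    fun_prop
  have h2 : Continuous fun y : ℂ => ∑ i ∈ Finset.range (m + 1), a i * (x ^ i * y ^ (m - i)) := by
    fun_prop
  refine congrFun (Continuous.ext_on (dense_compl_singleton (-x)) h1 h2 fun y hy => ?_) y
  have hu : x + y ≠ 0 := fun h => hy (eq_neg_of_add_eq_zero_right h)
  have e1 : (j * x + (j - 1) * y) / (x + y) + (1 - j) = x / (x + y) := by field_simp; ring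
  have e2 : j - (j * x + (j - 1) * y) / (x + y) = y / (x + y) := by field_simp; ring
  change homEval m p (x + y) (j * x + (j - 1) * y) = _
  rw [homEval_of_ne_zero hdeg hu, hp]
  simp only [eval_finsetSum, eval_smul, eval_mul, eval_pow, eval_add, eval_sub, eval_X, eval_C,
    smul_eq_mul, e1, e2, Finset.mul_sum]
  refine Finset.sum_congr rfl fun i hi => ?_
  have hi' : i ≤ m := by simpa [Nat.lt_succ_iff] using hi
  nth_rewrite 1 [← Nat.add_sub_cancel' hi']
  rw [pow_add, div_pow, div_pow]
  field_simp

end BinaryForm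

namespace A2Resolution

open SymmetricDifferential Laurent BinaryForm Polynomial

variable {m : ℕ} {U V : Opens A2Resolution}

/-- The exponents in the `j`-th chart of the weight `n`, that is, of the function
`y ^ n.1 * (x / y) ^ n.2`. -/
def wt (j : Fin 3) : ℤ × ℤ ≃ ℤ × ℤ where
  toFun n := (n.1 + (j : ℕ) * n.2, n.1 + ((j : ℕ) - 1) * n.2)
  invFun k := (k.1 - (j : ℕ) * (k.1 - k.2), k.1 - k.2)
  left_inv n := Prod.ext (by simp only; ring) (by simp only; ring)
  right_inv k := Prod.ext (by simp only; ring) (by simp only; ring)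

lemma wt_fst (j : Fin 3) (n : ℤ × ℤ) : (wt j n).1 = n.1 + (j : ℕ) * n.2 := rfl

lemma wt_snd (j : Fin 3) (n : ℤ × ℤ) : (wt j n).2 = n.1 + ((j : ℕ) - 1) * n.2 := rfl

/-- The vanishing order at `r` that regularity along the `r`-th divisor requires in weight `n`. -/
def ord (m : ℕ) (n : ℤ × ℤ) (r : ℤ) : ℕ := (m - (n.1 + r * n.2)).toNat

/-- The form `p n` is regular in weight `n` along the `r`-th divisor. -/
def reg (m : ℕ) (n : ℤ × ℤ) (r : ℤ) : Submodule ℂ ℂ[X] := vanishing m r (ord m n r)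

lemma mon_wt_toMiddle (j : Fin 3) (n : ℤ × ℤ) {c : ℂ × ℂ} (h1 : c.1 ≠ 0) (h2 : c.2 ≠ 0) :
    mon (wt 1 n) (toMiddle j c) = mon (wt j n) c := by
  simp only [mon, toMiddle, wt_fst, wt_snd, mul_zpow, ← zpow_mul]
  calc _ = (c.1 ^ ((j : ℕ) * (n.1 + ((1 : Fin 3) : ℕ) * n.2) : ℤ) *
          c.1 ^ ((1 - (j : ℕ)) * (n.1 + (((1 : Fin 3) : ℕ) - 1) * n.2) : ℤ)) *
        (c.2 ^ (((j : ℕ) - 1) * (n.1 + ((1 : Fin 3) : ℕ) * n.2) : ℤ) *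
          c.2 ^ ((2 - (j : ℕ)) * (n.1 + (((1 : Fin 3) : ℕ) - 1) * n.2) : ℤ)) := by ring
    _ = _ := by
      rw [← zpow_add₀ h1, ← zpow_add₀ h2]
      congr 2 <;> · simp only [Fin.val_one, Nat.cast_one]; ring

/-- The symmetric differential `f` has the Laurent expansion with coefficients `p` on the torus. -/
structure HasExpansion (f : sections (ℂ × ℂ) m U) (p : ℤ × ℤ → ℂ[X]) : Prop where
  natDegree_le : ∀ n, (p n).natDegree ≤ m
  hasSum : ∀ (j : Fin 3) (c : ℂ × ℂ), c.1 ≠ 0 → c.2 ≠ 0 → param j c ∈ U → ∀ x y : ℂ,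
    HasSum (fun n => mon (wt j n) c * homEval m (p n) (x + y) ((j : ℕ) * x + ((j : ℕ) - 1) * y))
      (rep j f c (c.1 * x, c.2 * y))

/-- Weights and the forms u, v are attached to the torus and not to a chart, so the coefficients are
the same in every chart. -/
lemma HasExpansion.of_middle {f : sections (ℂ × ℂ) m U} {p : ℤ × ℤ → ℂ[X]}
    (hp : ∀ n, (p n).natDegree ≤ m) (h : ∀ c : ℂ × ℂ, c.1 ≠ 0 → c.2 ≠ 0 → param 1 c ∈ U →
      ∀ x y : ℂ, HasSum (fun n => mon (wt 1 n) c * homEval m (p n) (x + y) x)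
        (rep 1 f c (c.1 * x, c.2 * y))) : HasExpansion f p := by
  refine ⟨hp, fun j c h1 h2 hc x y => ?_⟩
  rw [rep_toMiddle j f h1 h2]
  have := h (toMiddle j c) (mon_ne_zero _ h1 h2) (mon_ne_zero _ h1 h2)
    (by rwa [param_toMiddle j h1 h2]) ((j : ℕ) * x + ((j : ℕ) - 1) * y)
    ((1 - (j : ℕ)) * x + (2 - (j : ℕ)) * y)
  refine this.congr_fun fun n => ?_
  rw [mon_wt_toMiddle j n h1 h2]
  congr 2
  ring

/-- A holomorphic symmetric differential on a complete Reinhardt domain has a Laurent expansion. -/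
lemma exists_hasExpansion (f : sections (ℂ × ℂ) m U)
    (hU : IsCompleteReinhardt {c : ℂ × ℂ | c.1 ≠ 0 ∧ c.2 ≠ 0 ∧ param 1 c ∈ U}) :
    ∃ p, HasExpansion f p := by
  obtain ⟨F, hF, hFf⟩ := exists_coeff 1 f
  -- Passing from the frame dc.1, dc.2 to the logarithmic frame multiplies the i-th coefficient by
  -- this monomial.
  have hd : ∀ i, DifferentiableOn ℂ (fun c : ℂ × ℂ => F i c * (c.1 ^ i * c.2 ^ (m - i)))
      {c : ℂ × ℂ | c.1 ≠ 0 ∧ c.2 ≠ 0 ∧ param 1 c ∈ U} := fun i =>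
    ((hF i).mono fun c hc => hc.2.2).mul (by fun_prop)
  choose a ha using fun i => exists_hasSum hU (hd i)
  refine ⟨fun n => ∑ i ∈ Finset.range (m + 1), a i (wt 1 n) •
      ((X + C (1 - ((1 : ℤ) : ℂ))) ^ i * (C ((1 : ℤ) : ℂ) - X) ^ (m - i)),
    .of_middle (fun n => natDegree_sum_smul_le m 1 _) fun c h1 h2 hc x y => ?_⟩
  have hx : ∀ n, homEval m (∑ i ∈ Finset.range (m + 1), a i (wt 1 n) •
      ((X + C (1 - ((1 : ℤ) : ℂ))) ^ i * (C ((1 : ℤ) : ℂ) - X) ^ (m - i))) (x + y) x =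
      ∑ i ∈ Finset.range (m + 1), a i (wt 1 n) * (x ^ i * y ^ (m - i)) := fun n => by
    rw [← homEval_sum_smul m 1]
    congr 1
    push_cast
    ring
  simp only [hx, Finset.mul_sum]
  rw [hFf c hc]
  refine hasSum_sum fun i hi => ?_
  have hi' : i ≤ m := by simpa [Nat.lt_succ_iff] using hi
  have := ((wt 1).hasSum_iff.mpr (ha i c ⟨h1, h2, hc⟩)).mul_right (x ^ i * y ^ (m - i))
  have e : F i c * ((c.1 * x) ^ i * (c.2 * y) ^ (m - i)) =
      F i c * (c.1 ^ i * c.2 ^ (m - i)) * (x ^ i * y ^ (m - i)) := by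
    rw [mul_pow, mul_pow]
    ring
  rw [e]
  refine this.congr_fun fun n => ?_
  simp only [Function.comp_apply]
  ring

namespace HasExpansion

variable {f g : sections (ℂ × ℂ) m U} {p q : ℤ × ℤ → ℂ[X]}

lemma restrict (h : V ≤ U) (hf : HasExpansion f p) :
    HasExpansion (SymmetricDifferential.restrict (ℂ × ℂ) m h f) p :=
  ⟨hf.1, fun j c h1 h2 hc x y => by
    rw [rep_restrict j h f hc]
    exact hf.2 j c h1 h2 (h hc) x y⟩

lemma add (hf : HasExpansion f p) (hg : HasExpansion g q) : HasExpansion (f + g) (p + q) :=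
  ⟨fun n => (natDegree_add_le _ _).trans (max_le (hf.1 n) (hg.1 n)), fun j c h1 h2 hc x y => by
    rw [rep_add]
    refine ((hf.2 j c h1 h2 hc x y).add (hg.2 j c h1 h2 hc x y)).congr_fun fun n => ?_
    rw [Pi.add_apply, homEval_add, mul_add]⟩

lemma smul (a : ℂ) (hf : HasExpansion f p) : HasExpansion (a • f) (a • p) :=
  ⟨fun n => (natDegree_smul_le _ _).trans (hf.1 n), fun j c h1 h2 hc x y => by
    rw [rep_smul]
    refine ((hf.2 j c h1 h2 hc x y).mul_left a).congr_fun fun n => ?_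
    rw [Pi.smul_apply, homEval_smul]
    ring⟩

lemma sub (hf : HasExpansion f p) (hg : HasExpansion g q) : HasExpansion (f - g) (p - q) := by
  have e1 : f - g = f + (-1 : ℂ) • g := by module
  have e2 : p - q = p + (-1 : ℂ) • q := by module
  rw [e1, e2]
  exact hf.add (hg.smul (-1))

/-- The Laurent expansion determines the symmetric differential. -/
lemma eq (hf : HasExpansion f p) (hg : HasExpansion g p) : f = g := by
  refine sections_ext_rep fun j c hc w => ?_
  have hcont : ∀ f : sections (ℂ × ℂ) m U, ContinuousOn (fun c => rep j f c w)
      {c | param j c ∈ U} := fun f => (differentiableOn_rep j f).continuousOn.comp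
    (f := fun c : ℂ × ℂ => (c, w)) (by fun_prop) fun c hc => hc
  -- The expansion fixes the values only on the torus; density and continuity carry equality to the
  -- divisors.
  have hdense : Dense {c : ℂ × ℂ | c.1 ≠ 0 ∧ c.2 ≠ 0} :=
    (dense_compl_singleton (0 : ℂ)).prod (dense_compl_singleton (0 : ℂ))
  have hsub : c ∈ closure ({c | param j c ∈ U} ∩ {c : ℂ × ℂ | c.1 ≠ 0 ∧ c.2 ≠ 0}) :=
    hdense.open_subset_closure_inter (isOpen_preimage_param j U) hc
  have := mem_closure_iff_nhdsWithin_neBot.mp hsub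
  have t1 := ((hcont f) c hc).mono_left (nhdsWithin_mono c
    (inter_subset_left (t := {c : ℂ × ℂ | c.1 ≠ 0 ∧ c.2 ≠ 0})))
  have t2 := ((hcont g) c hc).mono_left (nhdsWithin_mono c
    (inter_subset_left (t := {c : ℂ × ℂ | c.1 ≠ 0 ∧ c.2 ≠ 0})))
  refine tendsto_nhds_unique_of_eventuallyEq t1 t2 ?_
  filter_upwards [self_mem_nhdsWithin] with d hd
  obtain ⟨hdU, h1, h2⟩ := hd
  have hw : w = (d.1 * (w.1 / d.1), d.2 * (w.2 / d.2)) := by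
    ext <;> simp <;> field_simp
  rw [hw]
  exact (hf.2 j d h1 h2 hdU _ _).unique (hg.2 j d h1 h2 hdU _ _)

/-- The chosen tangent vector is the one with u = 1 and v = t, so the form of weight n takes the
value p n (t). -/
lemma hasSum_eval (hf : HasExpansion f p) (j : Fin 3) {c : ℂ × ℂ} (h1 : c.1 ≠ 0) (h2 : c.2 ≠ 0)
    (hc : param j c ∈ U) (t : ℂ) : HasSum (fun n => mon (wt j n) c * (p n).eval t)
      (rep j f c (c.1 * (t + 1 - (j : ℕ)), c.2 * ((j : ℕ) - t))) := by
  refine (hf.2 j c h1 h2 hc _ _).congr_fun fun n => ?_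
  rw [show t + 1 - (j : ℕ) + ((j : ℕ) - t) = (1 : ℂ) by ring,
    show (j : ℕ) * (t + 1 - (j : ℕ)) + ((j : ℕ) - 1) * ((j : ℕ) - t) = t by ring,
    homEval_one (hf.1 n)]

lemma summable (hf : HasExpansion f p) (j : Fin 3) {c : ℂ × ℂ} (h1 : c.1 ≠ 0) (h2 : c.2 ≠ 0)
    (hc : param j c ∈ U) : Summable fun n => ‖mon (wt j n) c‖ * coeffNorm m (p n) := by
  obtain ⟨l, hl⟩ := exists_coeff_eq m
  simp only [coeffNorm, Finset.mul_sum]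
  refine summable_sum fun k _ => ?_
  have : Summable fun n => mon (wt j n) c * (p n).coeff k := by
    have hs : Summable fun n => ∑ t ∈ Finset.range (m + 1),
        l k t * (mon (wt j n) c * (p n).eval (t : ℂ)) :=
      summable_sum fun t _ => (hf.hasSum_eval j h1 h2 hc t).summable.mul_left _
    refine hs.congr fun n => ?_
    rw [hl (p n) (hf.1 n), Finset.mul_sum]
    exact Finset.sum_congr rfl fun t _ => by ring
  simpa only [norm_mul] using this.norm

/-- The coefficients of the expansion are unique. -/
lemma coeff_unique (hf : HasExpansion f p) (hg : HasExpansion f q) {ρ : ℝ × ℝ} (h1 : 0 < ρ.1)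
    (h2 : 0 < ρ.2) (hρ : ∀ z, param 1 (torusPt ρ z) ∈ U) : p = q := by
  have hne : ∀ z, (torusPt ρ z).1 ≠ 0 ∧ (torusPt ρ z).2 ≠ 0 := fun z =>
    ⟨norm_pos_iff.mp (by rwa [norm_torusPt_fst h1.le]),
      norm_pos_iff.mp (by rwa [norm_torusPt_snd h2.le])⟩
  funext n
  refine Polynomial.funext fun t => ?_
  have key : ∀ r : ℤ × ℤ → ℂ[X], HasExpansion f r → ∀ z,
      HasSum (fun k => (r ((wt 1).symm k)).eval t * mon k (torusPt ρ z))
        (rep 1 f (torusPt ρ z) ((torusPt ρ z).1 * (t + 1 - ((1 : Fin 3) : ℕ)),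
          (torusPt ρ z).2 * (((1 : Fin 3) : ℕ) - t))) := fun r hr z => by
    rw [← (wt 1).hasSum_iff]
    refine (hr.hasSum_eval 1 (hne z).1 (hne z).2 (hρ z) t).congr_fun fun n => ?_
    simp [mul_comm]
  have := congrFun (Laurent.coeff_unique (g := fun c => rep 1 f c
    (c.1 * (t + 1 - ((1 : Fin 3) : ℕ)), c.2 * (((1 : Fin 3) : ℕ) - t))) h1 h2 (key p hf) (key q hg))
    (wt 1 n)
  simpa using this

/-- Both sides are recovered from the expansion at the directions (t, 1) by the same interpolation
formula. This gives the scalar Laurent series to which Cauchy's estimate is applied. -/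
lemma hasSum_chartCoeff (hf : HasExpansion f p) (j : Fin 3) {F : ℕ → ℂ × ℂ → ℂ}
    {c : ℂ × ℂ} (h1 : c.1 ≠ 0) (h2 : c.2 ≠ 0) (hc : param j c ∈ U)
    (hF : ∀ w : ℂ × ℂ,
      rep j f c w = ∑ i ∈ Finset.range (m + 1), F i c * (w.1 ^ i * w.2 ^ (m - i)))
    {i : ℕ} (hi : i ≤ m) :
    HasSum (fun n => chartCoeff m (j : ℕ) i (p n) * mon (wt j n) c)
      (F i c * (c.1 ^ i * c.2 ^ (m - i))) := by
  obtain ⟨l, hl⟩ := exists_coeff_eq m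
  set P : ℂ[X] := ∑ i ∈ Finset.range (m + 1), monomial i (F i c * (c.1 ^ i * c.2 ^ (m - i)))
    with hP
  have hdeg : P.natDegree ≤ m := by
    refine natDegree_sum_le_of_forall_le (Finset.range (m + 1))
      (fun i => monomial i (F i c * (c.1 ^ i * c.2 ^ (m - i)))) fun i hi => ?_
    exact (natDegree_monomial_le _).trans (by simpa [Nat.lt_succ_iff] using hi)
  have hev : ∀ t : ℂ, P.eval t = rep j f c (c.1 * t, c.2 * 1) := fun t => by
    rw [hF, hP]
    simp only [eval_finsetSum, eval_monomial, mul_one, mul_pow]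
    exact Finset.sum_congr rfl fun i _ => by ring
  have hco : P.coeff i = F i c * (c.1 ^ i * c.2 ^ (m - i)) := by
    rw [hP]
    simp only [finsetSum_coeff, coeff_monomial]
    rw [Finset.sum_ite_eq' _ i, if_pos (by simpa [Nat.lt_succ_iff] using hi)]
  rw [← hco, hl P hdeg i]
  have := hasSum_sum (s := Finset.range (m + 1)) fun t _ =>
    (hf.2 j c h1 h2 hc (t : ℂ) 1).mul_left (l i t)
  simp only [hev]
  refine this.congr_fun fun n => ?_
  rw [chartCoeff_eq, hl _ (natDegree_chartForm_le _ _ _), Finset.sum_mul]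
  refine Finset.sum_congr rfl fun t _ => ?_
  rw [eval_chartForm, mul_one]
  push_cast
  ring

lemma norm_chartCoeff_le (hf : HasExpansion f p) (j : Fin 3) {F : ℕ → ℂ × ℂ → ℂ} {ρ : ℝ × ℝ}
    {M : ℝ} (h1 : 0 < ρ.1) (h2 : 0 < ρ.2) (hρ : ∀ z, param j (torusPt ρ z) ∈ U)
    (hF : ∀ c, param j c ∈ U → ∀ w : ℂ × ℂ,
      rep j f c w = ∑ i ∈ Finset.range (m + 1), F i c * (w.1 ^ i * w.2 ^ (m - i)))
    {i : ℕ} (hi : i ≤ m) (hM : ∀ z, ‖F i (torusPt ρ z)‖ ≤ M) (n : ℤ × ℤ) :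
    ‖chartCoeff m (j : ℕ) i (p n)‖ * (ρ.1 ^ (wt j n).1 * ρ.2 ^ (wt j n).2) ≤
      M * (ρ.1 ^ i * ρ.2 ^ (m - i)) := by
  have hne : ∀ z, (torusPt ρ z).1 ≠ 0 ∧ (torusPt ρ z).2 ≠ 0 := fun z =>
    ⟨norm_pos_iff.mp (by rwa [norm_torusPt_fst h1.le]),
      norm_pos_iff.mp (by rwa [norm_torusPt_snd h2.le])⟩
  have := norm_coeff_le (a := fun k => chartCoeff m (j : ℕ) i (p ((wt j).symm k)))
    (g := fun c => F i c * (c.1 ^ i * c.2 ^ (m - i))) (M := M * (ρ.1 ^ i * ρ.2 ^ (m - i)))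
    h1.le h2.le (fun z => by
      rw [← (wt j).hasSum_iff]
      refine (hf.hasSum_chartCoeff j (hne z).1 (hne z).2 (hρ z) (hF _ (hρ z)) hi).congr_fun
        fun n => ?_
      simp) (fun z => by
      simp only [norm_mul, norm_pow, norm_torusPt_fst h1.le, norm_torusPt_snd h2.le]
      exact mul_le_mul_of_nonneg_right (hM z) (by positivity)) (wt j n)
  simpa using this

end HasExpansion

lemma eq_zero_of_forall_le_mul {a B r₀ : ℝ} (ha : 0 ≤ a) (hr₀ : 0 < r₀) {k : ℕ} (hk : 0 < k)
    (h : ∀ r, 0 < r → r ≤ r₀ → a ≤ B * r ^ k) : a = 0 := by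
  have ht : Tendsto (fun r : ℝ => B * r ^ k) (𝓝[>] 0) (𝓝 0) := by
    have : Continuous fun r : ℝ => B * r ^ k := by fun_prop
    simpa [hk.ne'] using (this.tendsto 0).mono_left (nhdsWithin_le_nhds (s := Ioi 0))
  refine le_antisymm (ge_of_tendsto ht ?_) ha
  filter_upwards [Ioc_mem_nhdsGT hr₀] with r hr
  exact h r hr.1 hr.2

lemma zpow_bound_aux {a M r A : ℝ} (hr : 0 < r) {k : ℤ} {i : ℕ} (hk : k < i)
    (h : a * (r ^ k * A) ≤ M * r ^ i) (hA : 0 < A) : a ≤ M / A * r ^ (i - k).toNat := by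
  have e : r ^ i = r ^ k * r ^ (i - k).toNat := by
    rw [← zpow_natCast, ← zpow_natCast, ← zpow_add₀ hr.ne']
    congr 1
    omega
  rw [e] at h
  have hp : 0 < r ^ k := zpow_pos hr k
  rw [div_mul_eq_mul_div, le_div_iff₀ hA]
  refine le_of_mul_le_mul_right ?_ hp
  linarith

/-- A symmetric differential that is holomorphic at the generic point of the `j`-th divisor has
regular coefficients along it. -/
lemma HasExpansion.mem_reg {f : sections (ℂ × ℂ) m U} {p : ℤ × ℤ → ℂ[X]}
    (hf : HasExpansion f p) (j : Fin 3) {ρ : ℝ × ℝ} (h1 : 0 < ρ.1) (h2 : 0 < ρ.2)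
    (hU : ∀ c : ℂ × ℂ, ‖c.1‖ ≤ ρ.1 → ‖c.2‖ = ρ.2 → param j c ∈ U) (n : ℤ × ℤ) :
    p n ∈ reg m n (j : ℕ) := by
  obtain ⟨F, hF, hFf⟩ := exists_coeff j f
  refine mem_vanishing_of_chartCoeff (hf.1 n) fun i hi hie => ?_
  have hki : (wt j n).1 < i := by
    rw [wt_fst]
    simp only [ord] at hie
    omega
  obtain ⟨M, hM⟩ := ((isCompact_closedBall (0 : ℂ) ρ.1).prod
    (isCompact_sphere (0 : ℂ) ρ.2)).exists_bound_of_continuousOn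
    ((hF i).continuousOn.mono fun c hc => hU c (by simpa using hc.1) (by simpa using hc.2))
  rw [← norm_eq_zero]
  -- `F i` stays bounded up to c.1 = 0, so the Cauchy estimate on the torus of radii `(r, ρ.2)` is a
  -- constant times r to the positive power `i - (wt j n).1`; let r tend to 0.
  refine eq_zero_of_forall_le_mul (B := M * ρ.2 ^ (m - i) / ρ.2 ^ (wt j n).2)
    (k := (i - (wt j n).1).toNat) (norm_nonneg _) h1 (by omega) fun r hr hr1 => ?_
  have hz : ∀ z, ‖(torusPt (r, ρ.2) z).1‖ ≤ ρ.1 ∧ ‖(torusPt (r, ρ.2) z).2‖ = ρ.2 := fun z =>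
    ⟨by rwa [norm_torusPt_fst (ρ := (r, ρ.2)) hr.le],
      norm_torusPt_snd (ρ := (r, ρ.2)) h2.le z⟩
  have := hf.norm_chartCoeff_le j (ρ := (r, ρ.2)) hr h2 (fun z => hU _ (hz z).1 (hz z).2) hFf hi
    (fun z => hM _ ⟨by simpa using (hz z).1, by simpa using (hz z).2⟩) n
  refine zpow_bound_aux hr hki ?_ (zpow_pos h2 _)
  simp only at this
  linarith

/-- The mirror case: c.2 = 0 is divisor `j - 1` in chart `j`, and the exponents of the second
coordinate are bounded below instead. -/
lemma HasExpansion.mem_reg' {f : sections (ℂ × ℂ) m U} {p : ℤ × ℤ → ℂ[X]}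
    (hf : HasExpansion f p) (j : Fin 3) {ρ : ℝ × ℝ} (h1 : 0 < ρ.1) (h2 : 0 < ρ.2)
    (hU : ∀ c : ℂ × ℂ, ‖c.1‖ = ρ.1 → ‖c.2‖ ≤ ρ.2 → param j c ∈ U) (n : ℤ × ℤ) :
    p n ∈ reg m n ((j : ℕ) - 1) := by
  obtain ⟨F, hF, hFf⟩ := exists_coeff j f
  refine mem_vanishing_of_chartCoeff' (hf.1 n) fun i hi hie => ?_
  have hki : (wt j n).2 < (m - i : ℕ) := by
    rw [wt_snd]
    simp only [ord] at hie
    omega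
  obtain ⟨M, hM⟩ := ((isCompact_sphere (0 : ℂ) ρ.1).prod
    (isCompact_closedBall (0 : ℂ) ρ.2)).exists_bound_of_continuousOn
    ((hF i).continuousOn.mono fun c hc => hU c (by simpa using hc.1) (by simpa using hc.2))
  rw [← norm_eq_zero]
  refine eq_zero_of_forall_le_mul (B := M * ρ.1 ^ i / ρ.1 ^ (wt j n).1)
    (k := ((m - i : ℕ) - (wt j n).2).toNat) (norm_nonneg _) h2 (by omega) fun r hr hr1 => ?_
  have hz : ∀ z, ‖(torusPt (ρ.1, r) z).1‖ = ρ.1 ∧ ‖(torusPt (ρ.1, r) z).2‖ ≤ ρ.2 := fun z =>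
    ⟨norm_torusPt_fst (ρ := (ρ.1, r)) h1.le z,
      by rwa [norm_torusPt_snd (ρ := (ρ.1, r)) hr.le]⟩
  have := hf.norm_chartCoeff_le j (ρ := (ρ.1, r)) h1 hr (fun z => hU _ (hz z).1 (hz z).2) hFf hi
    (fun z => hM _ ⟨by simpa using (hz z).1, by simpa using (hz z).2⟩) n
  refine zpow_bound_aux hr hki ?_ (zpow_pos h1 _)
  simp only at this
  linarith

end A2Resolution

end

/-! ### Gluing, and the synthesis of symmetric differentials from Laurent series -/

noncomputable section

namespace A2Resolution

open SymmetricDifferential Laurent BinaryForm Polynomial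

variable {m : ℕ} {U V : Opens A2Resolution}

/-- The open set with coordinates in `N` in the `j`-th chart. -/
def chartOpen (j : Fin 3) (N : Opens (ℂ × ℂ)) : Opens A2Resolution :=
  ⟨chartDomain j ∩ coord j ⁻¹' N,
    (contMDiffOn_coord j).continuousOn.isOpen_inter_preimage (chartDomain j).isOpen N.isOpen⟩

lemma param_mem_chartOpen {j : Fin 3} {N : Opens (ℂ × ℂ)} {c : ℂ × ℂ} :
    param j c ∈ chartOpen j N ↔ c ∈ N := by
  change (param j c ∈ chartDomain j ∧ coord j (param j c) ∈ N) ↔ c ∈ N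
  rw [coord_param]
  exact and_iff_right (param_mem_chartDomain j c)

lemma chartOpen_le (j : Fin 3) (N : Opens (ℂ × ℂ)) : chartOpen j N ≤ chartDomain j :=
  fun _ h => h.1

/-- Symmetric differentials with a given Laurent expansion can be glued. -/
lemma exists_hasExpansion_of_local {p : ℤ × ℤ → ℂ[X]} (hp : ∀ n, (p n).natDegree ≤ m)
    (h : ∀ q ∈ U, ∃ N : Opens A2Resolution, q ∈ N ∧ ∃ g : sections (ℂ × ℂ) m N,
      HasExpansion g p) : ∃ f : sections (ℂ × ℂ) m U, HasExpansion f p := by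
  classical
  choose! N hN g hg using h
  -- Local sections with the same expansion coincide on overlaps, so they need no further
  -- compatibility.
  have agree : ∀ q ∈ U, ∀ q' ∈ U, ∀ v : TangentBundle 𝓘(ℂ, ℂ × ℂ) A2Resolution,
      v.proj ∈ N q → v.proj ∈ N q' → extend (g q) v = extend (g q') v := by
    intro q hq q' hq' v hv hv'
    have := ((hg q hq).restrict (V := N q ⊓ N q') inf_le_left).eq
      ((hg q' hq').restrict (V := N q ⊓ N q') inf_le_right)
    rw [← extend_restrict (inf_le_left : N q ⊓ N q' ≤ N q) (g q) (v := v) ⟨hv, hv'⟩, this,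
      extend_restrict (inf_le_right : N q ⊓ N q' ≤ N q') (g q') (v := v) ⟨hv, hv'⟩]
  let F : TangentBundle 𝓘(ℂ, ℂ × ℂ) A2Resolution → ℂ := fun v => extend (g v.proj) v
  have hF : ∀ q ∈ U, ∀ v : TangentBundle 𝓘(ℂ, ℂ × ℂ) A2Resolution,
      v.proj ∈ N q → v.proj ∈ U → F v = extend (g q) v := fun q hq v hv hU =>
    agree _ hU q hq v (hN _ hU) hv
  refine ⟨⟨fun v => F v, mem_sections_of_local fun q hq => ⟨N q, hN q hq, g q, hF q hq⟩⟩,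
    hp, fun j c h1 h2 hc x y => ?_⟩
  have := (hg _ hc).2 j c h1 h2 (hN _ hc) x y
  rw [rep, extend_of_mem _ (v := tangentVec j (c, (c.1 * x, c.2 * y))) hc]
  exact this

/-- Two symmetric differentials that agree on the intersection of their domains can be glued. -/
lemma exists_glue {A B W : Opens A2Resolution} (hW : W ≤ A ⊔ B) (hA : A ≤ W)
    (f : sections (ℂ × ℂ) m A) (g : sections (ℂ × ℂ) m B)
    (h : restrict (ℂ × ℂ) m (inf_le_left : A ⊓ B ≤ A) f =
      restrict (ℂ × ℂ) m (inf_le_right : A ⊓ B ≤ B) g) :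
    ∃ F : sections (ℂ × ℂ) m W, restrict (ℂ × ℂ) m hA F = f := by
  classical
  let F : TangentBundle 𝓘(ℂ, ℂ × ℂ) A2Resolution → ℂ := fun v =>
    if v.proj ∈ A then extend f v else extend g v
  have hFA : ∀ v : TangentBundle 𝓘(ℂ, ℂ × ℂ) A2Resolution, v.proj ∈ A → F v = extend f v :=
    fun v hv => if_pos hv
  have hFB : ∀ v : TangentBundle 𝓘(ℂ, ℂ × ℂ) A2Resolution, v.proj ∈ B → F v = extend g v := by
    intro v hv
    by_cases hA : v.proj ∈ A
    · rw [hFA v hA, ← extend_restrict (inf_le_left : A ⊓ B ≤ A) f (v := v) ⟨hA, hv⟩, h,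
        extend_restrict (inf_le_right : A ⊓ B ≤ B) g (v := v) ⟨hA, hv⟩]
    · exact if_neg hA
  refine ⟨⟨fun v => F v, mem_sections_of_local fun q hq => ?_⟩, Subtype.ext (funext fun v => ?_)⟩
  · rcases hW hq with h | h
    · exact ⟨A, h, f, fun v hv _ => hFA v hv⟩
    · exact ⟨B, h, g, fun v hv _ => hFB v hv⟩
  · exact (hFA v.1 v.2).trans (extend_apply f v)

lemma mon_sub (n k : ℤ × ℤ) {c : ℂ × ℂ} (h1 : c.1 ≠ 0) (h2 : c.2 ≠ 0) :
    mon (n - k) c * mon k c = mon n c := by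
  simp only [mon, Prod.fst_sub, Prod.snd_sub]
  calc _ = (c.1 ^ (n.1 - k.1) * c.1 ^ k.1) * (c.2 ^ (n.2 - k.2) * c.2 ^ k.2) := by ring
    _ = _ := by rw [← zpow_add₀ h1, ← zpow_add₀ h2, sub_add_cancel, sub_add_cancel]

/-- The term of weight `n` in the coefficient of index `i` in the `j`-th chart. -/
def term (m : ℕ) (j : Fin 3) (p : ℤ × ℤ → ℂ[X]) (i : ℕ) (n : ℤ × ℤ) (c : ℂ × ℂ) : ℂ :=
  chartCoeff m (j : ℕ) i (p n) * mon (wt j n - ((i : ℤ), ((m - i : ℕ) : ℤ))) c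

lemma chartCoeff_eq_zero_of_reg {j : Fin 3} {p : ℤ × ℤ → ℂ[X]} {n : ℤ × ℤ}
    (h : p n ∈ reg m n (j : ℕ)) {i : ℕ} (hk : (wt j n).1 < i) :
    chartCoeff m (j : ℕ) i (p n) = 0 := by
  refine chartCoeff_eq_zero h ?_
  simp only [wt_fst, ord] at *
  omega

lemma chartCoeff_eq_zero_of_reg' {j : Fin 3} {p : ℤ × ℤ → ℂ[X]} {n : ℤ × ℤ}
    (h : p n ∈ reg m n ((j : ℕ) - 1)) {i : ℕ} (hi : i ≤ m) (hk : (wt j n).2 < (m - i : ℕ)) :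
    chartCoeff m (j : ℕ) i (p n) = 0 := by
  refine chartCoeff_eq_zero' h ?_
  simp only [wt_snd, ord] at *
  omega

/-- A negative exponent matters only where its coordinate vanishes, and there regularity forces the
coefficient to be zero. So regularity is needed only along divisors through `c`. -/
lemma differentiableAt_term {j : Fin 3} {p : ℤ × ℤ → ℂ[X]} {n : ℤ × ℤ} {i : ℕ} (hi : i ≤ m)
    {c : ℂ × ℂ} (h1 : c.1 = 0 → p n ∈ reg m n (j : ℕ))
    (h2 : c.2 = 0 → p n ∈ reg m n ((j : ℕ) - 1)) :
    DifferentiableAt ℂ (term m j p i n) c := by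
  by_cases h0 : chartCoeff m (j : ℕ) i (p n) = 0
  · have : term m j p i n = fun _ => 0 := funext fun c => by simp [term, h0]
    rw [this]
    exact differentiableAt_const 0
  · have e1 : c.1 ≠ 0 ∨ 0 ≤ (wt j n).1 - i := by
      by_contra! h
      exact h0 (chartCoeff_eq_zero_of_reg (h1 h.1) (by omega))
    have e2 : c.2 ≠ 0 ∨ 0 ≤ (wt j n).2 - (m - i : ℕ) := by
      by_contra! h
      exact h0 (chartCoeff_eq_zero_of_reg' (h2 h.1) hi (by omega))
    unfold term mon
    exact ((differentiableAt_fst.zpow e1).mul (differentiableAt_snd.zpow e2)).const_mul _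

/-- A series of regular terms with summable bounds is a symmetric differential. -/
lemma exists_hasExpansion_chartOpen (j : Fin 3) (N : Opens (ℂ × ℂ)) {p : ℤ × ℤ → ℂ[X]}
    (hp : ∀ n, (p n).natDegree ≤ m) (h1 : ∀ c ∈ N, c.1 = 0 → ∀ n, p n ∈ reg m n (j : ℕ))
    (h2 : ∀ c ∈ N, c.2 = 0 → ∀ n, p n ∈ reg m n ((j : ℕ) - 1))
    (hb : ∀ i ≤ m, ∃ u : ℤ × ℤ → ℝ, Summable u ∧ ∀ n, ∀ c ∈ N, ‖term m j p i n c‖ ≤ u n) :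
    ∃ f : sections (ℂ × ℂ) m (chartOpen j N), HasExpansion f p := by
  have hF : ∀ i ≤ m, DifferentiableOn ℂ (fun c => ∑' n, term m j p i n c)
      {c | param j c ∈ chartOpen j N} := fun i hi => by
    obtain ⟨u, hu, hbu⟩ := hb i hi
    have : {c | param j c ∈ chartOpen j N} = N := ext fun c => param_mem_chartOpen
    rw [this]
    exact differentiableOn_tsum N.isOpen hu (fun n c hc => (differentiableAt_term hi
      (fun h => h1 c hc h n) (fun h => h2 c hc h n)).differentiableWithinAt) hbu
  obtain ⟨f, hf⟩ := exists_section m j (chartOpen_le j N) _ hF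
  refine ⟨f, hp, fun j' c a1 a2 hc x y => ?_⟩
  have key : ∀ (c : ℂ × ℂ), c.1 ≠ 0 → c.2 ≠ 0 → param j c ∈ chartOpen j N → ∀ x y : ℂ,
      HasSum (fun n => mon (wt j n) c *
        homEval m (p n) (x + y) ((j : ℕ) * x + ((j : ℕ) - 1) * y))
        (rep j f c (c.1 * x, c.2 * y)) := by
    intro c a1 a2 hc x y
    rw [hf c _ hc]
    have hh : ∀ n, homEval m (p n) (x + y) ((j : ℕ) * x + ((j : ℕ) - 1) * y) =
        ∑ i ∈ Finset.range (m + 1), chartCoeff m (j : ℕ) i (p n) * (x ^ i * y ^ (m - i)) :=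
      fun n => by
        rw [← homEval_eq_sum_chartCoeff]
        push_cast
        rfl
    simp only [hh, Finset.mul_sum]
    refine hasSum_sum fun i hi => ?_
    have hi' : i ≤ m := by simpa [Nat.lt_succ_iff] using hi
    obtain ⟨u, hu, hbu⟩ := hb i hi'
    have hs : HasSum (fun n => term m j p i n c) (∑' n, term m j p i n c) :=
      (Summable.of_norm_bounded hu fun n => hbu n c (param_mem_chartOpen.mp hc)).hasSum
    refine (hs.mul_right _).congr_fun fun n => ?_
    rw [← mon_sub (wt j n) ((i : ℤ), ((m - i : ℕ) : ℤ)) a1 a2, term, mul_pow, mul_pow]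
    simp only [mon, zpow_natCast]
    ring
  have o : param j' c ∈ chartDomain j := chartOpen_le j N hc
  have hmid : ∀ c : ℂ × ℂ, c.1 ≠ 0 → c.2 ≠ 0 →
      ∃ d : ℂ × ℂ, d.1 ≠ 0 ∧ d.2 ≠ 0 ∧ toMiddle j d = c := by
    intro c a1 a2
    -- The exponent matrix of `toMiddle j` has determinant 1; these are the exponents of its
    -- inverse.
    refine ⟨(mon (2 - (j : ℕ), 1 - (j : ℕ)) c, mon ((j : ℕ) - 1, (j : ℕ)) c), mon_ne_zero _ a1 a2,
      mon_ne_zero _ a1 a2, Prod.ext ?_ ?_⟩ <;> fin_cases j <;> simp [toMiddle, mon] <;> field_simp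
  refine (HasExpansion.of_middle hp fun c a1 a2 hc x y => ?_ : HasExpansion f p).2 j' c a1 a2 hc x y
  obtain ⟨d, d1, d2, rfl⟩ := hmid c a1 a2
  rw [param_toMiddle j d1 d2] at hc
  have := key d d1 d2 hc ((2 - (j : ℕ)) * x + (1 - (j : ℕ)) * y)
    (((j : ℕ) - 1) * x + (j : ℕ) * y)
  rw [rep_toMiddle j f d1 d2] at this
  convert! this.congr_fun fun n => ?_ using 3
  · ring
  · ring
  · rw [mon_wt_toMiddle j n d1 d2]
    congr 2 <;> ring

/-- Synthesis of a symmetric differential on a bidisc in a chart. -/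
lemma exists_hasExpansion_bidisc (j : Fin 3) {p : ℤ × ℤ → ℂ[X]}
    (h1 : ∀ n, p n ∈ reg m n (j : ℕ)) (h2 : ∀ n, p n ∈ reg m n ((j : ℕ) - 1)) {c₀ : ℂ × ℂ}
    (hc₀1 : c₀.1 ≠ 0) (hc₀2 : c₀.2 ≠ 0)
    (hs : Summable fun n => ‖mon (wt j n) c₀‖ * coeffNorm m (p n)) :
    ∃ N : Opens (ℂ × ℂ), (∀ c : ℂ × ℂ, c ∈ N ↔ ‖c.1‖ < ‖c₀.1‖ ∧ ‖c.2‖ < ‖c₀.2‖) ∧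
      ∃ f : sections (ℂ × ℂ) m (chartOpen j N), HasExpansion f p := by
  have o1 : Continuous fun c : ℂ × ℂ => ‖c.1‖ := by fun_prop
  have o2 : Continuous fun c : ℂ × ℂ => ‖c.2‖ := by fun_prop
  refine ⟨⟨{c | ‖c.1‖ < ‖c₀.1‖ ∧ ‖c.2‖ < ‖c₀.2‖}, (isOpen_lt o1 continuous_const).inter
    (isOpen_lt o2 continuous_const)⟩, fun c => Iff.rfl, ?_⟩
  refine exists_hasExpansion_chartOpen j _ (fun n => (h1 n).1) (fun c _ _ => h1)
    (fun c _ _ => h2) fun i hi => ?_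
  obtain ⟨K, hK0, hK⟩ := exists_bound m (chartCoeff m (j : ℕ) i)
  have p1 : 0 < ‖c₀.1‖ := norm_pos_iff.mpr hc₀1
  have p2 : 0 < ‖c₀.2‖ := norm_pos_iff.mpr hc₀2
  refine ⟨fun n => (K * (‖mon ((i : ℤ), ((m - i : ℕ) : ℤ)) c₀‖)⁻¹) *
    (‖mon (wt j n) c₀‖ * coeffNorm m (p n)), hs.mul_left _, fun n c hc => ?_⟩
  -- A term with non-zero coefficient has non-negative exponents, so its monomial is at most its
  -- value at `c₀`. This is why one point of convergence controls the whole bidisc.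
  by_cases h0 : chartCoeff m (j : ℕ) i (p n) = 0
  · rw [term, h0, zero_mul, norm_zero]
    have := coeffNorm_nonneg m (p n)
    positivity
  · have e1 : (i : ℤ) ≤ (wt j n).1 := by
      by_contra! h
      exact h0 (chartCoeff_eq_zero_of_reg (h1 n) h)
    have e2 : ((m - i : ℕ) : ℤ) ≤ (wt j n).2 := by
      by_contra! h
      exact h0 (chartCoeff_eq_zero_of_reg' (h2 n) hi h)
    have hz : ∀ {a b : ℝ} {k l : ℤ}, 0 ≤ a → a < b → l ≤ k → a ^ (k - l) ≤ b ^ k * (b ^ l)⁻¹ := by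
      intro a b k l ha hab hkl
      rw [← div_eq_mul_inv, ← zpow_sub₀ (by linarith)]
      obtain ⟨r, hr⟩ := Int.eq_ofNat_of_zero_le (sub_nonneg.mpr hkl)
      rw [hr, zpow_natCast, zpow_natCast]
      exact pow_le_pow_left₀ ha hab.le r
    have hm : ‖mon (wt j n - ((i : ℤ), ((m - i : ℕ) : ℤ))) c‖ ≤
        ‖mon (wt j n) c₀‖ * (‖mon ((i : ℤ), ((m - i : ℕ) : ℤ)) c₀‖)⁻¹ := by
      simp only [norm_mon, Prod.fst_sub, Prod.snd_sub]
      calc _ ≤ (‖c₀.1‖ ^ (wt j n).1 * (‖c₀.1‖ ^ (i : ℤ))⁻¹) *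
            (‖c₀.2‖ ^ (wt j n).2 * (‖c₀.2‖ ^ ((m - i : ℕ) : ℤ))⁻¹) := by
            refine mul_le_mul (hz (norm_nonneg _) hc.1 e1) (hz (norm_nonneg _) hc.2 e2)
              (zpow_nonneg (norm_nonneg _) _) (by positivity)
        _ = _ := by rw [mul_inv]; ring
    rw [term, norm_mul]
    calc _ ≤ (K * coeffNorm m (p n)) *
          (‖mon (wt j n) c₀‖ * (‖mon ((i : ℤ), ((m - i : ℕ) : ℤ)) c₀‖)⁻¹) :=
          mul_le_mul (hK _ (h1 n).1) hm (norm_nonneg _)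
            (mul_nonneg hK0 (coeffNorm_nonneg m (p n)))
      _ = _ := by ring

/-- Laurent polynomials are symmetric differentials where their terms are regular. -/
lemma exists_hasExpansion_of_finite {p : ℤ × ℤ → ℂ[X]} (hp : ∀ n, (p n).natDegree ≤ m)
    (hfin : {n | p n ≠ 0}.Finite)
    (h1 : ∀ (j : Fin 3) (c : ℂ × ℂ), param j c ∈ U → c.1 = 0 → ∀ n, p n ∈ reg m n (j : ℕ))
    (h2 : ∀ (j : Fin 3) (c : ℂ × ℂ), param j c ∈ U → c.2 = 0 → ∀ n, p n ∈ reg m n ((j : ℕ) - 1)) :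
    ∃ f : sections (ℂ × ℂ) m U, HasExpansion f p := by
  refine exists_hasExpansion_of_local hp fun q hq => ?_
  obtain ⟨j, hj⟩ := exists_rep_ne_zero q
  set c := coord j q with hc
  have hcq : param j c = q := param_coord j q hj
  have hcU : param j c ∈ U := by rwa [hcq]
  -- With finitely many non-zero terms, continuity at `c` gives common bounds near `c`, and
  -- summability of the bounds is automatic.
  have hcont : ∀ i ∈ Finset.range (m + 1), ∀ n, ∀ᶠ d in 𝓝 c,
      ‖term m j p i n d‖ ≤ ‖term m j p i n c‖ + 1 := by
    intro i hi n
    have hi' : i ≤ m := by simpa [Nat.lt_succ_iff] using hi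
    have := (differentiableAt_term (n := n) hi' (fun h => h1 j c hcU h n)
      (fun h => h2 j c hcU h n)).continuousAt.norm
    exact (this.eventually (gt_mem_nhds (lt_add_one _))).mono fun d hd => hd.le
  have hev : ∀ᶠ d in 𝓝 c, d ∈ {d | param j d ∈ U} ∧ ∀ i ∈ Finset.range (m + 1),
      ∀ n ∈ {n | p n ≠ 0}, ‖term m j p i n d‖ ≤ ‖term m j p i n c‖ + 1 := by
    refine Filter.Eventually.and (show ∀ᶠ d in 𝓝 c, d ∈ {d | param j d ∈ U} from
      (isOpen_preimage_param j U).mem_nhds hcU) ?_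
    rw [Filter.eventually_all_finset]
    intro i hi
    rw [Filter.eventually_all_finite hfin]
    exact fun n _ => hcont i hi n
  obtain ⟨N, hN, hNo, hcN⟩ := eventually_nhds_iff.mp hev
  refine ⟨chartOpen j ⟨N, hNo⟩, ?_, exists_hasExpansion_chartOpen j ⟨N, hNo⟩ hp
    (fun d hd => h1 j d (hN d hd).1) (fun d hd => h2 j d (hN d hd).1) fun i hi => ?_⟩
  · rw [← hcq]
    exact param_mem_chartOpen.mpr hcN
  · classical
    refine ⟨fun n => if p n ≠ 0 then ‖term m j p i n c‖ + 1 else 0,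
      summable_of_ne_finset_zero (s := hfin.toFinset) fun n hn => ?_, fun n d hd => ?_⟩
    · simp only [Set.Finite.mem_toFinset, mem_ofPred_eq] at hn
      exact if_neg hn
    · by_cases h : p n = 0
      · simp [term, h]
      · simp only [ne_eq, h, not_false_eq_true, if_true]
        exact (hN d hd).2 i (by simpa [Nat.lt_succ_iff] using hi) n h

end A2Resolution

end

/-! ### The extension quotient -/

noncomputable section

/-- The dimension of a quotient that decomposes into weight spaces. -/
lemma finrank_quotient_eq_sum {V X ι : Type*} [AddCommGroup V] [Module ℂ V] [AddCommGroup X]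
    [Module ℂ X] (R : Submodule ℂ V) (A B : ι → Submodule ℂ X) [∀ n, FiniteDimensional ℂ (A n)]
    (hBA : ∀ n, B n ≤ A n) (L : V →ₗ[ℂ] ι → X) (S : Finset ι) (hA : ∀ f n, L f n ∈ A n)
    (hR : ∀ f, f ∈ R ↔ ∀ n, L f n ∈ B n) (hS : ∀ n ∉ S, A n ≤ B n)
    (hL : ∀ a : ι → X, (∀ n, a n ∈ A n) → (∀ n ∉ S, a n = 0) → ∃ f, L f = a) :
    FiniteDimensional ℂ (V ⧸ R) ∧ Module.finrank ℂ (V ⧸ R) =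
      ∑ n ∈ S, (Module.finrank ℂ (A n) - Module.finrank ℂ (B n)) := by
  classical
  -- The kernel is `R`, because weights outside `S` impose no condition; `hL` is needed only for
  -- finitely supported families and gives surjectivity.
  let Ψ : V →ₗ[ℂ] ∀ n : S, (A n ⧸ (B n).submoduleOf (A n)) := LinearMap.pi fun n =>
    ((B n).submoduleOf (A n)).mkQ ∘ₗ
      ((LinearMap.proj (R := ℂ) (φ := fun _ : ι => X) n.1 ∘ₗ L).codRestrict (A n) fun f => hA f n)
  have hker : LinearMap.ker Ψ = R := by
    ext f
    rw [hR, LinearMap.mem_ker, funext_iff]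
    have : ∀ n : S, Ψ f n = 0 ↔ L f n ∈ B n := fun n => by
      change ((B n).submoduleOf (A n)).mkQ _ = 0 ↔ _
      rw [Submodule.mkQ_apply, Submodule.Quotient.mk_eq_zero]
      rfl
    constructor
    · intro h n
      by_cases hn : n ∈ S
      · exact (this ⟨n, hn⟩).mp (h ⟨n, hn⟩)
      · exact hS n hn (hA f n)
    · exact fun h n => (this n).mpr (h n)
  have hsurj : Function.Surjective Ψ := by
    intro b
    choose a ha using fun n : S => Submodule.mkQ_surjective _ (b n)
    obtain ⟨f, hf⟩ := hL (fun n => if h : n ∈ S then (a ⟨n, h⟩ : X) else 0) (fun n => by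
      by_cases h : n ∈ S
      · simp [h]
      · simp [h]) (fun n hn => by simp [hn])
    refine ⟨f, funext fun n => ?_⟩
    rw [← ha n]
    change ((B n).submoduleOf (A n)).mkQ _ = _
    congr 1
    refine Subtype.ext ?_
    change L f n = a n
    rw [hf]
    simp
  have e := (Submodule.quotEquivOfEq _ _ hker.symm).trans (Ψ.quotKerEquivOfSurjective hsurj)
  refine ⟨e.symm.finiteDimensional, ?_⟩
  rw [e.finrank_eq, Module.finrank_pi_fintype, ← Finset.sum_coe_sort S]
  refine Finset.sum_congr rfl fun n _ => ?_
  rw [Submodule.finrank_quotient, (Submodule.submoduleOfEquivOfLe (hBA n)).finrank_eq]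

namespace A2Resolution

open SymmetricDifferential Laurent BinaryForm Polynomial

variable {m : ℕ} {U V : Opens A2Resolution}

/-- The Laurent expansion as a linear map. -/
lemma exists_laurent (m : ℕ)
    (hU : IsCompleteReinhardt {c : ℂ × ℂ | c.1 ≠ 0 ∧ c.2 ≠ 0 ∧ param 1 c ∈ U})
    {ρ : ℝ × ℝ} (h1 : 0 < ρ.1) (h2 : 0 < ρ.2) (hρ : ∀ z, param 1 (torusPt ρ z) ∈ U) :
    ∃ L : sections (ℂ × ℂ) m U →ₗ[ℂ] ℤ × ℤ → ℂ[X], ∀ f, HasExpansion f (L f) := by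
  choose p hp using fun f : sections (ℂ × ℂ) m U => exists_hasExpansion f hU
  exact ⟨{ toFun := p
           map_add' := fun f g => (hp (f + g)).coeff_unique ((hp f).add (hp g)) h1 h2 hρ
           map_smul' := fun a f => (hp (a • f)).coeff_unique ((hp f).smul a) h1 h2 hρ }, hp⟩

/-- The coordinates of ℂ³ are monomials with non-negative exponents in every chart. This makes tubes
Reinhardt. -/
lemma norm_pt_param_le (j : Fin 3) (k : Fin 3) {c d : ℂ × ℂ} (h1 : ‖d.1‖ ≤ ‖c.1‖)
    (h2 : ‖d.2‖ ≤ ‖c.2‖) : ‖(param j d).pt k‖ ≤ ‖(param j c).pt k‖ := by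
  fin_cases j <;> fin_cases k <;> simp [param, scale, vec] <;> gcongr

lemma continuous_pt (k : Fin 3) : Continuous fun q : A2Resolution => q.pt k := by
  rw [continuous_iff_continuousAt]
  intro q
  obtain ⟨j, hj⟩ := exists_rep_ne_zero q
  have h1 : ContinuousAt (coord j) q :=
    (contMDiffOn_coord j).continuousOn.continuousAt ((chartDomain j).isOpen.mem_nhds hj)
  have h2 : Continuous fun c => (param j c).pt k :=
    ((contDiff_scale j).mul (contDiff_vec j k)).continuous
  refine (h2.continuousAt.comp h1).congr ?_
  filter_upwards [(chartDomain j).isOpen.mem_nhds hj] with q' hq'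
  simp only [Function.comp_apply]
  rw [param_coord j q' hq']

/-- The preimage of a polydisc around the singular point. -/
def tube (ε : ℝ) : Opens A2Resolution :=
  ⟨{q | ∀ k, ‖q.pt k‖ < ε}, by
    simp only [Set.ofPred_forall]
    exact isOpen_iInter_of_finite fun k => isOpen_lt (continuous_pt k).norm continuous_const⟩

lemma param_mem_tube_of_le {ε : ℝ} {j : Fin 3} {c d : ℂ × ℂ} (h : param j c ∈ tube ε)
    (h1 : ‖d.1‖ ≤ ‖c.1‖) (h2 : ‖d.2‖ ≤ ‖c.2‖) : param j d ∈ tube ε :=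
  fun k => (norm_pt_param_le j k h1 h2).trans_lt (h k)

lemma mem_regular {q : A2Resolution} : q ∈ regular ↔ q.pt ≠ 0 := Iff.rfl

lemma param_mem_regular {j : Fin 3} {c : ℂ × ℂ} : param j c ∈ regular ↔ scale j c ≠ 0 := by
  rw [mem_regular]
  change scale j c • vec j c ≠ 0 ↔ _
  simp [vec_ne_zero]

lemma scale_ne_zero (j : Fin 3) {c : ℂ × ℂ} (h1 : c.1 ≠ 0) (h2 : c.2 ≠ 0) : scale j c ≠ 0 := by
  fin_cases j <;> simp [scale, h1, h2]

lemma exists_param_mem_tube {ε : ℝ} (hε : 0 < ε) :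
    ∃ δ : ℝ, 0 < δ ∧ ∀ (j : Fin 3) (c : ℂ × ℂ), ‖c.1‖ ≤ δ → ‖c.2‖ ≤ δ → param j c ∈ tube ε := by
  have h0 : ∀ j : Fin 3, ∀ᶠ t : ℝ in 𝓝 0, param j ((t : ℂ), (t : ℂ)) ∈ tube ε := fun j => by
    have hc : Continuous fun t : ℝ => param j ((t : ℂ), (t : ℂ)) :=
      (continuous_param j).comp (by fun_prop)
    refine hc.continuousAt.eventually ((tube ε).isOpen.mem_nhds fun k => ?_)
    have : (param j (((0 : ℝ) : ℂ), ((0 : ℝ) : ℂ))).pt k = 0 := by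
      fin_cases j <;> simp [param, scale]
    rw [this, norm_zero]
    exact hε
  have h1 : ∀ᶠ t : ℝ in 𝓝[>] 0, ∀ j, param j ((t : ℂ), (t : ℂ)) ∈ tube ε :=
    (eventually_all.mpr h0).filter_mono nhdsWithin_le_nhds
  obtain ⟨δ, hδ, hδ0⟩ := (h1.and self_mem_nhdsWithin).exists
  have hδ0 : 0 < δ := hδ0
  have hn : ‖(δ : ℂ)‖ = δ := by simp [hδ0.le]
  exact ⟨δ, hδ0, fun j c a b => param_mem_tube_of_le (hδ j) (by rwa [hn]) (by rwa [hn])⟩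

/-- The tubes form a neighbourhood basis of the exceptional locus. -/
lemma exists_tube_le {W : Opens A2Resolution} (hW : exceptional ⊆ W) :
    ∃ ε : ℝ, 0 < ε ∧ tube ε ≤ W := by
  have key : ∀ j : Fin 3, ∃ ε : ℝ, 0 < ε ∧ ∀ c : ℂ × ℂ, ‖c.1‖ ≤ 1 → ‖c.2‖ ≤ 1 →
      ‖scale j c‖ < ε → param j c ∈ W := by
    intro j
    -- Zeros of `scale` are points of E, hence in `W`; so |scale| has a positive minimum on the
    -- compact part of the unit bidisc outside `W`.
    have hK : IsCompact ((Metric.closedBall (0 : ℂ) 1 ×ˢ Metric.closedBall (0 : ℂ) 1) ∩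
        {c : ℂ × ℂ | param j c ∈ W}ᶜ) :=
      ((isCompact_closedBall _ _).prod (isCompact_closedBall _ _)).inter_right
        (isOpen_preimage_param j W).isClosed_compl
    rcases eq_empty_or_nonempty ((Metric.closedBall (0 : ℂ) 1 ×ˢ Metric.closedBall (0 : ℂ) 1) ∩
        {c : ℂ × ℂ | param j c ∈ W}ᶜ) with he | hne
    · refine ⟨1, one_pos, fun c h1 h2 _ => ?_⟩
      by_contra h
      have hcK : c ∈ (Metric.closedBall (0 : ℂ) 1 ×ˢ Metric.closedBall (0 : ℂ) 1) ∩
          {c : ℂ × ℂ | param j c ∈ W}ᶜ := ⟨⟨by simpa using h1, by simpa using h2⟩, h⟩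
      rw [he] at hcK
      exact hcK
    · obtain ⟨c₀, hc₀, hmin⟩ := hK.exists_isMinOn hne
        (contDiff_scale j).continuous.norm.continuousOn
      refine ⟨‖scale j c₀‖, ?_, fun c h1 h2 h => ?_⟩
      · rw [norm_pos_iff]
        intro h0
        refine hc₀.2 (hW ?_)
        change scale j c₀ • vec j c₀ = 0
        rw [h0, zero_smul]
      · by_contra hcW
        have hcK : c ∈ (Metric.closedBall (0 : ℂ) 1 ×ˢ Metric.closedBall (0 : ℂ) 1) ∩
            {c : ℂ × ℂ | param j c ∈ W}ᶜ := ⟨⟨by simpa using h1, by simpa using h2⟩, hcW⟩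
        exact absurd (hmin hcK) (not_le.mpr h)
  choose ε hε hεW using key
  have hmin : 0 < min (min (ε 0) (ε 1)) (min (ε 2) 1) := by simp [hε]
  refine ⟨_, hmin, fun q hq => ?_⟩
  have hlt : ∀ k, ‖q.pt k‖ < ε 0 ∧ ‖q.pt k‖ < ε 1 ∧ ‖q.pt k‖ < ε 2 ∧ ‖q.pt k‖ < 1 := fun k => by
    have := hq k
    simp only [lt_min_iff] at this
    exact ⟨this.1.1, this.1.2, this.2.1, this.2.2⟩
  -- In the chart of the largest homogeneous coordinate the ratios have modulus at most 1. As the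
  -- point is small too, its chart coordinates lie in the closed unit bidisc.
  obtain ⟨j, hj⟩ := Finite.exists_max fun k => ‖q.line.rep k‖
  have hj0 : q.line.rep j ≠ 0 := by
    obtain ⟨k, hk⟩ := exists_rep_ne_zero q
    exact norm_pos_iff.mp ((norm_pos_iff.mpr hk).trans_le (hj k))
  set c := coord j q with hc
  have hcq : param j c = q := param_coord j q hj0
  have hvec : ∀ k, ‖vec j c k‖ ≤ 1 := fun k => by
    have := ratio_param j j k c
    rw [hcq, vec_self, div_one] at this
    rw [← this, norm_div]
    exact div_le_one_of_le₀ (hj k) (norm_nonneg _)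
  have hs : scale j c = q.pt j := by
    rw [← hcq]
    change _ = scale j c * vec j c j
    rw [vec_self, mul_one]
  rw [← hcq]
  have h01 : ‖q.pt j‖ ≤ 1 := (hlt j).2.2.2.le
  rw [← hs] at h01
  refine hεW j c ?_ ?_ ?_
  · fin_cases j
    · exact h01
    · exact hvec 0
    · exact hvec 1
  · fin_cases j
    · exact hvec 1
    · exact hvec 2
    · exact h01
  · rw [hs]
    fin_cases j
    · exact (hlt _).1
    · exact (hlt _).2.1
    · exact (hlt _).2.2.1

lemma isCompleteReinhardt_of_tube {ε : ℝ} {U : Opens A2Resolution} (hU : U ≤ tube ε)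
    (hU' : tube ε ⊓ regular ≤ U) :
    IsCompleteReinhardt {c : ℂ × ℂ | c.1 ≠ 0 ∧ c.2 ≠ 0 ∧ param 1 c ∈ U} where
  isOpen := (isOpen_ne_fun continuous_fst continuous_const).inter
    ((isOpen_ne_fun continuous_snd continuous_const).inter (isOpen_preimage_param 1 U))
  ne_zero _ hs := ⟨hs.1, hs.2.1⟩
  mem _ hs _ h1 h2 h3 h4 := ⟨h1, h2, hU' ⟨param_mem_tube_of_le (hU hs.2.2) h3 h4,
    param_mem_regular.mpr (scale_ne_zero 1 h1 h2)⟩⟩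

/-- The dimension of the extension quotient in weight `n`. -/
def extDim (m : ℕ) (n : ℤ × ℤ) : ℕ :=
  (m + 1 - (ord m n (-1) + ord m n 2)) -
    (m + 1 - (ord m n (-1) + ord m n 2 + ord m n 0 + ord m n 1))

/-- A finite set that contains all weights that occur in the cohomology. -/
def weightBox (m : ℕ) : Finset (ℤ × ℤ) :=
  Finset.Icc (-2 * m : ℤ) (3 * m) ×ˢ Finset.Icc (-1 * m : ℤ) (1 * m)

lemma not_mem_weightBox {m : ℕ} {n : ℤ × ℤ} (h : n ∉ weightBox m) :
    n.1 < -(2 * m) ∨ 3 * m < n.1 ∨ n.2 < -m ∨ m < n.2 := by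
  simp only [weightBox, Finset.mem_product, Finset.mem_Icc] at h
  omega

/-- A Riemann extension in terms of coefficients: convergence on the torus part of the tube is known
from `f`, and regularity along all four divisors makes the same series converge across E. -/
lemma exists_hasExpansion_tube {ε : ℝ} {f : sections (ℂ × ℂ) m (tube ε ⊓ regular)}
    {p : ℤ × ℤ → ℂ[X]} (hf : HasExpansion f p)
    (hp : ∀ n, p n ∈ reg m n (-1) ∧ p n ∈ reg m n 0 ∧ p n ∈ reg m n 1 ∧ p n ∈ reg m n 2) :
    ∃ g : sections (ℂ × ℂ) m (tube ε), HasExpansion g p := by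
  refine exists_hasExpansion_of_local hf.1 fun q hq => ?_
  obtain ⟨j, hj⟩ := exists_rep_ne_zero q
  set c := coord j q with hc
  have hcq : param j c = q := param_coord j q hj
  -- For small t > 0 this comparison point is in the tube and on the torus, even if `q` lies on a
  -- divisor, and the bidisc below it contains `q`.
  have hcont : Continuous fun t : ℝ => param j (((‖c.1‖ + t : ℝ) : ℂ), ((‖c.2‖ + t : ℝ) : ℂ)) :=
    (continuous_param j).comp (by fun_prop)
  have h0 : param j (((‖c.1‖ + 0 : ℝ) : ℂ), ((‖c.2‖ + 0 : ℝ) : ℂ)) ∈ tube ε :=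
    param_mem_tube_of_le (c := c) (by rwa [hcq]) (by simp) (by simp)
  have hev : ∀ᶠ t : ℝ in 𝓝[>] 0,
      param j (((‖c.1‖ + t : ℝ) : ℂ), ((‖c.2‖ + t : ℝ) : ℂ)) ∈ tube ε :=
    (hcont.continuousAt.eventually ((tube ε).isOpen.mem_nhds h0)).filter_mono nhdsWithin_le_nhds
  obtain ⟨t, ht, ht0⟩ := (hev.and self_mem_nhdsWithin).exists
  have ht0 : 0 < t := ht0
  have p1 : 0 < ‖c.1‖ + t := by positivity
  have p2 : 0 < ‖c.2‖ + t := by positivity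
  have n1 : ((‖c.1‖ + t : ℝ) : ℂ) ≠ 0 := by exact_mod_cast p1.ne'
  have n2 : ((‖c.2‖ + t : ℝ) : ℂ) ≠ 0 := by exact_mod_cast p2.ne'
  have hreg : ∀ n, p n ∈ reg m n (j : ℕ) ∧ p n ∈ reg m n ((j : ℕ) - 1) := fun n => by
    obtain ⟨r₀, r₁, r₂, r₃⟩ := hp n
    fin_cases j
    · exact ⟨by simpa using r₁, by simpa using r₀⟩
    · exact ⟨by simpa using r₂, by simpa using r₁⟩
    · refine ⟨by simpa using r₃, ?_⟩
      norm_num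
      exact r₂
  obtain ⟨N, hN, g, hg⟩ := exists_hasExpansion_bidisc j (fun n => (hreg n).1)
    (fun n => (hreg n).2) (c₀ := (((‖c.1‖ + t : ℝ) : ℂ), ((‖c.2‖ + t : ℝ) : ℂ))) n1 n2
    (hf.summable j n1 n2 ⟨ht, param_mem_regular.mpr (scale_ne_zero j n1 n2)⟩)
  refine ⟨chartOpen j N, ?_, g, hg⟩
  rw [← hcq, param_mem_chartOpen, hN]
  simp only [Complex.norm_real, Real.norm_eq_abs, abs_of_pos p1, abs_of_pos p2]
  constructor <;> linarith

/-- The dimension of the extension quotient. -/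
theorem finrank_extensionQuotient {W : Opens A2Resolution} (hW : exceptional ⊆ W) (m : ℕ) :
    FiniteDimensional ℂ (ExtensionQuotient (ℂ × ℂ) m W regular) ∧
      Module.finrank ℂ (ExtensionQuotient (ℂ × ℂ) m W regular) =
        ∑ n ∈ weightBox m, extDim m n := by
  obtain ⟨ε, hε, hεW⟩ := exists_tube_le hW
  obtain ⟨δ, hδ, hδε⟩ := exists_param_mem_tube hε
  have hNW : tube ε ⊓ regular ≤ W ⊓ regular := inf_le_inf_right _ hεW
  have htor : ∀ z, param 1 (torusPt (δ, δ) z) ∈ tube ε ⊓ regular := fun z => by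
    have h1 : ‖(torusPt (δ, δ) z).1‖ = δ := norm_torusPt_fst (ρ := (δ, δ)) hδ.le z
    have h2 : ‖(torusPt (δ, δ) z).2‖ = δ := norm_torusPt_snd (ρ := (δ, δ)) hδ.le z
    refine ⟨hδε 1 _ h1.le h2.le, param_mem_regular.mpr (scale_ne_zero 1 ?_ ?_)⟩
    · exact norm_pos_iff.mp (by rw [h1]; exact hδ)
    · exact norm_pos_iff.mp (by rw [h2]; exact hδ)
  obtain ⟨L, hL⟩ := exists_laurent m (U := tube ε ⊓ regular)
    (isCompleteReinhardt_of_tube inf_le_left le_rfl) (ρ := (δ, δ)) hδ hδ htor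
  have hsmall : ∀ (j : Fin 3) (c : ℂ × ℂ), ‖c.1‖ ≤ δ → ‖c.2‖ ≤ δ → scale j c ≠ 0 →
      param j c ∈ tube ε ⊓ regular := fun j c h1 h2 h =>
    ⟨hδε j c h1 h2, param_mem_regular.mpr h⟩
  have hne : ∀ {z : ℂ}, ‖z‖ = δ → z ≠ 0 := fun h => norm_pos_iff.mp (by rw [h]; exact hδ)
  -- The non-compact divisors -1 and 2 are not removed with E: in charts 0 and 2 a disc across them
  -- stays off E while the other coordinate has modulus δ.
  have hout : ∀ {f : sections (ℂ × ℂ) m (tube ε ⊓ regular)} {p}, HasExpansion f p → ∀ n,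
      p n ∈ reg m n (-1) ∧ p n ∈ reg m n 2 := fun hf n => by
    have h1 := hf.mem_reg' 0 (ρ := (δ, δ)) hδ hδ
      (fun c h1 h2 => hsmall 0 c h1.le h2 (hne h1)) n
    have h2 := hf.mem_reg 2 (ρ := (δ, δ)) hδ hδ
      (fun c h1 h2 => hsmall 2 c h1 h2.le (hne h2)) n
    exact ⟨by simpa using h1, by simpa using h2⟩
  have hR : ∀ f : sections (ℂ × ℂ) m (W ⊓ regular),
      f ∈ LinearMap.range (restrict (ℂ × ℂ) m (inf_le_left : W ⊓ regular ≤ W)) ↔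
        ∀ n, L (restrict (ℂ × ℂ) m hNW f) n ∈ reg m n 0 ∧
          L (restrict (ℂ × ℂ) m hNW f) n ∈ reg m n 1 := by
    intro f
    constructor
    · rintro ⟨F, rfl⟩ n
      obtain ⟨p, hp⟩ := exists_hasExpansion (restrict (ℂ × ℂ) m hεW F)
        (isCompleteReinhardt_of_tube le_rfl inf_le_left)
      have hp' := hp.restrict (V := tube ε ⊓ regular) inf_le_left
      have : L (restrict (ℂ × ℂ) m hNW
          (restrict (ℂ × ℂ) m (inf_le_left : W ⊓ regular ≤ W) F)) = p :=
        (hL _).coeff_unique hp' (ρ := (δ, δ)) hδ hδ htor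
      rw [this]
      have h0 := hp.mem_reg 0 (ρ := (δ, δ)) hδ hδ (fun c h1 h2 => hδε 0 c h1 h2.le) n
      have h1 := hp.mem_reg 1 (ρ := (δ, δ)) hδ hδ (fun c h1 h2 => hδε 1 c h1 h2.le) n
      exact ⟨by simpa using h0, by simpa using h1⟩
    · intro h
      have hexp := hL (restrict (ℂ × ℂ) m hNW f)
      obtain ⟨g, hg⟩ := exists_hasExpansion_tube hexp fun n =>
        ⟨(hout hexp n).1, (h n).1, (h n).2, (hout hexp n).2⟩
      have hle : W ⊓ regular ⊓ tube ε ≤ tube ε ⊓ regular := fun q hq => ⟨hq.2, hq.1.2⟩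
      -- The extension is constructed only on the tube; together with `W ∖ E` the tube covers `W`,
      -- and equal expansions make the two sections agree on the overlap.
      obtain ⟨F, hF⟩ := exists_glue (A := W ⊓ regular) (B := tube ε) (W := W) (fun q hq => by
          by_cases hr : q ∈ regular
          · exact Or.inl ⟨hq, hr⟩
          · refine Or.inr fun k => ?_
            rw [mem_regular, not_not] at hr
            rw [hr, Pi.zero_apply, norm_zero]
            exact hε) inf_le_left f g
        ((hexp.restrict hle).eq (hg.restrict inf_le_right))
      exact ⟨F, hF⟩
  set A : ℤ × ℤ → Submodule ℂ ℂ[X] := fun n => reg m n (-1) ⊓ reg m n 2 with hAdef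
  set B : ℤ × ℤ → Submodule ℂ ℂ[X] := fun n => reg m n (-1) ⊓ reg m n 2 ⊓
    (reg m n 0 ⊓ reg m n 1) with hBdef
  have hAfin : ∀ n, FiniteDimensional ℂ (A n) := fun n =>
    Submodule.finiteDimensional_of_le (S₂ := vanishing m (-1) (ord m n (-1))) inf_le_left
  have hBA : ∀ n, B n ≤ A n := fun n => inf_le_left
  have dA : ∀ n, Module.finrank ℂ (A n) = m + 1 - (ord m n (-1) + ord m n 2) := fun n =>
    finrank_vanishing_inf m (by decide) _ _
  have dB : ∀ n, Module.finrank ℂ (B n) =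
      m + 1 - (ord m n (-1) + ord m n 2 + ord m n 0 + ord m n 1) := fun n =>
    finrank_vanishing_inf₄ m (by decide) (by decide) (by decide) (by decide) (by decide)
      (by decide) _ _ _ _
  have := finrank_quotient_eq_sum
    (LinearMap.range (restrict (ℂ × ℂ) m (inf_le_left : W ⊓ regular ≤ W))) A B hBA
    (L ∘ₗ restrict (ℂ × ℂ) m hNW) (weightBox m) (fun f n => hout (hL _) n) (fun f => ?_)
    (fun n hn => ?_) (fun a ha haS => ?_)
  · refine ⟨this.1, this.2.trans (Finset.sum_congr rfl fun n _ => ?_)⟩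
    rw [dA, dB, extDim]
  · rw [hR]
    exact forall_congr' fun n => ⟨fun h => ⟨hout (hL _) n, h⟩, fun h => h.2⟩
  -- Outside the box either the orders at -1 and 2 already add up to more than `m`, so `A n` is
  -- zero, or no vanishing is required at 0 and 1.
  · refine (Submodule.eq_of_le_of_finrank_eq (hBA n) ?_).ge
    have := not_mem_weightBox hn
    rw [dA, dB]
    simp only [ord]
    omega
  -- Surjectivity needs sections on all of `W ∖ E`, for arbitrary `W`. Finite Laurent polynomials
  -- provide them, as off E only divisors -1 and 2 can be met.
  · have h1 : ∀ (j : Fin 3) (c : ℂ × ℂ), param j c ∈ W ⊓ regular → c.1 = 0 →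
        ∀ n, a n ∈ reg m n (j : ℕ) := fun j c hc h0 n => by
      have hs := param_mem_regular.mp hc.2
      fin_cases j
      · exact absurd h0 hs
      · exact absurd (by simp [scale, h0]) hs
      · simpa using (ha n).2
    have h2 : ∀ (j : Fin 3) (c : ℂ × ℂ), param j c ∈ W ⊓ regular → c.2 = 0 →
        ∀ n, a n ∈ reg m n ((j : ℕ) - 1) := fun j c hc h0 n => by
      have hs := param_mem_regular.mp hc.2
      fin_cases j
      · simpa using (ha n).1
      · exact absurd (by simp [scale, h0]) hs
      · exact absurd h0 hs
    have hfin : {n | a n ≠ 0}.Finite := (weightBox m).finite_toSet.subset fun n hn => by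
      by_contra h
      exact hn (haS n h)
    obtain ⟨f, hf⟩ := exists_hasExpansion_of_finite (fun n => (ha n).1.1) hfin h1 h2
    exact ⟨f, (hL _).coeff_unique (hf.restrict hNW) (ρ := (δ, δ)) hδ hδ htor⟩

end A2Resolution

end

/-! ### The first Čech cohomology -/

noncomputable section

lemma Submodule.finrank_prod_eq {X Y : Type*} [AddCommGroup X] [Module ℂ X] [AddCommGroup Y]
    [Module ℂ Y] (A : Submodule ℂ X) (B : Submodule ℂ Y) [FiniteDimensional ℂ A]
    [FiniteDimensional ℂ B] :
    FiniteDimensional ℂ (A.prod B) ∧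
      Module.finrank ℂ (A.prod B) = Module.finrank ℂ A + Module.finrank ℂ B := by
  let e : (A.prod B) ≃ₗ[ℂ] A × B :=
    { toFun := fun x => (⟨x.1.1, x.2.1⟩, ⟨x.1.2, x.2.2⟩)
      invFun := fun x => ⟨(x.1.1, x.2.1), x.1.2, x.2.2⟩
      left_inv := fun _ => rfl
      right_inv := fun _ => rfl
      map_add' := fun _ _ => rfl
      map_smul' := fun _ _ => rfl }
  exact ⟨e.symm.finiteDimensional, by rw [e.finrank_eq, Module.finrank_prod]⟩

/-! ### The Čech complex in a single weight -/

namespace BinaryForm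

open Polynomial

/-- The Čech coboundary on the coefficients of a fixed weight. -/
def cobdry : ℂ[X] × ℂ[X] × ℂ[X] →ₗ[ℂ] ℂ[X] × ℂ[X] where
  toFun v := (v.2.1 - v.1, v.2.2 - v.2.1)
  map_add' v w := Prod.ext (by simp only [Prod.fst_add, Prod.snd_add]; ring)
    (by simp only [Prod.fst_add, Prod.snd_add]; ring)
  map_smul' c v := by simp [smul_sub]

lemma cobdry_apply (v : ℂ[X] × ℂ[X] × ℂ[X]) : cobdry v = (v.2.1 - v.1, v.2.2 - v.2.1) := rfl

/-- The forms in the three charts with given vanishing orders at `-1`, `0`, `1`, `2`. -/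
def chartVanishing (m : ℕ) (e : Fin 4 → ℕ) : Submodule ℂ (ℂ[X] × ℂ[X] × ℂ[X]) :=
  (vanishing m (-1) (e 0) ⊓ vanishing m 0 (e 1)).prod
    ((vanishing m 0 (e 1) ⊓ vanishing m 1 (e 2)).prod
      (vanishing m 1 (e 2) ⊓ vanishing m 2 (e 3)))

lemma chartVanishing_min (m : ℕ) (e : Fin 4 → ℕ) :
    chartVanishing m (fun i => min (e i) (m + 1)) = chartVanishing m e := by
  simp only [chartVanishing, vanishing_min]

instance (m : ℕ) (r s : ℤ) (e f : ℕ) :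
    FiniteDimensional ℂ ↥(vanishing m r e ⊓ vanishing m s f) :=
  Submodule.finiteDimensional_of_le (S₂ := vanishing m r e) inf_le_left

lemma finrank_chartVanishing (m : ℕ) (e : Fin 4 → ℕ) :
    FiniteDimensional ℂ (chartVanishing m e) ∧ Module.finrank ℂ (chartVanishing m e) =
      (m + 1 - (e 0 + e 1)) + ((m + 1 - (e 1 + e 2)) + (m + 1 - (e 2 + e 3))) := by
  have h1 := Submodule.finrank_prod_eq (vanishing m 0 (e 1) ⊓ vanishing m 1 (e 2))
    (vanishing m 1 (e 2) ⊓ vanishing m 2 (e 3))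
  have := h1.1
  have h2 := Submodule.finrank_prod_eq (vanishing m (-1) (e 0) ⊓ vanishing m 0 (e 1))
    ((vanishing m 0 (e 1) ⊓ vanishing m 1 (e 2)).prod
      (vanishing m 1 (e 2) ⊓ vanishing m 2 (e 3)))
  refine ⟨h2.1, h2.2.trans ?_⟩
  rw [h1.2, finrank_vanishing_inf m (by decide), finrank_vanishing_inf m (by decide),
    finrank_vanishing_inf m (by decide)]

/-- Rank-nullity: a triple in the kernel has three equal entries, hence is one polynomial vanishing
at all four points. The sum form avoids truncated subtraction between ranks. -/
lemma finrank_map_cobdry (m : ℕ) (e : Fin 4 → ℕ) :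
    Module.finrank ℂ ((chartVanishing m e).map cobdry) + (m + 1 - (e 0 + e 1 + e 2 + e 3)) =
      (m + 1 - (e 0 + e 1)) + ((m + 1 - (e 1 + e 2)) + (m + 1 - (e 2 + e 3))) := by
  obtain ⟨hfin, hrank⟩ := finrank_chartVanishing m e
  let D : ↥(vanishing m (-1) (e 0) ⊓ vanishing m 0 (e 1) ⊓
      (vanishing m 1 (e 2) ⊓ vanishing m 2 (e 3))) ≃ₗ[ℂ]
      LinearMap.ker (cobdry.domRestrict (chartVanishing m e)) :=
    { toFun := fun x => ⟨⟨(x.1, x.1, x.1), ⟨x.2.1, ⟨x.2.1.2, x.2.2.1⟩, x.2.2⟩⟩, by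
        rw [LinearMap.mem_ker, LinearMap.domRestrict_apply, cobdry_apply]
        simp⟩
      invFun := fun x => ⟨x.1.1.1, by
        have h := x.2
        rw [LinearMap.mem_ker, LinearMap.domRestrict_apply, cobdry_apply] at h
        have h1 : x.1.1.2.1 = x.1.1.1 := sub_eq_zero.mp (congrArg Prod.fst h)
        have h2 : x.1.1.2.2 = x.1.1.2.1 := sub_eq_zero.mp (congrArg Prod.snd h)
        refine ⟨x.1.2.1, ?_⟩
        rw [← h1, ← h2]
        exact x.1.2.2.2⟩
      left_inv := fun _ => rfl
      right_inv := fun x => by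
        have h := x.2
        rw [LinearMap.mem_ker, LinearMap.domRestrict_apply, cobdry_apply] at h
        have h1 : x.1.1.2.1 = x.1.1.1 := sub_eq_zero.mp (congrArg Prod.fst h)
        have h2 : x.1.1.2.2 = x.1.1.2.1 := sub_eq_zero.mp (congrArg Prod.snd h)
        exact Subtype.ext (Subtype.ext (Prod.ext rfl (Prod.ext h1.symm (h2.trans h1).symm)))
      map_add' := fun _ _ => rfl
      map_smul' := fun _ _ => rfl }
  rw [← hrank, ← LinearMap.finrank_range_add_finrank_ker
    (cobdry.domRestrict (chartVanishing m e)), LinearMap.range_domRestrict, ← D.finrank_eq,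
    finrank_vanishing_inf₄ m (by decide) (by decide) (by decide) (by decide) (by decide)
      (by decide)]

/-- The coboundaries in a fixed weight have primitives of comparable size. -/
lemma exists_primitive_bound (m : ℕ) : ∃ K : ℝ, ∀ (e : Fin 4 → ℕ) (b : ℂ[X] × ℂ[X]),
    b.1.natDegree ≤ m → b.2.natDegree ≤ m → b ∈ (chartVanishing m e).map cobdry →
    ∃ v ∈ chartVanishing m e, cobdry v = b ∧
      coeffNorm m v.1 ≤ K * (coeffNorm m b.1 + coeffNorm m b.2) ∧
      coeffNorm m v.2.1 ≤ K * (coeffNorm m b.1 + coeffNorm m b.2) ∧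
      coeffNorm m v.2.2 ≤ K * (coeffNorm m b.1 + coeffNorm m b.2) := by
  have bound : ∀ T : ℂ[X] × ℂ[X] →ₗ[ℂ] ℂ[X], ∃ K : ℝ, 0 ≤ K ∧ ∀ b : ℂ[X] × ℂ[X],
      b.1.natDegree ≤ m → b.2.natDegree ≤ m →
      coeffNorm m (T b) ≤ K * (coeffNorm m b.1 + coeffNorm m b.2) := by
    intro T
    obtain ⟨K₁, h₁, H₁⟩ := exists_bound_map m (T ∘ₗ LinearMap.inl ℂ _ _)
    obtain ⟨K₂, h₂, H₂⟩ := exists_bound_map m (T ∘ₗ LinearMap.inr ℂ _ _)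
    refine ⟨K₁ + K₂, add_nonneg h₁ h₂, fun b hb1 hb2 => ?_⟩
    have e : T b = (T ∘ₗ LinearMap.inl ℂ _ _) b.1 + (T ∘ₗ LinearMap.inr ℂ _ _) b.2 := by
      simp [← map_add]
    have ht : coeffNorm m (T b) ≤ coeffNorm m ((T ∘ₗ LinearMap.inl ℂ _ _) b.1) +
        coeffNorm m ((T ∘ₗ LinearMap.inr ℂ _ _) b.2) := by
      rw [e]
      simp only [coeffNorm, ← Finset.sum_add_distrib, coeff_add]
      exact Finset.sum_le_sum fun k _ => norm_add_le _ _
    have := H₁ b.1 hb1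
    have := H₂ b.2 hb2
    have n1 := coeffNorm_nonneg m b.1
    have n2 := coeffNorm_nonneg m b.2
    nlinarith [mul_nonneg h₁ n2, mul_nonneg h₂ n1]
  have key : ∀ e : Fin 4 → ℕ, ∃ K : ℝ, 0 ≤ K ∧ ∀ b : ℂ[X] × ℂ[X],
      b.1.natDegree ≤ m → b.2.natDegree ≤ m → b ∈ (chartVanishing m e).map cobdry →
      ∃ v ∈ chartVanishing m e, cobdry v = b ∧
        coeffNorm m v.1 ≤ K * (coeffNorm m b.1 + coeffNorm m b.2) ∧
        coeffNorm m v.2.1 ≤ K * (coeffNorm m b.1 + coeffNorm m b.2) ∧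
        coeffNorm m v.2.2 ≤ K * (coeffNorm m b.1 + coeffNorm m b.2) := by
    intro e
    -- A linear section of the coboundary, extended to all pairs, is bounded on polynomials of
    -- degree at most `m`, so for fixed orders a constant exists.
    obtain ⟨S, hS⟩ := (cobdry.submoduleMap (chartVanishing m e)).exists_rightInverse_of_surjective
      (LinearMap.range_eq_top.mpr (cobdry.submoduleMap_surjective _))
    obtain ⟨T, hT⟩ := LinearMap.exists_extend ((chartVanishing m e).subtype ∘ₗ S)
    obtain ⟨K₀, k₀, H₀⟩ := bound (LinearMap.fst ℂ _ _ ∘ₗ T)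
    obtain ⟨K₁, k₁, H₁⟩ := bound (LinearMap.fst ℂ _ _ ∘ₗ LinearMap.snd ℂ _ _ ∘ₗ T)
    obtain ⟨K₂, k₂, H₂⟩ := bound (LinearMap.snd ℂ _ _ ∘ₗ LinearMap.snd ℂ _ _ ∘ₗ T)
    refine ⟨K₀ + K₁ + K₂, by positivity, fun b hb1 hb2 hb => ?_⟩
    have hTb : T b = S ⟨b, hb⟩ := LinearMap.congr_fun hT ⟨b, hb⟩
    have hn : 0 ≤ coeffNorm m b.1 + coeffNorm m b.2 :=
      add_nonneg (coeffNorm_nonneg _ _) (coeffNorm_nonneg _ _)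
    refine ⟨T b, ?_, ?_, (H₀ b hb1 hb2).trans ?_, (H₁ b hb1 hb2).trans ?_,
      (H₂ b hb1 hb2).trans ?_⟩
    · rw [hTb]
      exact (S ⟨b, hb⟩).2
    · rw [hTb]
      exact congrArg Subtype.val (LinearMap.congr_fun hS ⟨b, hb⟩)
    all_goals exact mul_le_mul_of_nonneg_right (by linarith) hn
  choose K hK0 hK using key
  -- Orders may be cut off at `m + 1`, which leaves `(m + 2) ^ 4` cases; the sum of their constants
  -- serves all weights at once.
  refine ⟨∑ e : Fin 4 → Fin (m + 2), K fun i => e i, fun e b hb1 hb2 hb => ?_⟩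
  set e' : Fin 4 → Fin (m + 2) := fun i => ⟨min (e i) (m + 1), by omega⟩ with he'
  have heq : chartVanishing m (fun i => e' i) = chartVanishing m e := chartVanishing_min m e
  rw [← heq] at hb ⊢
  obtain ⟨v, hv, hvb, h0, h1, h2⟩ := hK _ b hb1 hb2 hb
  have hle : K (fun i => e' i) ≤ ∑ e : Fin 4 → Fin (m + 2), K fun i => e i :=
    Finset.single_le_sum (f := fun e : Fin 4 → Fin (m + 2) => K fun i => e i)
      (fun _ _ => hK0 _) (Finset.mem_univ e')
  have hn : 0 ≤ coeffNorm m b.1 + coeffNorm m b.2 :=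
    add_nonneg (coeffNorm_nonneg _ _) (coeffNorm_nonneg _ _)
  have hm := mul_le_mul_of_nonneg_right hle hn
  exact ⟨v, hv, hvb, h0.trans hm, h1.trans hm, h2.trans hm⟩

end BinaryForm

end

/-! ### The weight decomposition of the Čech cohomology -/

noncomputable section

namespace A2Resolution

open SymmetricDifferential Laurent BinaryForm Polynomial

variable {m : ℕ} {U V : Opens A2Resolution}

lemma param_mem_chartDomain_iff {i k : Fin 3} {c : ℂ × ℂ} :
    param k c ∈ chartDomain i ↔ vec k c i ≠ 0 := rep_param_ne_zero_iff k i c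

lemma param_mem_chartDomain_of_ne_zero (i k : Fin 3) {c : ℂ × ℂ} (h1 : c.1 ≠ 0) (h2 : c.2 ≠ 0) :
    param k c ∈ chartDomain i := by
  rw [param_mem_chartDomain_iff]
  fin_cases k <;> fin_cases i <;> simp [vec, h1, h2]

/-- The open sets that contain the torus. -/
def ContainsTorus (U : Opens A2Resolution) : Prop :=
  ∀ (k : Fin 3) (c : ℂ × ℂ), c.1 ≠ 0 → c.2 ≠ 0 → param k c ∈ U

lemma containsTorus_chartDomain (i : Fin 3) : ContainsTorus (chartDomain i) :=
  fun k _ h1 h2 => param_mem_chartDomain_of_ne_zero i k h1 h2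

lemma ContainsTorus.inf (hU : ContainsTorus U) (hV : ContainsTorus V) : ContainsTorus (U ⊓ V) :=
  fun k c h1 h2 => ⟨hU k c h1 h2, hV k c h1 h2⟩

lemma ContainsTorus.isCompleteReinhardt (hU : ContainsTorus U) :
    IsCompleteReinhardt {c : ℂ × ℂ | c.1 ≠ 0 ∧ c.2 ≠ 0 ∧ param 1 c ∈ U} where
  isOpen := (isOpen_ne_fun continuous_fst continuous_const).inter
    ((isOpen_ne_fun continuous_snd continuous_const).inter (isOpen_preimage_param 1 U))
  ne_zero _ hs := ⟨hs.1, hs.2.1⟩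
  mem _ _ t h1 h2 _ _ := ⟨h1, h2, hU 1 t h1 h2⟩

lemma ContainsTorus.torusPt_mem (hU : ContainsTorus U) (z : _) :
    param 1 (torusPt (1, 1) z) ∈ U :=
  hU 1 _ (norm_pos_iff.mp (by rw [norm_torusPt_fst (by simp)]; exact one_pos))
    (norm_pos_iff.mp (by rw [norm_torusPt_snd (by simp)]; exact one_pos))

lemma ContainsTorus.exists_laurent (hU : ContainsTorus U) (m : ℕ) :
    ∃ L : sections (ℂ × ℂ) m U →ₗ[ℂ] ℤ × ℤ → ℂ[X], ∀ f, HasExpansion f (L f) :=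
  A2Resolution.exists_laurent m hU.isCompleteReinhardt (ρ := (1, 1)) one_pos one_pos hU.torusPt_mem

lemma ContainsTorus.coeff_unique (hU : ContainsTorus U) {f : sections (ℂ × ℂ) m U}
    {p q : ℤ × ℤ → ℂ[X]} (hp : HasExpansion f p) (hq : HasExpansion f q) : p = q :=
  hp.coeff_unique hq (ρ := (1, 1)) one_pos one_pos hU.torusPt_mem

lemma mem_reg_of_chartDomain {j : Fin 3} {f : sections (ℂ × ℂ) m (chartDomain j)}
    {p : ℤ × ℤ → ℂ[X]} (hf : HasExpansion f p) (n : ℤ × ℤ) :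
    p n ∈ reg m n ((j : ℕ) - 1) ⊓ reg m n (j : ℕ) :=
  ⟨hf.mem_reg' j (ρ := (1, 1)) one_pos one_pos (fun c _ _ => param_mem_chartDomain j c) n,
    hf.mem_reg j (ρ := (1, 1)) one_pos one_pos (fun c _ _ => param_mem_chartDomain j c) n⟩

/-- Synthesis of a symmetric differential on the domain of a chart. -/
lemma exists_hasExpansion_chartDomain (j : Fin 3) {p : ℤ × ℤ → ℂ[X]}
    (hp : ∀ n, p n ∈ reg m n ((j : ℕ) - 1) ⊓ reg m n (j : ℕ))
    (hs : ∀ c : ℂ × ℂ, c.1 ≠ 0 → c.2 ≠ 0 →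
      Summable fun n => ‖mon (wt j n) c‖ * coeffNorm m (p n)) :
    ∃ f : sections (ℂ × ℂ) m (chartDomain j), HasExpansion f p := by
  refine exists_hasExpansion_of_local (fun n => (hp n).1.1) fun q hq => ?_
  set c := coord j q with hc
  have hcq : param j c = q := param_coord j q hq
  have p1 : 0 < ‖c.1‖ + 1 := by positivity
  have p2 : 0 < ‖c.2‖ + 1 := by positivity
  have n1 : ((‖c.1‖ + 1 : ℝ) : ℂ) ≠ 0 := by exact_mod_cast p1.ne'
  have n2 : ((‖c.2‖ + 1 : ℝ) : ℂ) ≠ 0 := by exact_mod_cast p2.ne'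
  obtain ⟨N, hN, g, hg⟩ := exists_hasExpansion_bidisc j (fun n => (hp n).2) (fun n => (hp n).1)
    (c₀ := (((‖c.1‖ + 1 : ℝ) : ℂ), ((‖c.2‖ + 1 : ℝ) : ℂ))) n1 n2 (hs _ n1 n2)
  refine ⟨chartOpen j N, ?_, g, hg⟩
  rw [← hcq, param_mem_chartOpen, hN]
  simp only [Complex.norm_real, Real.norm_eq_abs, abs_of_pos p1, abs_of_pos p2]
  constructor <;> linarith

/-- The vanishing orders along the four divisors. -/
def ords (m : ℕ) (n : ℤ × ℤ) : Fin 4 → ℕ := ![ord m n (-1), ord m n 0, ord m n 1, ord m n 2]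

lemma mem_chartVanishing_ords {n : ℤ × ℤ} {v : ℂ[X] × ℂ[X] × ℂ[X]} :
    v ∈ chartVanishing m (ords m n) ↔
      ∀ j : Fin 3, ![v.1, v.2.1, v.2.2] j ∈ reg m n ((j : ℕ) - 1) ⊓ reg m n (j : ℕ) := by
  rw [Fin.forall_fin_succ, Fin.forall_fin_succ, Fin.forall_fin_succ]
  norm_num
  rfl

/-- The dimension of the first cohomology in weight `n`. -/
def cechDim (m : ℕ) (n : ℤ × ℤ) : ℕ :=
  (m + 1 - ord m n 0) + (m + 1 - ord m n 1) -
    ((m + 1 - (ord m n (-1) + ord m n 0)) + ((m + 1 - (ord m n 0 + ord m n 1)) +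
      (m + 1 - (ord m n 1 + ord m n 2))) -
      (m + 1 - (ord m n (-1) + ord m n 0 + ord m n 1 + ord m n 2)))

/-- The value of a cocycle on a pair of charts. -/
def cocycleVal (m : ℕ) (i j : Fin 3) :
    LinearMap.ker (cechD1 (ℂ × ℂ) m chartDomain) →ₗ[ℂ]
      sections (ℂ × ℂ) m (chartDomain i ⊓ chartDomain j) where
  toFun z := z.1 i j
  map_add' _ _ := rfl
  map_smul' _ _ := rfl

/-- Every intersection of charts contains the torus, where expansions exist and are unique, so the
cocycle condition can be read off the coefficients. -/
lemma mem_ker_cechD1 {z : Cochain1 (ℂ × ℂ) m chartDomain}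
    {P : Fin 3 → Fin 3 → ℤ × ℤ → ℂ[X]} (hz : ∀ i j, HasExpansion (z i j) (P i j)) :
    z ∈ LinearMap.ker (cechD1 (ℂ × ℂ) m chartDomain) ↔
      ∀ i j k, P j k - P i k + P i j = 0 := by
  have hexp : ∀ i j k, HasExpansion (cechD1 (ℂ × ℂ) m chartDomain z i j k)
      (P j k - P i k + P i j) := fun i j k =>
    (((hz j k).restrict _).sub ((hz i k).restrict _)).add ((hz i j).restrict _)
  have hzero : ∀ U : Opens A2Resolution,
      HasExpansion (0 : sections (ℂ × ℂ) m U) (0 : ℤ × ℤ → ℂ[X]) := fun U => ⟨by simp, by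
    intro j c _ _ _ x y
    simp only [Pi.zero_apply, homEval_zero, mul_zero]
    have h0 := rep_smul j (0 : ℂ) (0 : sections (ℂ × ℂ) m U) c (c.1 * x, c.2 * y)
    rw [smul_zero, zero_mul] at h0
    rw [h0]
    exact hasSum_zero⟩
  rw [LinearMap.mem_ker]
  constructor
  · intro h i j k
    have h1 := hexp i j k
    have h2 : cechD1 (ℂ × ℂ) m chartDomain z i j k = 0 := by rw [h]; rfl
    rw [h2] at h1
    exact (((containsTorus_chartDomain i).inf (containsTorus_chartDomain j)).inf
      (containsTorus_chartDomain k)).coeff_unique h1 (hzero _)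
  · intro h
    funext i j k
    have h1 := hexp i j k
    rw [h i j k] at h1
    exact h1.eq (hzero _)

/-- The dimension of the first Čech cohomology. -/
theorem finrank_cechH1 (m : ℕ) :
    FiniteDimensional ℂ (CechH1 (ℂ × ℂ) m chartDomain) ∧
      Module.finrank ℂ (CechH1 (ℂ × ℂ) m chartDomain) = ∑ n ∈ weightBox m, cechDim m n := by
  have tor : ∀ i j : Fin 3, ContainsTorus (chartDomain i ⊓ chartDomain j) := fun i j =>
    (containsTorus_chartDomain i).inf (containsTorus_chartDomain j)
  choose Λ hΛ using fun i j : Fin 3 => (tor i j).exists_laurent m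
  have cocycle : ∀ z : LinearMap.ker (cechD1 (ℂ × ℂ) m chartDomain), ∀ i j k,
      Λ j k (z.1 j k) - Λ i k (z.1 i k) + Λ i j (z.1 i j) = 0 := fun z =>
    (mem_ker_cechD1 fun i j => hΛ i j (z.1 i j)).mp z.2
  -- The values on the pairs (0, 1) and (1, 2) determine a cocycle: it is alternating, and its value
  -- on (0, 2) is their sum.
  let L : LinearMap.ker (cechD1 (ℂ × ℂ) m chartDomain) →ₗ[ℂ] ℤ × ℤ → ℂ[X] × ℂ[X] :=
    LinearMap.pi fun n => (LinearMap.proj n ∘ₗ Λ 0 1 ∘ₗ cocycleVal m 0 1).prod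
      (LinearMap.proj n ∘ₗ Λ 1 2 ∘ₗ cocycleVal m 1 2)
  have L_apply : ∀ z n, L z n = (Λ 0 1 (z.1 0 1) n, Λ 1 2 (z.1 1 2) n) := fun _ _ => rfl
  have eq_sub : ∀ (z : LinearMap.ker (cechD1 (ℂ × ℂ) m chartDomain))
      (v : ℤ × ℤ → ℂ[X] × ℂ[X] × ℂ[X]), (∀ n, cobdry (v n) = L z n) → ∀ i j,
      Λ i j (z.1 i j) = (fun n => ![(v n).1, (v n).2.1, (v n).2.2] j) -
        (fun n => ![(v n).1, (v n).2.1, (v n).2.2] i) := by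
    intro z v hv i j
    have h := cocycle z
    have h01 : Λ 0 1 (z.1 0 1) = (fun n => (v n).2.1) - fun n => (v n).1 := funext fun n =>
      (congrArg Prod.fst (hv n)).symm
    have h12 : Λ 1 2 (z.1 1 2) = (fun n => (v n).2.2) - fun n => (v n).2.1 := funext fun n =>
      (congrArg Prod.snd (hv n)).symm
    have hd : ∀ i, Λ i i (z.1 i i) = 0 := fun i => by simpa using h i i i
    have hs : ∀ i j, Λ j i (z.1 j i) = -Λ i j (z.1 i j) := fun i j => by
      have := h i j i
      rw [hd, sub_zero] at this
      exact eq_neg_of_add_eq_zero_left this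
    have h02 : Λ 0 2 (z.1 0 2) = (fun n => (v n).2.2) - fun n => (v n).1 := by
      have := h 0 1 2
      rw [h01, h12] at this
      linear_combination (exp := 1) -this
    fin_cases i <;> fin_cases j
    · exact (hd 0).trans (sub_self _).symm
    · exact h01
    · exact h02
    · exact (hs 0 1).trans (by rw [h01, neg_sub]; rfl)
    · exact (hd 1).trans (sub_self _).symm
    · exact h12
    · exact (hs 0 2).trans (by rw [h02, neg_sub]; rfl)
    · exact (hs 1 2).trans (by rw [h12, neg_sub]; rfl)
    · exact (hd 2).trans (sub_self _).symm
  -- Outside the torus, charts 0 and 1 share only divisor 0 and charts 1 and 2 only divisor 1.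
  -- Charts 0 and 2 meet exactly in the torus, so the third component is unconstrained.
  set A : ℤ × ℤ → Submodule ℂ (ℂ[X] × ℂ[X]) := fun n => (reg m n 0).prod (reg m n 1) with hA
  set B : ℤ × ℤ → Submodule ℂ (ℂ[X] × ℂ[X]) := fun n =>
    (chartVanishing m (ords m n)).map cobdry with hB
  have dA : ∀ n, FiniteDimensional ℂ (A n) ∧
      Module.finrank ℂ (A n) = (m + 1 - ord m n 0) + (m + 1 - ord m n 1) := fun n => by
    have := Submodule.finrank_prod_eq (vanishing m 0 (ord m n 0)) (vanishing m 1 (ord m n 1))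
    rw [finrank_vanishing, finrank_vanishing] at this
    exact this
  have hAfin : ∀ n, FiniteDimensional ℂ (A n) := fun n => (dA n).1
  have hBA : ∀ n, B n ≤ A n := by
    rintro n _ ⟨v, hv, rfl⟩
    exact ⟨sub_mem hv.2.1.1 hv.1.2, sub_mem hv.2.2.1 hv.2.1.2⟩
  have dB : ∀ n, Module.finrank ℂ (B n) + (m + 1 - (ord m n (-1) + ord m n 0 + ord m n 1 +
      ord m n 2)) = (m + 1 - (ord m n (-1) + ord m n 0)) + ((m + 1 - (ord m n 0 + ord m n 1)) +
      (m + 1 - (ord m n 1 + ord m n 2))) := fun n => finrank_map_cobdry m (ords m n)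
  have := finrank_quotient_eq_sum ((LinearMap.range (cechD0 (ℂ × ℂ) m chartDomain)).submoduleOf
    (LinearMap.ker (cechD1 (ℂ × ℂ) m chartDomain))) A B hBA L (weightBox m) (fun z n => ?_)
    (fun z => ?_) (fun n hn => ?_) (fun a ha haS => ?_)
  · refine ⟨this.1, this.2.trans (Finset.sum_congr rfl fun n _ => ?_)⟩
    rw [(dA n).2, cechDim]
    have := dB n
    omega
  · have h0 := (hΛ 0 1 (z.1 0 1)).mem_reg 0 (ρ := (1, 1)) one_pos one_pos (fun c _ h2 =>
      ⟨param_mem_chartDomain 0 c, param_mem_chartDomain_iff.mpr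
        (norm_pos_iff.mp (by simp [vec, h2]))⟩) n
    have h1 := (hΛ 1 2 (z.1 1 2)).mem_reg 1 (ρ := (1, 1)) one_pos one_pos (fun c _ h2 =>
      ⟨param_mem_chartDomain 1 c, param_mem_chartDomain_iff.mpr
        (norm_pos_iff.mp (by simp [vec, h2]))⟩) n
    rw [L_apply]
    exact ⟨by simpa using h0, by simpa using h1⟩
  · constructor
    · rintro ⟨s, hs⟩ n
      choose Q hQ using fun j => (containsTorus_chartDomain j).exists_laurent m
      refine ⟨(Q 0 (s 0) n, Q 1 (s 1) n, Q 2 (s 2) n), mem_chartVanishing_ords.mpr fun j => ?_, ?_⟩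
      · have := mem_reg_of_chartDomain (hQ j (s j)) n
        fin_cases j <;> exact this
      · have key : ∀ i j, Λ i j (z.1 i j) = Q j (s j) - Q i (s i) := fun i j => by
          have h1 : HasExpansion (z.1 i j) (Q j (s j) - Q i (s i)) := by
            have : z.1 i j = cechD0 (ℂ × ℂ) m chartDomain s i j := by rw [hs]; rfl
            rw [this]
            exact ((hQ j (s j)).restrict _).sub ((hQ i (s i)).restrict _)
          exact (tor i j).coeff_unique (hΛ i j _) h1
        rw [L_apply, key, key]
        rfl
    · intro h
      -- Primitives chosen weight by weight sum to holomorphic sections only because one constant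
      -- `K` bounds them all by the convergent series of the cocycle.
      obtain ⟨K, hK⟩ := exists_primitive_bound m
      choose v hv hvb h0 h1 h2 using fun n => hK (ords m n) (L z n)
        ((hΛ 0 1 (z.1 0 1)).natDegree_le n) ((hΛ 1 2 (z.1 1 2)).natDegree_le n) (h n)
      have hle : ∀ j : Fin 3, ∀ n, coeffNorm m (![(v n).1, (v n).2.1, (v n).2.2] j) ≤
          K * (coeffNorm m (Λ 0 1 (z.1 0 1) n) + coeffNorm m (Λ 1 2 (z.1 1 2) n)) := fun j n => by
        fin_cases j
        · exact h0 n
        · exact h1 n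
        · exact h2 n
      have hsum : ∀ (j : Fin 3) (c : ℂ × ℂ), c.1 ≠ 0 → c.2 ≠ 0 → Summable fun n =>
          ‖mon (wt j n) c‖ * coeffNorm m (![(v n).1, (v n).2.1, (v n).2.2] j) := by
        intro j c hc1 hc2
        have s1 := (hΛ 0 1 (z.1 0 1)).summable j hc1 hc2 (tor 0 1 j c hc1 hc2)
        have s2 := (hΛ 1 2 (z.1 1 2)).summable j hc1 hc2 (tor 1 2 j c hc1 hc2)
        refine Summable.of_nonneg_of_le
          (fun n => mul_nonneg (norm_nonneg _) (coeffNorm_nonneg _ _)) (fun n => ?_)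
          ((s1.add s2).mul_left K)
        refine (mul_le_mul_of_nonneg_left (hle j n) (norm_nonneg _)).trans (le_of_eq ?_)
        ring
      choose s hs using fun j => exists_hasExpansion_chartDomain j
        (p := fun n => ![(v n).1, (v n).2.1, (v n).2.2] j)
        (fun n => mem_chartVanishing_ords.mp (hv n) j) (hsum j)
      refine ⟨s, ?_⟩
      funext i j
      have e1 : HasExpansion (cechD0 (ℂ × ℂ) m chartDomain s i j) (_ - _) :=
        ((hs j).restrict inf_le_right).sub ((hs i).restrict inf_le_left)
      have e2 := hΛ i j (z.1 i j)
      rw [eq_sub z v hvb] at e2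
      exact e1.eq e2
  · refine (Submodule.eq_of_le_of_finrank_eq (hBA n) ?_).ge
    have := not_mem_weightBox hn
    have := dB n
    rw [(dA n).2]
    simp only [ord] at *
    omega
  · have hfin : {n | a n ≠ 0}.Finite := (weightBox m).finite_toSet.subset fun n hn => by
      by_contra h
      exact hn (haS n h)
    -- A 0-cochain of Laurent polynomials on the torus with the prescribed differences. Its
    -- coboundary is automatically a cocycle; only regularity of the differences on the chart
    -- intersections remains.
    let h : Fin 3 → ℤ × ℤ → ℂ[X] := fun i n => ![0, (a n).1, (a n).1 + (a n).2] i
    have hdeg : ∀ i n, (h i n).natDegree ≤ m := fun i n => by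
      fin_cases i
      · simp [h]
      · exact (ha n).1.1
      · exact (natDegree_add_le _ _).trans (max_le (ha n).1.1 (ha n).2.1)
    have r1 : ∀ (i j k : Fin 3) (c : ℂ × ℂ), param k c ∈ chartDomain i ⊓ chartDomain j →
        c.1 = 0 → ∀ n, h j n - h i n ∈ reg m n (k : ℕ) := by
      intro i j k c hc h0 n
      have hi := param_mem_chartDomain_iff.mp hc.1
      have hj := param_mem_chartDomain_iff.mp hc.2
      have a0 := (ha n).1
      have a1 := (ha n).2
      fin_cases k <;> fin_cases i <;> fin_cases j <;> simp [vec, h0] at hi hj <;>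
        simp [h] <;> first | exact a0 | exact a1
    have r2 : ∀ (i j k : Fin 3) (c : ℂ × ℂ), param k c ∈ chartDomain i ⊓ chartDomain j →
        c.2 = 0 → ∀ n, h j n - h i n ∈ reg m n ((k : ℕ) - 1) := by
      intro i j k c hc h0 n
      have hi := param_mem_chartDomain_iff.mp hc.1
      have hj := param_mem_chartDomain_iff.mp hc.2
      have a0 := (ha n).1
      have a1 := (ha n).2
      fin_cases k <;> fin_cases i <;> fin_cases j <;> simp [vec, h0] at hi hj <;>
        simp [h] <;> first | exact a0 | exact a1
    choose z hz using fun i j : Fin 3 => exists_hasExpansion_of_finite (m := m)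
      (U := chartDomain i ⊓ chartDomain j) (p := fun n => h j n - h i n)
      (fun n => (natDegree_sub_le _ _).trans (max_le (hdeg j n) (hdeg i n)))
      (hfin.subset fun n hn => by
        contrapose! hn
        have hn : a n = 0 := by simpa using hn
        fin_cases i <;> fin_cases j <;> simp [h, hn])
      (r1 i j) (r2 i j)
    have hker : (z : Cochain1 (ℂ × ℂ) m chartDomain) ∈
        LinearMap.ker (cechD1 (ℂ × ℂ) m chartDomain) := by
      refine (mem_ker_cechD1 hz).mpr fun i j k => ?_
      funext n
      simp only [Pi.add_apply, Pi.sub_apply, Pi.zero_apply]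
      ring
    refine ⟨⟨z, hker⟩, funext fun n => ?_⟩
    rw [L_apply]
    have e01 := (tor 0 1).coeff_unique (hΛ 0 1 (z 0 1)) (hz 0 1)
    have e12 := (tor 1 2).coeff_unique (hΛ 1 2 (z 1 2)) (hz 1 2)
    refine Prod.ext ?_ ?_
    · refine (congrFun e01 n).trans ?_
      simp [h]
    · refine (congrFun e12 n).trans ?_
      simp [h]

end A2Resolution

end

noncomputable section

/-! ### Riemann sums of Lipschitz functions -/

namespace RiemannSum

lemma continuous_of_abs_sub_le {f : ℝ → ℝ} {L : ℝ} (hL : 0 ≤ L)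
    (hf : ∀ x y, |f x - f y| ≤ L * |x - y|) : Continuous f :=
  (LipschitzWith.of_dist_le_mul (K := ⟨L, hL⟩) fun x y => by
    simp only [Real.dist_eq]
    exact hf x y).continuous

lemma sum_Icc_eq_sum_range (a : ℤ) (N : ℕ) (g : ℤ → ℝ) :
    ∑ k ∈ Finset.Icc a (a + N), g k = ∑ i ∈ Finset.range (N + 1), g (a + i) := by
  refine Finset.sum_nbij' (fun k => (k - a).toNat) (fun i => a + i) ?_ ?_ ?_ ?_ ?_
  · intro k hk
    simp only [Finset.mem_Icc, Finset.mem_range] at *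
    omega
  · intro i hi
    simp only [Finset.mem_Icc, Finset.mem_range] at *
    omega
  · intro k hk
    simp only [Finset.mem_Icc] at *
    omega
  · intro i hi
    simp
  · intro k hk
    simp only [Finset.mem_Icc] at hk
    congr 1
    omega

lemma abs_integral_sub_le {f : ℝ → ℝ} {L : ℝ} (hL : 0 ≤ L)
    (hf : ∀ x y, |f x - f y| ≤ L * |x - y|) {h : ℝ} (hh : 0 ≤ h) (x : ℝ) :
    |h * f x - ∫ t in x..x + h, f t| ≤ L * h ^ 2 := by
  have hc := continuous_of_abs_sub_le hL hf
  have e : h * f x - ∫ t in x..x + h, f t = ∫ t in x..x + h, (f x - f t) := by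
    rw [intervalIntegral.integral_sub (by simp) (hc.intervalIntegrable _ _)]
    simp
  rw [e, ← Real.norm_eq_abs]
  refine (intervalIntegral.norm_integral_le_of_norm_le_const (C := L * h) fun t ht => ?_).trans ?_
  · rw [uIoc_of_le (by linarith)] at ht
    refine (hf x t).trans (mul_le_mul_of_nonneg_left ?_ hL)
    rw [abs_sub_comm, abs_of_nonneg (by linarith [ht.1])]
    linarith [ht.2]
  · rw [add_sub_cancel_left, abs_of_nonneg hh]
    exact le_of_eq (by ring)

/-- There are `(b - a) * m` cells of width `1 / m`, each with error at most `L / m ^ 2`. The closed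
range has one more sample point than there are cells, which costs the extra `M / m`. -/
lemma abs_sum_sub_integral_le {f : ℝ → ℝ} {L M : ℝ} (hL : 0 ≤ L)
    (hf : ∀ x y, |f x - f y| ≤ L * |x - y|) (hM : ∀ x, |f x| ≤ M) {a b : ℤ} (hab : a ≤ b)
    {m : ℕ} (hm : 0 < m) :
    |(∑ k ∈ Finset.Icc (a * m) (b * m), f (k / m)) / m - ∫ t in (a : ℝ)..b, f t| ≤
      ((b - a) * L + M) / m := by
  have hm' : (0 : ℝ) < m := by exact_mod_cast hm
  obtain ⟨c, hc⟩ := Int.eq_ofNat_of_zero_le (sub_nonneg.mpr hab)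
  have hb : b = a + c := by omega
  subst hb
  have hcont := continuous_of_abs_sub_le hL hf
  have e1 : (a + c : ℤ) * m = a * m + ((c * m : ℕ) : ℤ) := by push_cast; ring
  rw [e1, sum_Icc_eq_sum_range]
  set x : ℕ → ℝ := fun i => a + i * (1 / m : ℝ) with hx
  have e2 : ∀ i : ℕ, (((a * m + i : ℤ) : ℝ) / m) = x i := fun i => by
    simp only [hx]
    push_cast
    field_simp
  have e3 : ∫ t in (a : ℝ)..((a + c : ℤ) : ℝ), f t =
      ∑ i ∈ Finset.range (c * m), ∫ t in x i..x (i + 1), f t := by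
    rw [intervalIntegral.sum_integral_adjacent_intervals fun i _ => hcont.intervalIntegrable _ _]
    congr 1
    · simp [hx]
    · simp only [hx]
      push_cast
      field_simp
  have e4 : ∀ i : ℕ, x (i + 1) = x i + 1 / m := fun i => by
    simp only [hx]
    push_cast
    ring
  rw [e3, Finset.sum_range_succ, add_div, Finset.sum_div, add_sub_right_comm,
    ← Finset.sum_sub_distrib]
  refine (abs_add_le _ _).trans ?_
  rw [add_div]
  refine add_le_add ((Finset.abs_sum_le_sum_abs _ _).trans ?_) ?_
  · have : ∀ i ∈ Finset.range (c * m), |f (((a * m + i : ℤ) : ℝ) / m) / m -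
        ∫ t in x i..x (i + 1), f t| ≤ L * (1 / m : ℝ) ^ 2 := fun i _ => by
      rw [e2, e4]
      have := abs_integral_sub_le hL hf (h := 1 / m) (by positivity) (x i)
      rwa [one_div_mul_eq_div] at this
    refine (Finset.sum_le_card_nsmul _ _ _ this).trans (le_of_eq ?_)
    simp only [Finset.card_range, nsmul_eq_mul]
    push_cast
    field_simp
    ring
  · rw [abs_div, abs_of_pos hm']
    exact div_le_div_of_nonneg_right (hM _) hm'.le

/-- The Riemann sums of a bounded Lipschitz function of two variables over a rectangle. -/
lemma tendsto_sum_sum {F : ℝ → ℝ → ℝ} {L M : ℝ} (hL : 0 ≤ L)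
    (h1 : ∀ x x' y, |F x y - F x' y| ≤ L * |x - x'|)
    (h2 : ∀ x y y', |F x y - F x y'| ≤ L * |y - y'|) (hM : ∀ x y, |F x y| ≤ M)
    {a b a' b' : ℤ} (hab : a ≤ b) (hab' : a' ≤ b') :
    Tendsto (fun m : ℕ => (∑ l ∈ Finset.Icc (a' * m) (b' * m), ∑ k ∈ Finset.Icc (a * m) (b * m),
      F (k / m) (l / m)) / (m : ℝ) ^ 2) atTop
      (𝓝 (∫ y in (a' : ℝ)..b', ∫ x in (a : ℝ)..b, F x y)) := by
  set G : ℝ → ℝ := fun y => ∫ x in (a : ℝ)..b, F x y with hG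
  have hab0 : (0 : ℝ) ≤ b - a := sub_nonneg.mpr (by exact_mod_cast hab)
  have hM0 : 0 ≤ M := (abs_nonneg _).trans (hM 0 0)
  have cont : ∀ y, Continuous fun x => F x y := fun y =>
    continuous_of_abs_sub_le hL fun x x' => h1 x x' y
  have g1 : ∀ y y', |G y - G y'| ≤ (b - a) * L * |y - y'| := fun y y' => by
    simp only [hG]
    rw [← intervalIntegral.integral_sub ((cont y).intervalIntegrable _ _)
      ((cont y').intervalIntegrable _ _), ← Real.norm_eq_abs]
    refine (intervalIntegral.norm_integral_le_of_norm_le_const fun t _ => h2 t y y').trans ?_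
    rw [abs_of_nonneg hab0]
    exact le_of_eq (by ring)
  have g2 : ∀ y, |G y| ≤ (b - a) * M := fun y => by
    rw [← Real.norm_eq_abs]
    refine (intervalIntegral.norm_integral_le_of_norm_le_const fun t _ => hM t y).trans ?_
    rw [abs_of_nonneg hab0]
    exact le_of_eq (by ring)
  set C : ℝ := (b - a) * L + M with hC
  set C' : ℝ := (b' - a') * ((b - a) * L) + (b - a) * M with hC'
  rw [tendsto_iff_norm_sub_tendsto_zero]
  have hC0 : 0 ≤ C := by positivity
  -- Each of the `(b' - a') * m + 1` rows has inner error at most `C / m`, which gives the first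
  -- summand after division by `m`; `C' / m` is the error of the outer sum of `G`.
  refine squeeze_zero' (.of_forall fun _ => norm_nonneg _) (g := fun m : ℕ =>
    ((b' - a' + 1) * C + C') / (m : ℝ)) ?_ (tendsto_const_div_atTop_nhds_zero_nat _)
  filter_upwards [eventually_ge_atTop 1] with m hm
  have hm' : (1 : ℝ) ≤ m := by exact_mod_cast hm
  have hm0 : (0 : ℝ) < m := by linarith
  have b2 := abs_sum_sub_integral_le (mul_nonneg hab0 hL) g1 g2 hab' hm
  have b1 : |(∑ l ∈ Finset.Icc (a' * m) (b' * m), ∑ k ∈ Finset.Icc (a * m) (b * m),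
      F (k / m) (l / m)) / (m : ℝ) ^ 2 - (∑ l ∈ Finset.Icc (a' * m) (b' * m), G (l / m)) / m| ≤
      (b' - a' + 1) * C / m := by
    have e : (∑ l ∈ Finset.Icc (a' * m) (b' * m), ∑ k ∈ Finset.Icc (a * m) (b * m),
        F (k / m) (l / m)) / (m : ℝ) ^ 2 - (∑ l ∈ Finset.Icc (a' * m) (b' * m), G (l / m)) / m =
        (∑ l ∈ Finset.Icc (a' * m) (b' * m), ((∑ k ∈ Finset.Icc (a * m) (b * m),
          F (k / m) (l / m)) / m - G (l / m))) / m := by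
      rw [Finset.sum_sub_distrib, ← Finset.sum_div]
      field_simp
    rw [e, abs_div, abs_of_pos hm0]
    refine div_le_div_of_nonneg_right ((Finset.abs_sum_le_sum_abs _ _).trans
      ((Finset.sum_le_card_nsmul _ _ (C / m) fun l _ =>
        abs_sum_sub_integral_le hL (fun x y => h1 x y _) (fun x => hM x _) hab hm).trans ?_)) hm0.le
    have hcard : (((Finset.Icc (a' * m) (b' * m)).card : ℕ) : ℝ) = (b' - a') * m + 1 := by
      have hle : a' * m ≤ b' * m + 1 := by nlinarith
      have : (((Finset.Icc (a' * m) (b' * m)).card : ℕ) : ℤ) = (b' - a') * m + 1 := by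
        rw [Int.card_Icc_of_le _ _ hle]
        ring
      exact_mod_cast this
    rw [nsmul_eq_mul, hcard, mul_div_assoc', div_le_iff₀ hm0]
    nlinarith [mul_nonneg hC0 (sub_nonneg.mpr hm')]
  rw [Real.norm_eq_abs]
  refine (abs_sub_le _ ((∑ l ∈ Finset.Icc (a' * m) (b' * m), G (l / m)) / m) _).trans ?_
  rw [add_div]
  exact add_le_add b1 b2

end RiemannSum

end

noncomputable section

/-! ### The volumes -/

namespace A2Resolution

open SymmetricDifferential

lemma abs_max_zero_sub_le (a b : ℝ) : |max 0 a - max 0 b| ≤ |a - b| := by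
  rw [max_comm 0 a, max_comm 0 b]
  exact abs_max_sub_max_le_abs a b 0

/-- The limit of the dimension of the space of forms with prescribed vanishing along the divisors
in `S`, in scaled coordinates. -/
def wedge (S : Finset ℤ) (u d : ℝ) : ℝ := max 0 (1 - ∑ r ∈ S, max 0 (u - r * d))

/-- The dimension of the space of forms with prescribed vanishing along the divisors in `S`. -/
def count (S : Finset ℤ) (m : ℕ) (n : ℤ × ℤ) : ℕ := m + 1 - ∑ r ∈ S, ord m n r

lemma wedge_nonneg (S : Finset ℤ) (u d : ℝ) : 0 ≤ wedge S u d := le_max_left _ _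

lemma wedge_le_one (S : Finset ℤ) (u d : ℝ) : wedge S u d ≤ 1 :=
  max_le zero_le_one (by
    have : 0 ≤ ∑ r ∈ S, max 0 (u - r * d) := Finset.sum_nonneg fun _ _ => le_max_left _ _
    linarith)

lemma abs_wedge_sub_le (S : Finset ℤ) (u u' d d' : ℝ) :
    |wedge S u d - wedge S u' d'| ≤ ∑ r ∈ S, |(u - r * d) - (u' - r * d')| := by
  refine (abs_max_zero_sub_le _ _).trans ?_
  rw [sub_sub_sub_cancel_left, ← Finset.sum_sub_distrib]
  refine (Finset.abs_sum_le_sum_abs _ _).trans (Finset.sum_le_sum fun r _ => ?_)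
  rw [abs_sub_comm (u - r * d)]
  exact abs_max_zero_sub_le _ _

lemma continuous_wedge (S : Finset ℤ) (d : ℝ) : Continuous fun u => wedge S u d := by
  unfold wedge
  fun_prop

lemma cast_tsub_eq_max (a b : ℕ) : ((a - b : ℕ) : ℝ) = max 0 ((a : ℝ) - b) := by
  rcases le_total b a with h | h
  · rw [Nat.cast_sub h, max_eq_right (sub_nonneg.mpr (by exact_mod_cast h))]
  · rw [Nat.sub_eq_zero_of_le h, max_eq_left (sub_nonpos.mpr (by exact_mod_cast h)), Nat.cast_zero]

lemma cast_ord (m : ℕ) (n : ℤ × ℤ) (r : ℤ) :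
    (ord m n r : ℝ) = max 0 ((m : ℝ) - (n.1 + r * n.2)) := by
  have : ((ord m n r : ℕ) : ℤ) = max 0 ((m : ℤ) - (n.1 + r * n.2)) := by
    rw [ord, Int.toNat_eq_max, max_comm]
  exact_mod_cast congrArg (Int.cast : ℤ → ℝ) this

/-- The orders scale exactly; the only discrepancy is the 1 in m + 1, and truncation at 0 is
1-Lipschitz. -/
lemma abs_count_sub_le (S : Finset ℤ) {m : ℕ} (hm : 0 < m) (n : ℤ × ℤ) :
    |(count S m n : ℝ) - m * wedge S (1 - n.1 / m) (n.2 / m)| ≤ 1 := by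
  have hm' : (0 : ℝ) < m := by exact_mod_cast hm
  have e1 : (m : ℝ) * wedge S (1 - n.1 / m) (n.2 / m) =
      max 0 ((m : ℝ) - ∑ r ∈ S, (ord m n r : ℝ)) := by
    rw [wedge, mul_max_of_nonneg _ _ hm'.le, mul_zero, mul_sub, mul_one, Finset.mul_sum]
    congr 2
    refine Finset.sum_congr rfl fun r _ => ?_
    rw [cast_ord, mul_max_of_nonneg _ _ hm'.le, mul_zero]
    congr 1
    field_simp
    ring
  rw [e1, count, cast_tsub_eq_max]
  refine (abs_max_zero_sub_le _ _).trans (le_of_eq ?_)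
  push_cast
  rw [sub_sub_sub_cancel_right, add_sub_cancel_left, abs_one]

/-- The limit of the total dimension in a fixed direction. -/
def area (S : Finset ℤ) (d : ℝ) : ℝ := ∫ u in (-2 : ℝ)..3, wedge S u d

/-- Replacing counts by scaled `wedge` values costs O(1) per weight over O(m²) weights; the rest is
a Riemann sum in x = n.1/m and d = n.2/m. The substitution u = 1 - x maps [-2, 3] to itself. The box
matters: a single count does not vanish outside it, only the combinations used later do. -/
lemma tendsto_sum_count (S : Finset ℤ) :
    Tendsto (fun m : ℕ => (∑ n ∈ weightBox m, (count S m n : ℝ)) / (m : ℝ) ^ 3) atTop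
      (𝓝 (∫ d in (-1 : ℝ)..1, area S d)) := by
  set L : ℝ := ∑ r ∈ S, (1 + |(r : ℝ)|) with hL
  have hL0 : 0 ≤ L := Finset.sum_nonneg fun _ _ => by positivity
  have h1 : ∀ x x' y : ℝ, |wedge S (1 - x) y - wedge S (1 - x') y| ≤ L * |x - x'| := by
    intro x x' y
    refine (abs_wedge_sub_le S _ _ _ _).trans ?_
    rw [hL, Finset.sum_mul]
    refine Finset.sum_le_sum fun r _ => ?_
    rw [show 1 - x - r * y - (1 - x' - r * y) = -(x - x') by ring, abs_neg]
    nlinarith [abs_nonneg (x - x'), mul_nonneg (abs_nonneg (r : ℝ)) (abs_nonneg (x - x'))]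
  have h2 : ∀ x y y' : ℝ, |wedge S (1 - x) y - wedge S (1 - x) y'| ≤ L * |y - y'| := by
    intro x y y'
    refine (abs_wedge_sub_le S _ _ _ _).trans ?_
    rw [hL, Finset.sum_mul]
    refine Finset.sum_le_sum fun r _ => ?_
    rw [show 1 - x - r * y - (1 - x - r * y') = -(r * (y - y')) by ring, abs_neg, abs_mul]
    nlinarith [abs_nonneg (y - y')]
  have h3 : ∀ x y : ℝ, |wedge S (1 - x) y| ≤ 1 := fun x y => by
    rw [abs_of_nonneg (wedge_nonneg _ _ _)]
    exact wedge_le_one _ _ _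
  have key := RiemannSum.tendsto_sum_sum (F := fun x y => wedge S (1 - x) y) hL0 h1 h2 h3
    (a := -2) (b := 3) (a' := -1) (b' := 1) (by norm_num) (by norm_num)
  have e : ∫ y in ((-1 : ℤ) : ℝ)..((1 : ℤ) : ℝ), ∫ x in ((-2 : ℤ) : ℝ)..((3 : ℤ) : ℝ),
      wedge S (1 - x) y = ∫ d in (-1 : ℝ)..1, area S d := by
    have h : ∀ y : ℝ, ∫ x in (-2 : ℝ)..3, wedge S (1 - x) y = area S y := fun y => by
      rw [intervalIntegral.integral_comp_sub_left (fun u => wedge S u y), area]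
      norm_num
    push_cast
    simp only [h]
  rw [e] at key
  have hdiff : Tendsto (fun m : ℕ => (∑ n ∈ weightBox m, (count S m n : ℝ)) / (m : ℝ) ^ 3 -
      (∑ l ∈ Finset.Icc (-1 * m : ℤ) (1 * m), ∑ k ∈ Finset.Icc (-2 * m : ℤ) (3 * m),
        wedge S (1 - k / m) (l / m)) / (m : ℝ) ^ 2) atTop (𝓝 0) := by
    -- The box has (5m + 1)(2m + 1) points, at most 6m · 3m = 18m² for m ≥ 1.
    refine squeeze_zero_norm' (a := fun m : ℕ => 18 / (m : ℝ)) ?_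
      (tendsto_const_div_atTop_nhds_zero_nat _)
    filter_upwards [eventually_ge_atTop 1] with m hm
    have hm' : (1 : ℝ) ≤ m := by exact_mod_cast hm
    have hm0 : (0 : ℝ) < m := by linarith
    have e : (∑ n ∈ weightBox m, (count S m n : ℝ)) / (m : ℝ) ^ 3 -
        (∑ l ∈ Finset.Icc (-1 * m : ℤ) (1 * m), ∑ k ∈ Finset.Icc (-2 * m : ℤ) (3 * m),
          wedge S (1 - k / m) (l / m)) / (m : ℝ) ^ 2 =
        (∑ n ∈ weightBox m, ((count S m n : ℝ) - m * wedge S (1 - n.1 / m) (n.2 / m))) /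
          (m : ℝ) ^ 3 := by
      rw [Finset.sum_sub_distrib, ← Finset.mul_sum, weightBox,
        Finset.sum_product_right (f := fun n : ℤ × ℤ => wedge S (1 - n.1 / m) (n.2 / m))]
      field_simp
    rw [e, norm_div, Real.norm_eq_abs, Real.norm_of_nonneg (by positivity),
      div_le_div_iff₀ (by positivity) hm0]
    have hcard : ((weightBox m).card : ℝ) = (5 * m + 1) * (2 * m + 1) := by
      have : (weightBox m).card = (5 * m + 1) * (2 * m + 1) := by
        rw [weightBox, Finset.card_product, Int.card_Icc, Int.card_Icc]
        congr 1 <;> omega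
      exact_mod_cast this
    have hle := (Finset.abs_sum_le_sum_abs
      (fun n : ℤ × ℤ => (count S m n : ℝ) - m * wedge S (1 - n.1 / m) (n.2 / m)) _).trans
      (Finset.sum_le_card_nsmul (weightBox m) _ 1 fun n _ => abs_count_sub_le S hm n)
    rw [nsmul_eq_mul, mul_one, hcard] at hle
    have h18 : (5 * m + 1) * (2 * m + 1) ≤ 18 * (m : ℝ) ^ 2 := by nlinarith
    calc _ ≤ (18 * (m : ℝ) ^ 2) * m := mul_le_mul_of_nonneg_right (hle.trans h18) hm0.le
      _ = _ := by ring
  simpa using hdiff.add key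

lemma integral_max_zero {A b : ℝ} (hb : -2 ≤ b) (hA : -2 ≤ A) :
    ∫ u in (-2 : ℝ)..A, max 0 (u - b) = (max 0 (A - b)) ^ 2 / 2 := by
  have zero : ∀ {x y : ℝ}, x ≤ y → y ≤ b → ∫ u in x..y, max 0 (u - b) = 0 := fun {x y} h hy => by
    rw [intervalIntegral.integral_congr (g := fun _ => (0 : ℝ)) fun u hu => ?_]
    · simp
    · rw [uIcc_of_le h] at hu
      exact max_eq_left (by linarith [hu.2])
  have hi : ∀ x y : ℝ, IntervalIntegrable (fun u => max 0 (u - b)) MeasureTheory.volume x y :=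
    fun x y => Continuous.intervalIntegrable (by fun_prop) _ _
  rcases le_total A b with h | h
  · rw [zero hA h, max_eq_left (by linarith)]
    simp
  · rw [← intervalIntegral.integral_add_adjacent_intervals (hi _ b) (hi b _), zero hb le_rfl,
      max_eq_right (by linarith),
      intervalIntegral.integral_congr (g := fun u => u - b) fun u hu => ?_]
    · rw [intervalIntegral.integral_comp_sub_right (fun u => u), integral_id]
      ring
    · rw [uIcc_of_le h] at hu
      exact max_eq_right (by linarith [hu.1])

/-- The sum of the ramps max(0, u - rd) is non-decreasing in u and equals 1 at `A`, so `wedge` is 1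
minus this sum up to `A` and 0 beyond. The condition on `r * d` makes every ramp start inside the
window, so its integral up to `A` is half the square of its final height. -/
lemma area_eq {S : Finset ℤ} {d A : ℝ} (hA : ∑ r ∈ S, max 0 (A - r * d) = 1) (h1 : -2 ≤ A)
    (h2 : A ≤ 3) (hS : ∀ r ∈ S, -2 ≤ (r : ℝ) * d) :
    area S d = A + 2 - (∑ r ∈ S, (max 0 (A - r * d)) ^ 2) / 2 := by
  have hi : ∀ x y : ℝ, IntervalIntegrable (fun u => wedge S u d) MeasureTheory.volume x y :=
    fun x y => (continuous_wedge S d).intervalIntegrable _ _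
  have mono : ∀ {u v : ℝ}, u ≤ v →
      ∑ r ∈ S, max 0 (u - r * d) ≤ ∑ r ∈ S, max 0 (v - r * d) := fun h =>
    Finset.sum_le_sum fun r _ => max_le_max le_rfl (by linarith)
  rw [area, ← intervalIntegral.integral_add_adjacent_intervals (hi _ A) (hi A _),
    intervalIntegral.integral_congr (a := A) (g := fun _ => (0 : ℝ)) fun u hu => ?_,
    intervalIntegral.integral_congr (b := A)
      (g := fun u => 1 - ∑ r ∈ S, max 0 (u - r * d)) fun u hu => ?_]
  · rw [intervalIntegral.integral_sub (by simp)
      (Continuous.intervalIntegrable (by fun_prop) _ _),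
      intervalIntegral.integral_finsetSum
        fun r _ => Continuous.intervalIntegrable (by fun_prop) _ _,
      Finset.sum_congr rfl fun r hr => integral_max_zero (hS r hr) h1, ← Finset.sum_div]
    simp
  · rw [uIcc_of_le h1] at hu
    exact max_eq_right (by linarith [mono hu.2])
  · rw [uIcc_of_le h2] at hu
    exact max_eq_left (by linarith [mono hu.1])

lemma area_singleton {r : ℤ} {d : ℝ} (h1 : -2 ≤ (r : ℝ) * d) (h2 : (r : ℝ) * d ≤ 2) :
    area {r} d = 5 / 2 + r * d := by
  have h : max 0 (1 + r * d - r * d) = (1 : ℝ) := by rw [add_sub_cancel_right]; norm_num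
  rw [area_eq (A := 1 + r * d) (by simp) (by linarith) (by linarith)
    (by simpa using h1), Finset.sum_singleton, h]
  ring

lemma area_pair {r s : ℤ} (hrs : r ≠ s) {d A c₀ c₁ : ℝ} (h₀ : max 0 (A - r * d) = c₀)
    (h₁ : max 0 (A - s * d) = c₁) (hc : c₀ + c₁ = 1) (h1 : -2 ≤ A) (h2 : A ≤ 3)
    (hr : -2 ≤ (r : ℝ) * d) (hs : -2 ≤ (s : ℝ) * d) :
    area {r, s} d = A + 2 - (c₀ ^ 2 + c₁ ^ 2) / 2 := by
  rw [area_eq (A := A) (by rw [Finset.sum_pair hrs, h₀, h₁, hc]) h1 h2 (by simp [hr, hs]),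
    Finset.sum_pair hrs, h₀, h₁]

lemma sum_divisors {M : Type*} [AddCommMonoid M] (f : ℤ → M) :
    ∑ r ∈ ({-1, 0, 1, 2} : Finset ℤ), f r = f (-1) + (f 0 + (f 1 + f 2)) := by
  rw [Finset.sum_insert (by decide), Finset.sum_insert (by decide), Finset.sum_pair (by decide)]

lemma area_divisors {d A c₀ c₁ c₂ c₃ : ℝ} (h₀ : max 0 (A + d) = c₀) (h₁ : max 0 A = c₁)
    (h₂ : max 0 (A - d) = c₂) (h₃ : max 0 (A - 2 * d) = c₃) (hc : c₀ + (c₁ + (c₂ + c₃)) = 1)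
    (h1 : -2 ≤ A) (h2 : A ≤ 3) (hd : -1 ≤ d) (hd' : d ≤ 1) :
    area {-1, 0, 1, 2} d = A + 2 - (c₀ ^ 2 + (c₁ ^ 2 + (c₂ ^ 2 + c₃ ^ 2))) / 2 := by
  have e0 : A - ((-1 : ℤ) : ℝ) * d = A + d := by push_cast; ring
  have e1 : A - ((0 : ℤ) : ℝ) * d = A := by push_cast; ring
  have e2 : A - ((1 : ℤ) : ℝ) * d = A - d := by push_cast; ring
  have e3 : A - ((2 : ℤ) : ℝ) * d = A - 2 * d := by push_cast; ring
  rw [area_eq (A := A) (by rw [sum_divisors, e0, e1, e2, e3, h₀, h₁, h₂, h₃, hc]) h1 h2 ?_,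
    sum_divisors, e0, e1, e2, e3, h₀, h₁, h₂, h₃]
  intro r hr
  simp only [Finset.mem_insert, Finset.mem_singleton] at hr
  rcases hr with rfl | rfl | rfl | rfl <;> push_cast <;> linarith

/-- The integral of a function that agrees with a quadratic polynomial. -/
lemma integral_quadratic {f : ℝ → ℝ} {a b : ℝ} (α β γ : ℝ) (hab : a ≤ b)
    (h : ∀ x, a ≤ x → x ≤ b → f x = α + β * x + γ * x ^ 2) :
    IntervalIntegrable f MeasureTheory.volume a b ∧ ∫ x in a..b, f x =
      α * (b - a) + β * (b ^ 2 - a ^ 2) / 2 + γ * (b ^ 3 - a ^ 3) / 3 := by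
  have heq : EqOn f (fun x => α + β * x + γ * x ^ 2) (uIcc a b) := fun x hx => by
    rw [uIcc_of_le hab] at hx
    exact h x hx.1 hx.2
  have hc : Continuous fun x : ℝ => α + β * x + γ * x ^ 2 := by fun_prop
  refine ⟨(intervalIntegrable_congr fun x hx => heq (uIoc_subset_uIcc hx)).mpr
    (hc.intervalIntegrable _ _), ?_⟩
  rw [intervalIntegral.integral_congr heq]
  have hd : ∀ x ∈ uIcc a b, HasDerivAt (fun x => α * x + β * x ^ 2 / 2 + γ * x ^ 3 / 3)
      (α + β * x + γ * x ^ 2) x := fun x _ => by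
    have h1 := ((hasDerivAt_id x).const_mul α)
    have h2 := ((hasDerivAt_pow 2 x).const_mul β).div_const 2
    have h3 := ((hasDerivAt_pow 3 x).const_mul γ).div_const 3
    refine ((h1.add h2).add h3).congr_deriv ?_
    push_cast
    ring
  rw [intervalIntegral.integral_eq_sub_of_hasDerivAt hd (hc.intervalIntegrable _ _)]
  ring

/-! ### The explicit volumes -/

lemma integral_area_singleton_zero : ∫ d in (-1 : ℝ)..1, area {0} d = 5 := by
  rw [(integral_quadratic (5 / 2) 0 0 (by norm_num) fun d h1 h2 => ?_).2]
  · norm_num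
  · rw [area_singleton (by push_cast; linarith) (by push_cast; linarith)]
    push_cast
    ring

lemma integral_area_singleton_one : ∫ d in (-1 : ℝ)..1, area {1} d = 5 := by
  rw [(integral_quadratic (5 / 2) 1 0 (by norm_num) fun d h1 h2 => ?_).2]
  · norm_num
  · rw [area_singleton (by push_cast; linarith) (by push_cast; linarith)]
    push_cast
    ring

/-- For neighbouring divisors the ramps at the threshold have heights (1 ± d)/2, non-negative on all
of [-1, 1], so a single quadratic suffices; likewise for the next two pairs. -/
lemma integral_area_pair_left : ∫ d in (-1 : ℝ)..1, area {-1, 0} d = 13 / 3 := by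
  rw [(integral_quadratic (9 / 4) (-1 / 2) (-1 / 4) (by norm_num) fun d h1 h2 => ?_).2]
  · norm_num
  · rw [area_pair (by decide) (A := (1 - d) / 2) (c₀ := (1 + d) / 2) (c₁ := (1 - d) / 2)
      (by push_cast; rw [max_eq_right] <;> linarith)
      (by push_cast; rw [max_eq_right] <;> linarith) (by ring) (by linarith) (by linarith)
      (by push_cast; linarith) (by push_cast; linarith)]
    ring

lemma integral_area_pair_middle : ∫ d in (-1 : ℝ)..1, area {0, 1} d = 13 / 3 := by
  rw [(integral_quadratic (9 / 4) (1 / 2) (-1 / 4) (by norm_num) fun d h1 h2 => ?_).2]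
  · norm_num
  · rw [area_pair (by decide) (A := (1 + d) / 2) (c₀ := (1 + d) / 2) (c₁ := (1 - d) / 2)
      (by push_cast; rw [max_eq_right] <;> linarith)
      (by push_cast; rw [max_eq_right] <;> linarith) (by ring) (by linarith) (by linarith)
      (by push_cast; linarith) (by push_cast; linarith)]
    ring

lemma integral_area_pair_right : ∫ d in (-1 : ℝ)..1, area {1, 2} d = 13 / 3 := by
  rw [(integral_quadratic (9 / 4) (3 / 2) (-1 / 4) (by norm_num) fun d h1 h2 => ?_).2]
  · norm_num
  · rw [area_pair (by decide) (A := (1 + 3 * d) / 2) (c₀ := (1 + d) / 2) (c₁ := (1 - d) / 2)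
      (by push_cast; rw [max_eq_right] <;> linarith)
      (by push_cast; rw [max_eq_right] <;> linarith) (by ring) (by linarith) (by linarith)
      (by push_cast; linarith) (by push_cast; linarith)]
    ring

/-- The heights at the threshold are (1 ± 3d)/2 as long as |d| ≤ 1/3; beyond that one ramp is
inactive and the other reaches 1 alone. -/
lemma integral_area_pair_outer : ∫ d in (-1 : ℝ)..1, area {-1, 2} d = 31 / 9 := by
  obtain ⟨i1, e1⟩ := integral_quadratic (f := area {-1, 2}) (a := -1) (b := -1 / 3) (5 / 2) 2 0
    (by norm_num) fun d h1 h2 => by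
      rw [area_pair (by decide) (A := 1 + 2 * d) (c₀ := 0) (c₁ := 1)
        (by push_cast; rw [max_eq_left] ; linarith)
        (by push_cast; rw [max_eq_right] <;> linarith) (by ring) (by linarith) (by linarith)
        (by push_cast; linarith) (by push_cast; linarith)]
      ring
  obtain ⟨i2, e2⟩ := integral_quadratic (f := area {-1, 2}) (a := -1 / 3) (b := 1 / 3) (9 / 4)
    (1 / 2) (-9 / 4) (by norm_num) fun d h1 h2 => by
      rw [area_pair (by decide) (A := (1 + d) / 2) (c₀ := (1 + 3 * d) / 2)
        (c₁ := (1 - 3 * d) / 2)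
        (by push_cast; rw [max_eq_right] <;> linarith)
        (by push_cast; rw [max_eq_right] <;> linarith) (by ring) (by linarith) (by linarith)
        (by push_cast; linarith) (by push_cast; linarith)]
      ring
  obtain ⟨i3, e3⟩ := integral_quadratic (f := area {-1, 2}) (a := 1 / 3) (b := 1) (5 / 2) (-1) 0
    (by norm_num) fun d h1 h2 => by
      rw [area_pair (by decide) (A := 1 - d) (c₀ := 1) (c₁ := 0)
        (by push_cast; rw [max_eq_right] <;> linarith)
        (by push_cast; rw [max_eq_left] ; linarith) (by ring) (by linarith) (by linarith)
        (by push_cast; linarith) (by push_cast; linarith)]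
      ring
  rw [← intervalIntegral.integral_add_adjacent_intervals (i1.trans i2) i3,
    ← intervalIntegral.integral_add_adjacent_intervals i1 i2, e1, e2, e3]
  norm_num

/-- As d grows, the divisors with an active ramp at the threshold are {1, 2}, {0, 1, 2}, all four,
{-1, 0, 1}, {-1, 0}; the changes occur at ±1/3 and ±1/6. On each piece the threshold A solves a
linear equation. -/
lemma integral_area_divisors : ∫ d in (-1 : ℝ)..1, area {-1, 0, 1, 2} d = 715 / 216 := by
  obtain ⟨i1, e1⟩ := integral_quadratic (f := area {-1, 0, 1, 2}) (a := -1) (b := -1 / 3) (9 / 4)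
    (3 / 2) (-1 / 4) (by norm_num) fun d h1 h2 => by
      rw [area_divisors (A := (1 + 3 * d) / 2) (c₀ := 0) (c₁ := 0) (c₂ := (1 + d) / 2)
        (c₃ := (1 - d) / 2) (max_eq_left (by linarith)) (max_eq_left (by linarith))
        (by rw [max_eq_right] <;> linarith) (by rw [max_eq_right] <;> linarith) (by ring)
        (by linarith) (by linarith) (by linarith) (by linarith)]
      ring
  obtain ⟨i2, e2⟩ := integral_quadratic (f := area {-1, 0, 1, 2}) (a := -1 / 3) (b := -1 / 6)
    (13 / 6) 1 (-1) (by norm_num) fun d h1 h2 => by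
      rw [area_divisors (A := 1 / 3 + d) (c₀ := 0) (c₁ := 1 / 3 + d) (c₂ := 1 / 3)
        (c₃ := 1 / 3 - d) (max_eq_left (by linarith)) (max_eq_right (by linarith))
        (by rw [max_eq_right] <;> linarith) (by rw [max_eq_right] <;> linarith) (by ring)
        (by linarith) (by linarith) (by linarith) (by linarith)]
      ring
  obtain ⟨i3, e3⟩ := integral_quadratic (f := area {-1, 0, 1, 2}) (a := -1 / 6) (b := 1 / 6)
    (17 / 8) (1 / 2) (-5 / 2) (by norm_num) fun d h1 h2 => by
      rw [area_divisors (A := (1 + 2 * d) / 4) (c₀ := (1 + 6 * d) / 4) (c₁ := (1 + 2 * d) / 4)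
        (c₂ := (1 - 2 * d) / 4) (c₃ := (1 - 6 * d) / 4) (by rw [max_eq_right] <;> linarith)
        (max_eq_right (by linarith)) (by rw [max_eq_right] <;> linarith)
        (by rw [max_eq_right] <;> linarith) (by ring)
        (by linarith) (by linarith) (by linarith) (by linarith)]
      ring
  obtain ⟨i4, e4⟩ := integral_quadratic (f := area {-1, 0, 1, 2}) (a := 1 / 6) (b := 1 / 3)
    (13 / 6) 0 (-1) (by norm_num) fun d h1 h2 => by
      rw [area_divisors (A := 1 / 3) (c₀ := 1 / 3 + d) (c₁ := 1 / 3) (c₂ := 1 / 3 - d)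
        (c₃ := 0) (max_eq_right (by linarith)) (max_eq_right (by linarith))
        (max_eq_right (by linarith)) (max_eq_left (by linarith)) (by ring)
        (by linarith) (by linarith) (by linarith) (by linarith)]
      ring
  obtain ⟨i5, e5⟩ := integral_quadratic (f := area {-1, 0, 1, 2}) (a := 1 / 3) (b := 1) (9 / 4)
    (-1 / 2) (-1 / 4) (by norm_num) fun d h1 h2 => by
      rw [area_divisors (A := (1 - d) / 2) (c₀ := (1 + d) / 2) (c₁ := (1 - d) / 2) (c₂ := 0)
        (c₃ := 0) (by rw [max_eq_right] <;> linarith) (max_eq_right (by linarith))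
        (max_eq_left (by linarith)) (max_eq_left (by linarith)) (by ring)
        (by linarith) (by linarith) (by linarith) (by linarith)]
      ring
  rw [← intervalIntegral.integral_add_adjacent_intervals (((i1.trans i2).trans i3).trans i4) i5,
    ← intervalIntegral.integral_add_adjacent_intervals ((i1.trans i2).trans i3) i4,
    ← intervalIntegral.integral_add_adjacent_intervals (i1.trans i2) i3,
    ← intervalIntegral.integral_add_adjacent_intervals i1 i2, e1, e2, e3, e4, e5]
  norm_num

lemma count_singleton (r : ℤ) (m : ℕ) (n : ℤ × ℤ) : count {r} m n = m + 1 - ord m n r := by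
  rw [count, Finset.sum_singleton]

lemma count_pair {r s : ℤ} (h : r ≠ s) (m : ℕ) (n : ℤ × ℤ) :
    count {r, s} m n = m + 1 - (ord m n r + ord m n s) := by
  rw [count, Finset.sum_pair h]

lemma count_divisors (m : ℕ) (n : ℤ × ℤ) : count {-1, 0, 1, 2} m n =
    m + 1 - (ord m n (-1) + (ord m n 0 + (ord m n 1 + ord m n 2))) := by
  rw [count, sum_divisors]

lemma cast_extDim (m : ℕ) (n : ℤ × ℤ) :
    (extDim m n : ℝ) = count {-1, 2} m n - count {-1, 0, 1, 2} m n := by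
  have : extDim m n + count {-1, 0, 1, 2} m n = count {-1, 2} m n := by
    rw [extDim, count_pair (by decide), count_divisors]
    omega
  rw [← this]
  push_cast
  ring

/-- An Euler characteristic: the inner difference in `cechDim` is the rank of the coboundary, and
none of the differences between dimensions is truncated. -/
lemma cast_cechDim (m : ℕ) (n : ℤ × ℤ) :
    (cechDim m n : ℝ) = count {0} m n + count {1} m n -
      (count {-1, 0} m n + count {0, 1} m n + count {1, 2} m n) + count {-1, 0, 1, 2} m n := by
  have : cechDim m n + (count {-1, 0} m n + count {0, 1} m n + count {1, 2} m n) =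
      count {0} m n + count {1} m n + count {-1, 0, 1, 2} m n := by
    rw [cechDim, count_pair (by decide), count_pair (by decide), count_pair (by decide),
      count_singleton, count_singleton, count_divisors]
    omega
  have : ((cechDim m n : ℕ) : ℝ) + (count {-1, 0} m n + count {0, 1} m n + count {1, 2} m n) =
      count {0} m n + count {1} m n + count {-1, 0, 1, 2} m n := by exact_mod_cast this
  linarith

/-- The value is 31/9 - 715/216. -/
theorem tendsto_sum_extDim :
    Tendsto (fun m : ℕ => ((∑ n ∈ weightBox m, extDim m n : ℕ) : ℝ) / (m : ℝ) ^ 3) atTop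
      (𝓝 (29 / 216)) := by
  have h := (tendsto_sum_count {-1, 2}).sub (tendsto_sum_count {-1, 0, 1, 2})
  rw [integral_area_pair_outer, integral_area_divisors] at h
  convert h using 2 with m
  · simp only [Nat.cast_sum, cast_extDim, Finset.sum_sub_distrib]
    ring
  · norm_num

/-- The value is 5 + 5 - 3 · 13/3 + 715/216. -/
theorem tendsto_sum_cechDim :
    Tendsto (fun m : ℕ => ((∑ n ∈ weightBox m, cechDim m n : ℕ) : ℝ) / (m : ℝ) ^ 3) atTop
      (𝓝 (67 / 216)) := by
  have h := (((tendsto_sum_count {0}).add (tendsto_sum_count {1})).sub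
    (((tendsto_sum_count {-1, 0}).add (tendsto_sum_count {0, 1})).add
      (tendsto_sum_count {1, 2}))).add (tendsto_sum_count {-1, 0, 1, 2})
  rw [integral_area_singleton_zero, integral_area_singleton_one, integral_area_pair_left,
    integral_area_pair_middle, integral_area_pair_right, integral_area_divisors] at h
  convert h using 2 with m
  · simp only [Nat.cast_sum, cast_cechDim, Finset.sum_sub_distrib, Finset.sum_add_distrib]
    ring
  · norm_num

end A2Resolution

end

/-! ### The theorem -/

theorem proposition1 :
    (∀ W : TopologicalSpace.Opens A2Resolution, A2Resolution.exceptional ⊆ W →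
      (∀ m : ℕ, FiniteDimensional ℂ
        (SymmetricDifferential.ExtensionQuotient (ℂ × ℂ) m W A2Resolution.regular)) ∧
      Filter.Tendsto
        (fun m : ℕ => (Module.finrank ℂ
          (SymmetricDifferential.ExtensionQuotient (ℂ × ℂ) m W A2Resolution.regular) : ℝ)
            / (m : ℝ) ^ 3)
        Filter.atTop (nhds (29 / 216))) ∧
    (∀ m : ℕ, FiniteDimensional ℂ
      (SymmetricDifferential.CechH1 (ℂ × ℂ) m A2Resolution.chartDomain)) ∧
    Filter.Tendsto
      (fun m : ℕ => (Module.finrank ℂ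
        (SymmetricDifferential.CechH1 (ℂ × ℂ) m A2Resolution.chartDomain) : ℝ)
          / (m : ℝ) ^ 3)
      Filter.atTop (nhds (67 / 216)) := by
  refine ⟨fun W hW => ⟨fun m => (A2Resolution.finrank_extensionQuotient hW m).1, ?_⟩,
    fun m => (A2Resolution.finrank_cechH1 m).1, ?_⟩
  · simp only [(A2Resolution.finrank_extensionQuotient hW _).2]
    exact A2Resolution.tendsto_sum_extDim
  · simp only [(A2Resolution.finrank_cechH1 _).2]
    exact A2Resolution.tendsto_sum_cechDim
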